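/- **Setting.** Let $N,P\ge1$. For $\mathcal B\in\mathbb R^{N\times N\times P}$ let $\mathcal B_{(i)}$ be its mode-$i$ matricization, $\|\mathcal B\|_{\rm F}$ its Frobenius norm, and for $q=(q_1,q_2,q_3)$ let $\Theta(q)=\{\mathcal B:\operatorname{rank}\mathcal B_{(i)}\le q_i,\ i=1,2,3\}$. Let $\mathcal A\in\Theta(r_1,r_2,r_3)$ with $\mathcal A_{(1)}=(\mathbf A_1,\dots,\mathbf A_P)$, and let $\mathcal A(z)=\mathbf I_N-\mathbf A_1z-\dots-\mathbf A_Pz^P$ satisfy $\det\mathcal A(z)\ne0$ for all $|z|<1$. Let $(\mathbf y_n)_{n\in\mathbb Z}$ be a strictly stationary, centered, square integrable $\mathbb R^N$-valued process with $$\mathbf y_n=\sum_{j=1}^P\mathbf A_j\mathbf y_{n-j}+\boldsymbol\varepsilon_n,\qquad \boldsymbol\varepsilon_n=\boldsymbol\Sigma_\varepsilon^{1/2}\boldsymbol\xi_n ,\quad n\in\mathbb Z,$$ where $\boldsymbol\Sigma_\varepsilon$ is positive definite, the $\boldsymbol\xi_n$ are i.i.d. with mean $0$ and covariance $\mathbf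 I_N$, and the entries of each $\boldsymbol\xi_n$ are mutually independent and $\kappa^2$-sub-Gaussian, i.e. $\mathbb E e^{t\xi_{i,n}}\le e^{\kappa^2t^2/2}$ for all $t\in\mathbb R$. One observes $\widetilde{\mathbf y}_n=\mathbf y_n+\boldsymbol\eta_n$, $1\le n\le T$, where $(\boldsymbol\eta_n)_{1\le n\le T}$ is independent of $(\boldsymbol\varepsilon_n)_{n\in\mathbb Z}$ and $\max_{1\le n\le T}\max_{1\le i\le N}\mathbb E|\eta_{i,n}|^2\le C_0m^{-1/2}$. Put $$\kappa_L=\frac{\lambda_{\min}(\boldsymbol\Sigma_\varepsilon)}{\max_{|z|=1}\lambda_{\max}(\mathcal A^*(z)\mathcal A(z))},\qquad \kappa_U=\frac{\lambda_{\max}(\boldsymbol\Sigma_\varepsilon)}{\min_{|z|=1}\lambda_{\min}(\mathcal A^*(z)\mathcal A(z))},$$ $$d'_{\mathcal M}=(r_1+r_1')(r_2+r_2')(r_3+r_3')+N(r_1+r_1')+N(r_2+r_2')+P(r_3+r_3'),$$ $$L(\mathcal B)=\frac1T\sum_{n=P+1}^T\|\widetilde{\mathbf y}_n-\mathcal B_{(1)}\widetilde{\mathbf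 x}_n\|_2^2,\qquad \widetilde{\mathbf x}_n=(\widetilde{\mathbf y}_{n-1}^\top,\dots,\widetilde{\mathbf y}_{n-P}^\top)^\top .$$ **Algorithm.** Start from any $\widehat{\mathcal A}_0\in\Theta(r_1',r_2',r_3')$ (possibly random). Given $\widehat{\mathcal A}_{k-1}$, form $\widehat{\mathcal A}_{k-1}-\tau\nabla L(\widehat{\mathcal A}_{k-1})$ with step size $\tau=2/(3\kappa_U)$; then, successively for $i=1,2,3$, replace the mode-$i$ matricization of the current tensor by its truncated singular value decomposition keeping the $r_i'$ largest singular values (with any choice of the decomposition if it is not unique); the result is $\widehat{\mathcal A}_k$. **Theorem.** For every $P\ge1$ there are positive constants $c_1,C,c$ depending only on $P$, and for all $C_0,\underline\kappa>0$ there are positive constants $c_2,c_3$ depending only on $P,C_0,\underline\kappa$, such that the following holds in the above setting for all $N,T,m$, all $\delta>0$, and all $\mathcal A,\boldsymbol\Sigma_\varepsilon,\kappa$, $(r_i)$, $(r_i')$ with $\kappa_L\ge\underline\kappa$. Suppose that $$r_i'\ge\Big(\sqrt[3]{1+\tfrac{\kappa_L}{24\kappa_U}}-1\Big)^{-2}r_i\quad(i=1,2,3),$$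 $$T\ge c_1\max(\kappa^2,\kappa^4)(\kappa_U/\kappa_L)^2d'_{\mathcal M},\qquad m^{1/4}T^{2\delta}\ge c_2N^2P\exp(d'_{\mathcal M}),\qquad m^{1/4}\ge c_3T^{1+2\delta}.$$ Then $0<1-\frac{\kappa_L}{24\kappa_U}<1$, and with probability at least $$1-\exp(-c\,d'_{\mathcal M})-2\exp\big(-c\,T(\kappa_L/\kappa_U)^2\min\{\kappa^{-2},\kappa^{-4}\}\big)$$ one has, for all $K\ge0$, $$\|\widehat{\mathcal A}_K-\mathcal A\|_{\rm F}\le\Big(1-\frac{\kappa_L}{24\kappa_U}\Big)^K\|\widehat{\mathcal A}_0-\mathcal A\|_{\rm F}+\frac C{\kappa_L}\left[\big(\kappa^2\sqrt{\lambda_{\max}(\boldsymbol\Sigma_\varepsilon)\kappa_U}+\kappa\sqrt{\kappa_U}\big)\sqrt{\frac{d'_{\mathcal M}}T}+\frac{T^{1+2\delta}}{m^{1/4}}\right].$$ In particular the optimization error (the first term) converges linearly to zero in $K$. -/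

import Mathlib

open MeasureTheory ProbabilityTheory

namespace MLRHAR

noncomputable section

/-- Third-order tensors in `ℝ^{N × N × P}`; the norm of this Euclidean space is the Frobenius norm.
The entry `(i, j, k)` is the `(i, j)` entry of the coefficient matrix of lag `k + 1`. -/
abbrev Tensor3 (N P : ℕ) := EuclideanSpace ℝ (Fin N × Fin N × Fin P)

/-- Mode-1 matricization. -/
def unfold1 {N P : ℕ} (B : Tensor3 N P) : Matrix (Fin N) (Fin N × Fin P) ℝ :=
  Matrix.of fun i c => B (i, c.1, c.2)

/-- Mode-2 matricization. -/
def unfold2 {N P : ℕ} (B : Tensor3 N P) : Matrix (Fin N) (Fin N × Fin P) ℝ :=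
  Matrix.of fun j c => B (c.1, j, c.2)

/-- Mode-3 matricization. -/
def unfold3 {N P : ℕ} (B : Tensor3 N P) : Matrix (Fin P) (Fin N × Fin N) ℝ :=
  Matrix.of fun k c => B (c.1, c.2, k)

/-- The set `Θ(q₁, q₂, q₃)` of tensors whose mode-`i` matricization has rank at most `q_i`. -/
def tuckerSet (N P : ℕ) (q : Fin 3 → ℕ) : Set (Tensor3 N P) :=
  {B | (unfold1 B).rank ≤ q 0 ∧ (unfold2 B).rank ≤ q 1 ∧ (unfold3 B).rank ≤ q 2}

/-- `q₁ q₂ q₃ + N q₁ + N q₂ + P q₃`. -/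
def tuckerDim (N P : ℕ) (q : Fin 3 → ℕ) : ℕ :=
  q 0 * q 1 * q 2 + N * q 0 + N * q 1 + P * q 2

/-- `B` arises from `M` by taking a singular value decomposition of `M` and keeping the `q` largest
singular values. (The decomposition, hence `B`, need not be unique.) -/
def IsTruncatedSVD {a b : Type*} [Fintype a] [Fintype b] (q : ℕ) (M B : Matrix a b ℝ) : Prop :=
  ∃ (l : ℕ) (s : Fin l → ℝ) (u : Fin l → EuclideanSpace ℝ a) (v : Fin l → EuclideanSpace ℝ b),
    Orthonormal ℝ u ∧ Orthonormal ℝ v ∧ Antitone s ∧ (∀ k, 0 ≤ s k) ∧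
    M = ∑ k, s k • Matrix.vecMulVec (u k) (v k) ∧
    B = ∑ k with k.val < q, s k • Matrix.vecMulVec (u k) (v k)

/-- The stacked vector of lags `(v_{n-1}, …, v_{n-P})`. -/
def lagVec {N : ℕ} (P : ℕ) (v : ℤ → Fin N → ℝ) (n : ℤ) : Fin N × Fin P → ℝ :=
  fun c => v (n - 1 - (c.2.val : ℤ)) c.1

/-- Least squares loss `T⁻¹ ∑_{n = P+1}^T ‖v_n - B₍₁₎ x_n‖²`, `x_n = (v_{n-1}, …, v_{n-P})`. -/
def loss {N P : ℕ} (T : ℕ) (v : ℤ → Fin N → ℝ) (B : Tensor3 N P) : ℝ :=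
  (1 / (T : ℝ)) * ∑ n ∈ Finset.Icc ((P : ℤ) + 1) (T : ℤ),
    ∑ i, (v n i - (unfold1 B).mulVec (lagVec P v n) i) ^ 2

/-- One step `B ↦ B'` of projected gradient descent for the loss `L` with step size `τ` and running
ranks `q`: a gradient step, then truncated SVDs of the matricizations in modes 1, 2, 3 in turn. -/
def IsPGDStep {N P : ℕ} (L : Tensor3 N P → ℝ) (τ : ℝ) (q : Fin 3 → ℕ) (B B' : Tensor3 N P) :
    Prop :=
  ∃ B₁ B₂ : Tensor3 N P,
    IsTruncatedSVD (q 0) (unfold1 (B - τ • gradient L B)) (unfold1 B₁) ∧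
    IsTruncatedSVD (q 1) (unfold2 B₁) (unfold2 B₂) ∧
    IsTruncatedSVD (q 2) (unfold3 B₂) (unfold3 B')

/-- Smallest eigenvalue of a Hermitian matrix. -/
def lambdaMin {N : ℕ} {𝕜 : Type*} [RCLike 𝕜] (M : Matrix (Fin N) (Fin N) 𝕜) : ℝ :=
  sInf (spectrum ℝ M)

/-- Largest eigenvalue of a Hermitian matrix. -/
def lambdaMax {N : ℕ} {𝕜 : Type*} [RCLike 𝕜] (M : Matrix (Fin N) (Fin N) 𝕜) : ℝ :=
  sSup (spectrum ℝ M)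

/-- The matrix polynomial `A(z) = I - A₁ z - ⋯ - A_P z^P`. -/
def charPoly {N P : ℕ} (A : Tensor3 N P) (z : ℂ) : Matrix (Fin N) (Fin N) ℂ :=
  1 - ∑ k : Fin P, z ^ (k.val + 1) • Matrix.of fun i j => ((A (i, j, k) : ℝ) : ℂ)

/-- `μ_min(A) = min_{|z| = 1} λ_min(A(z)ᴴ A(z))`. -/
def muMin {N P : ℕ} (A : Tensor3 N P) : ℝ :=
  ⨅ z : Circle, lambdaMin ((charPoly A (z : ℂ)).conjTranspose * charPoly A (z : ℂ))

/-- `μ_max(A) = max_{|z| = 1} λ_max(A(z)ᴴ A(z))`. -/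
def muMax {N P : ℕ} (A : Tensor3 N P) : ℝ :=
  ⨆ z : Circle, lambdaMax ((charPoly A (z : ℂ)).conjTranspose * charPoly A (z : ℂ))

/-- `κ_L = λ_min(Σ) / μ_max(A)`. -/
def kappaL {N P : ℕ} (A : Tensor3 N P) (Sig : Matrix (Fin N) (Fin N) ℝ) : ℝ :=
  lambdaMin Sig / muMax A

/-- `κ_U = λ_max(Σ) / μ_min(A)`. -/
def kappaU {N P : ℕ} (A : Tensor3 N P) (Sig : Matrix (Fin N) (Fin N) ℝ) : ℝ :=
  lambdaMax Sig / muMin A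

/-- `{ξ_n}` are i.i.d. with mean zero and identity covariance matrix, and the entries of each `ξ_n`
are mutually independent and `κ²`-sub-Gaussian. -/
structure IsSubGaussianNoise {Ω : Type*} [MeasurableSpace Ω] (Pr : Measure Ω) {N : ℕ}
    (κ : NNReal) (ξ : ℤ → Ω → Fin N → ℝ) : Prop where
  measurable : ∀ n, Measurable (ξ n)
  indep : iIndepFun ξ Pr
  identDistrib : ∀ n, IdentDistrib (ξ n) (ξ 0) Pr Pr
  mean : ∀ n i, ∫ ω, ξ n ω i ∂Pr = 0
  cov : ∀ n i j, ∫ ω, ξ n ω i * ξ n ω j ∂Pr = if i = j then 1 else 0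
  indep_entries : ∀ n, iIndepFun (fun (i : Fin N) (ω : Ω) => ξ n ω i) Pr
  subGaussian : ∀ n i, HasSubgaussianMGF (fun ω => ξ n ω i) (κ ^ 2) Pr

/-- `{y_n}` is a strictly stationary, centered, square integrable process that satisfies the vector
autoregression `y_n = A₁ y_{n-1} + ⋯ + A_P y_{n-P} + S ξ_n`. -/
structure IsStationaryVAR {Ω : Type*} [MeasurableSpace Ω] (Pr : Measure Ω) {N P : ℕ}
    (A : Tensor3 N P) (S : Matrix (Fin N) (Fin N) ℝ) (ξ y : ℤ → Ω → Fin N → ℝ) : Prop where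
  measurable : ∀ n, Measurable (y n)
  stationary : ∀ h : ℤ, IdentDistrib (fun ω n => y n ω) (fun ω n => y (n + h) ω) Pr Pr
  memLp : ∀ n i, MemLp (fun ω => y n ω i) 2 Pr
  mean : ∀ n i, ∫ ω, y n ω i ∂Pr = 0
  recursion : ∀ n, ∀ᵐ ω ∂Pr,
    y n ω = (unfold1 A).mulVec (lagVec P (fun l => y l ω) n) + S.mulVec (ξ n ω)

/-- The estimation errors `η_1, …, η_T` satisfy `max_{n, i} E|η_{i,n}|² ≤ C₀ m^{-1/2}`. -/
def IsSmallEstimationError {Ω : Type*} [MeasurableSpace Ω] (Pr : Measure Ω) {N : ℕ}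
    (C₀ : ℝ) (m T : ℕ) (η : ℤ → Ω → Fin N → ℝ) : Prop :=
  ∀ n ∈ Finset.Icc (1 : ℤ) (T : ℤ), Measurable (η n) ∧ ∀ i,
    MemLp (fun ω => η n ω i) 2 Pr ∧ ∫ ω, |η n ω i| ^ 2 ∂Pr ≤ C₀ * (m : ℝ) ^ (-(1 / 2) : ℝ)

/-- `(κ² √(λ_max(Σ) κ_U) + κ √κ_U) √(d/T) + T^{1+2δ} / m^{1/4}`. -/
def statError {N P : ℕ} (A : Tensor3 N P) (Sig : Matrix (Fin N) (Fin N) ℝ) (κ δ : ℝ)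
    (d T m : ℕ) : ℝ :=
  (κ ^ 2 * √(lambdaMax Sig * kappaU A Sig) + κ * √(kappaU A Sig)) * √((d : ℝ) / T)
    + (T : ℝ) ^ (1 + 2 * δ) / (m : ℝ) ^ (1 / 4 : ℝ)

end

end MLRHAR

/-! The argument separates a deterministic statement about the algorithm from a probabilistic
statement about the data.

Deterministic part. Suppose the Gram matrix of the observed lag vectors lies between `4/5 κ_L T` and
`6/5 κ_U T`. In mode 1 a gradient step with `τ = 2/(3κ_U)` multiplies every row of the error by `I -
(2τ/T) ∑ xₙ xₙᵀ`, a contraction with factor `1 - κ_L/(3κ_U)`, and adds `2τ/T` times the score `∑ eₙ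
xₙᵀ` (`unfold1_gradientStep`, `nsq_sub_gram_le`). Truncation to rank `r'` is not a contraction
towards a matrix of rank `r`, but it expands distances by at most `1 + β` once `r ≤ β² (r' - r)`
(`IsTruncatedSVD.norm_sub_le`). The running ranks allow `β = κ_L/(36κ_U)`, and three such factors do
not destroy the contraction. The error after truncation depends only on a projection onto a subspace
of dimension at most `r + r'`, so the noise enters through its pairing with low-rank matrices. This
gives `pgd_step` and, by iteration, `pgd_converges`.

Probabilistic part. The hypotheses exclude roots of the characteristic polynomial only inside the
open disc; a root on the unit circle would turn a scalar projection of the process into a random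
walk, against stationarity (`IsStationaryVAR.det_charPoly_ne_zero`). Powers of the companion matrix
therefore vanish in the limit, and the process is close in mean square to one started at zero in the
distant past (`IsStationaryVAR.exists_zeroStart_close`), which is a linear image of finitely many
independent sub-Gaussian variables. Parseval's identity on roots of unity bounds the energy gain of
this linear map by `κ_U` and, through the inverse filter, by `κ_L` from below. The Hanson–Wright
inequality `hansonWright` and a net then give the Gram bounds (`exists_gram_event`). The score is a
martingale transform; an exponential supermartingale, evaluated where the Gram bound controls the
quadratic variation, and nets for both low-rank factors control it (`exists_score_event`).

Observation errors and the discarded distant past form one small perturbation. Markov's inequality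
bounds its total energy, and `conditions_of_perturbation` shows that the Gram and score bounds
survive it. `exists_good_event` collects the three exceptional sets. -/

namespace MLRHAR
open scoped Matrix
noncomputable section

/-- The squared Euclidean norm of a real vector. -/
def nsq {ι : Type*} [Fintype ι] (v : ι → ℝ) : ℝ := ∑ i, v i ^ 2

section nsq
variable {ι : Type*} [Fintype ι]

lemma nsq_nonneg (v : ι → ℝ) : 0 ≤ nsq v := Finset.sum_nonneg fun _ _ => sq_nonneg _

lemma nsq_smul (c : ℝ) (v : ι → ℝ) : nsq (c • v) = c ^ 2 * nsq v := by
  simp [nsq, mul_pow, Finset.mul_sum]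

lemma nsq_zero : nsq (0 : ι → ℝ) = 0 := by simp [nsq]

lemma nsq_eq_dotProduct (v : ι → ℝ) : nsq v = v ⬝ᵥ v := by simp [nsq, dotProduct, sq]

lemma dotProduct_sq_le (v w : ι → ℝ) : (v ⬝ᵥ w) ^ 2 ≤ nsq v * nsq w :=
  Finset.sum_mul_sq_le_sq_mul_sq _ _ _

lemma abs_dotProduct_le (v w : ι → ℝ) : |v ⬝ᵥ w| ≤ √(nsq v) * √(nsq w) := by
  rw [← Real.sqrt_mul (nsq_nonneg v)]
  exact Real.abs_le_sqrt (dotProduct_sq_le v w)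

lemma nsq_eq_norm_sq (v : EuclideanSpace ℝ ι) : nsq (fun i => v i) = ‖v‖ ^ 2 := by
  simp [nsq, EuclideanSpace.norm_sq_eq]

end nsq

/-! ### Exponential moments of linear and quadratic forms in sub-Gaussian variables -/

section mgf

variable {Ω : Type*} [MeasurableSpace Ω] {Pr : Measure Ω}

/-- The exponential with values in `[0, ∞]`. -/
def eexp (x : ℝ) : ENNReal := ENNReal.ofReal (Real.exp x)

lemma eexp_add (x y : ℝ) : eexp (x + y) = eexp x * eexp y := by
  rw [eexp, Real.exp_add, ENNReal.ofReal_mul (Real.exp_pos _).le]; rfl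

lemma eexp_zero : eexp 0 = 1 := by simp [eexp]

lemma eexp_sum {ι : Type*} (s : Finset ι) (f : ι → ℝ) : eexp (∑ i ∈ s, f i) = ∏ i ∈ s, eexp (f i) := by
  rw [eexp, Real.exp_sum, ENNReal.ofReal_prod_of_nonneg fun _ _ => (Real.exp_pos _).le]; rfl

lemma eexp_mono {x y : ℝ} (h : x ≤ y) : eexp x ≤ eexp y :=
  ENNReal.ofReal_le_ofReal (Real.exp_le_exp.2 h)

lemma measurable_eexp : Measurable eexp := ENNReal.measurable_ofReal.comp Real.measurable_exp

lemma eexp_ne_top (x : ℝ) : eexp x ≠ ⊤ := ENNReal.ofReal_ne_top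

lemma lintegral_comp_indepFun [IsProbabilityMeasure Pr] {E F : Type*} [MeasurableSpace E]
    [MeasurableSpace F] {X : Ω → E} {Y : Ω → F} (hX : Measurable X) (hY : Measurable Y)
    (h : IndepFun X Y Pr) {f : E → F → ENNReal} (hf : Measurable (Function.uncurry f)) :
    ∫⁻ ω, f (X ω) (Y ω) ∂Pr = ∫⁻ ω, ∫⁻ ω', f (X ω) (Y ω') ∂Pr ∂Pr := by
  have h1 := (indepFun_iff_map_prod_eq_prod_map_map hX.aemeasurable hY.aemeasurable).1 h
  have h2 : ∫⁻ ω, f (X ω) (Y ω) ∂Pr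
      = ∫⁻ p, Function.uncurry f p ∂(Pr.map fun ω => (X ω, Y ω)) := by
    rw [lintegral_map hf (hX.prodMk hY)]; rfl
  rw [h2, h1, lintegral_prod _ hf.aemeasurable, lintegral_map hf.lintegral_prod_right' hX]
  refine lintegral_congr fun ω => ?_
  exact lintegral_map (hf.comp measurable_prodMk_left) hY

lemma lintegral_eexp_of_subgaussian {X : Ω → ℝ} {c : NNReal} (h : HasSubgaussianMGF X c Pr) :
    ∫⁻ ω, eexp (X ω) ∂Pr ≤ eexp (c / 2) := by
  have h1 := h.mgf_le 1
  have h2 := h.integrable_exp_mul 1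
  simp only [one_mul, mgf, one_pow, mul_one] at h1 h2
  simp only [eexp]
  rw [← ofReal_integral_eq_lintegral_ofReal h2 (ae_of_all _ fun _ => (Real.exp_pos _).le)]
  exact ENNReal.ofReal_le_ofReal h1

/-- A linear combination of independent sub-Gaussian variables is sub-Gaussian. -/
lemma lintegral_eexp_dotProduct_le {ι : Type*} [Fintype ι] {ζ : ι → Ω → ℝ} {κ : NNReal}
    (hind : iIndepFun ζ Pr) (hsub : ∀ i, HasSubgaussianMGF (ζ i) (κ ^ 2) Pr) (a : ι → ℝ) :
    ∫⁻ ω, eexp (∑ i, a i * ζ i ω) ∂Pr ≤ eexp ((κ : ℝ) ^ 2 * nsq a / 2) := by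
  have h1 : iIndepFun (fun i ω => a i * ζ i ω) Pr :=
    hind.comp (fun i x => a i * x) (fun i => measurable_const_mul _)
  have h2 := HasSubgaussianMGF.sum_of_iIndepFun h1 (s := Finset.univ)
    (fun i _ => (hsub i).const_mul (a i))
  refine (lintegral_eexp_of_subgaussian h2).trans (eexp_mono ?_)
  apply le_of_eq
  push_cast
  simp only [nsq, Finset.mul_sum, Finset.sum_div]
  refine Finset.sum_congr rfl fun i _ => ?_
  show a i ^ 2 * ((κ : ℝ) ^ 2) / 2 = _
  ring

/-- The standard Gaussian measure on `ℝ^w`. -/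
abbrev gaussPi (w : Type*) [Fintype w] : Measure (w → ℝ) := Measure.pi fun _ => gaussianReal 0 1

lemma lintegral_gaussian_eexp_mul (a : ℝ) :
    ∫⁻ x, eexp (a * x) ∂gaussianReal 0 1 = eexp (a ^ 2 / 2) := by
  have h := mgf_gaussianReal (p := gaussianReal 0 1) (X := id) (μ := 0) (v := 1) (by simp) a
  simp only [mgf, id] at h
  have hi : Integrable (fun x => Real.exp (a * x)) (gaussianReal 0 1) := by
    by_contra hc
    rw [integral_undef hc] at h
    exact (Real.exp_pos _).ne h
  simp only [eexp]
  rw [← ofReal_integral_eq_lintegral_ofReal hi (ae_of_all _ fun _ => (Real.exp_pos _).le), h]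
  simp

/-- The integral equals `(1 - 2s)^(-1/2)`, and `(1 - 2s)⁻¹ ≤ 1 + 4s ≤ exp (4s)`; the first
inequality is where `s ≤ 1/4` enters. -/
lemma lintegral_gaussian_eexp_sq {s : ℝ} (hs : 0 ≤ s) (hs4 : s ≤ 1 / 4) :
    ∫⁻ x, eexp (s * x ^ 2) ∂gaussianReal 0 1 ≤ eexp (2 * s) := by
  rw [gaussianReal_of_var_ne_zero _ one_ne_zero,
    lintegral_withDensity_eq_lintegral_mul _ (measurable_gaussianPDF _ _)
      (show Measurable fun x : ℝ => eexp (s * x ^ 2) from measurable_eexp.comp (by fun_prop))]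
  have h1 : ∀ x : ℝ, (gaussianPDF 0 1 * fun x => eexp (s * x ^ 2)) x
      = ENNReal.ofReal ((√(2 * Real.pi))⁻¹ * Real.exp (-(1 / 2 - s) * x ^ 2)) := by
    intro x
    simp only [Pi.mul_apply, gaussianPDF, gaussianPDFReal, eexp]
    rw [← ENNReal.ofReal_mul (by positivity)]
    congr 1
    simp only [NNReal.coe_one, mul_one, sub_zero]
    rw [mul_assoc, ← Real.exp_add]
    congr 2; ring
  rw [lintegral_congr h1, ← ofReal_integral_eq_lintegral_ofReal
    ((integrable_exp_neg_mul_sq (by linarith)).const_mul _)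
    (ae_of_all _ fun _ => by positivity), integral_const_mul, integral_gaussian]
  apply ENNReal.ofReal_le_ofReal
  have h2 : (√(2 * Real.pi))⁻¹ * √(Real.pi / (1 / 2 - s)) = √((1 - 2 * s)⁻¹) := by
    rw [← Real.sqrt_inv, ← Real.sqrt_mul (by positivity)]
    congr 1
    have : (1 / 2 - s) ≠ 0 := by linarith
    have : (1 - 2 * s) ≠ 0 := by linarith
    field_simp
  rw [h2]
  have h3 : Real.exp (2 * s) = √(Real.exp (4 * s)) := by
    rw [show 4 * s = 2 * s + 2 * s by ring, Real.exp_add, Real.sqrt_mul_self (Real.exp_pos _).le]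
  rw [h3]
  apply Real.sqrt_le_sqrt
  rw [inv_le_comm₀ (by linarith) (Real.exp_pos _), ← Real.exp_neg]
  have h4 := Real.add_one_le_exp (4 * s)
  rw [Real.exp_neg, inv_le_comm₀ (Real.exp_pos _) (by linarith)]
  refine le_trans ?_ h4
  rw [inv_le_comm₀ (by linarith) (by linarith)]
  rw [inv_le_iff_one_le_mul₀ (by linarith)]
  nlinarith

lemma lintegral_gaussPi_prod {w : Type*} [Fintype w] (f : w → ℝ → ENNReal)
    (hf : ∀ k, Measurable (f k)) :
    ∫⁻ g, ∏ k, f k (g k) ∂gaussPi w = ∏ k, ∫⁻ x, f k x ∂gaussianReal 0 1 := by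
  have h0 : iIndepFun (fun k (g : w → ℝ) => f k (g k)) (gaussPi w) :=
    iIndepFun_pi (X := fun k => f k) (fun k => (hf k).aemeasurable)
  rw [lintegral_prod_eq_prod_lintegral_of_indepFun _ _ h0
    (fun k => (hf k).comp (measurable_pi_apply k))]
  refine Finset.prod_congr rfl fun k _ => ?_
  have := (measurePreserving_eval (fun _ : w => gaussianReal 0 1) k).lintegral_comp (hf k)
  exact this

/-- Exponential moments of `‖F ζ‖²` for a vector `ζ` of independent sub-Gaussian variables. -/
lemma lintegral_eexp_nsq_mulVec_le [IsProbabilityMeasure Pr] {ι w : Type*} [Fintype ι] [Fintype w]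
    {ζ : ι → Ω → ℝ} {κ : NNReal} (hm : ∀ i, Measurable (ζ i))
    (hind : iIndepFun ζ Pr) (hsub : ∀ i, HasSubgaussianMGF (ζ i) (κ ^ 2) Pr)
    (F : Matrix w ι ℝ) {b μ : ℝ} (hF : ∀ v, nsq (v ᵥ* F) ≤ b * nsq v) (hμ : 0 ≤ μ) (hb : 0 ≤ b)
    (hμb : μ * κ ^ 2 * b ≤ 1 / 4) :
    ∫⁻ ω, eexp (μ * nsq (F *ᵥ fun i => ζ i ω)) ∂Pr
      ≤ eexp (2 * (μ * κ ^ 2 * b) * Fintype.card w) := by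
  -- Gaussian linearization: the exponential of a square is a Gaussian average of exponentials of
  -- linear forms. After exchanging the integrals, `ζ` enters linearly for each fixed `g`, and what
  -- is left is the moment of a square of a Gaussian.
  have h1 : ∀ ω, eexp (μ * nsq (F *ᵥ fun i => ζ i ω))
      = ∫⁻ g, eexp (∑ k, √(2 * μ) * (F *ᵥ fun i => ζ i ω) k * g k) ∂gaussPi w := by
    intro ω
    simp_rw [eexp_sum]
    rw [lintegral_gaussPi_prod (fun k x => eexp (√(2 * μ) * (F *ᵥ fun i => ζ i ω) k * x))
      (fun k => measurable_eexp.comp (measurable_const_mul _))]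
    simp_rw [lintegral_gaussian_eexp_mul, ← eexp_sum]
    congr 1
    simp only [nsq, Finset.mul_sum]
    refine Finset.sum_congr rfl fun k _ => ?_
    rw [mul_pow, Real.sq_sqrt (by linarith)]; ring
  have hmeas : Measurable fun p : Ω × (w → ℝ) =>
      eexp (∑ k, √(2 * μ) * (F *ᵥ fun i => ζ i p.1) k * p.2 k) := by
    refine measurable_eexp.comp ?_
    simp only [Matrix.mulVec, dotProduct]
    fun_prop
  simp_rw [h1]
  rw [lintegral_lintegral_swap hmeas.aemeasurable]
  have h2 : ∀ g : w → ℝ, ∫⁻ ω, eexp (∑ k, √(2 * μ) * (F *ᵥ fun i => ζ i ω) k * g k) ∂Pr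
      ≤ ∏ k, eexp (μ * κ ^ 2 * b * g k ^ 2) := by
    intro g
    have e : ∀ ω, ∑ k, √(2 * μ) * (F *ᵥ fun i => ζ i ω) k * g k
        = ∑ i, (√(2 * μ) • (g ᵥ* F)) i * ζ i ω := by
      intro ω
      have := Matrix.dotProduct_mulVec g F (fun i => ζ i ω)
      simp only [Pi.smul_apply, smul_eq_mul, mul_assoc, ← Finset.mul_sum]
      simp only [dotProduct] at this
      rw [← this]
      congr 1
      exact Finset.sum_congr rfl fun k _ => mul_comm _ _
    simp_rw [e]
    refine (lintegral_eexp_dotProduct_le hind hsub _).trans ?_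
    rw [← eexp_sum, nsq_smul, Real.sq_sqrt (by linarith)]
    apply eexp_mono
    rw [← Finset.mul_sum]
    have := hF g
    have h3 : (0:ℝ) ≤ μ * κ ^ 2 := by positivity
    calc (κ : ℝ) ^ 2 * (2 * μ * nsq (g ᵥ* F)) / 2 = μ * κ ^ 2 * nsq (g ᵥ* F) := by ring
      _ ≤ μ * κ ^ 2 * (b * nsq g) := by gcongr
      _ = μ * κ ^ 2 * b * ∑ k, g k ^ 2 := by rw [nsq]; ring
  refine (lintegral_mono h2).trans ?_
  rw [lintegral_gaussPi_prod (fun _ x => eexp (μ * κ ^ 2 * b * x ^ 2))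
    (fun _ => measurable_eexp.comp (by fun_prop))]
  calc _ ≤ ∏ _k : w, eexp (2 * (μ * κ ^ 2 * b)) :=
        Finset.prod_le_prod' fun _ _ => lintegral_gaussian_eexp_sq (by positivity) hμb
    _ = _ := by rw [← eexp_sum]; simp [mul_comm]

end mgf
end
end MLRHAR

namespace MLRHAR
open scoped Matrix
noncomputable section
-- Decoupling of the off-diagonal part of a quadratic form
section hansonWright
variable {Ω : Type*} [MeasurableSpace Ω] {Pr : Measure Ω}
variable {ι w : Type*} [Fintype ι] [Fintype w]
set_option linter.unusedSectionVars false

/-- The vector that agrees with `x` on `{i | ε i = b}` and vanishes elsewhere. -/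
def mask (ε : ι → Bool) (b : Bool) (x : ι → ℝ) : ι → ℝ := fun i => if ε i = b then x i else 0

lemma flip_involutive [DecidableEq ι] (i : ι) :
    Function.Involutive fun ε : ι → Bool => Function.update ε i (!ε i) := by
  intro ε
  funext k
  by_cases h : k = i
  · subst h; simp
  · simp [h]

/-- Flipping one coordinate is a bijection of the sign patterns. Hence half of them have `ε j =
false`, and half of those have `ε i = true`. -/
lemma sum_signs [DecidableEq ι] {i j : ι} (hij : i ≠ j) :
    4 * ∑ ε : ι → Bool, (if ε i = true then (1 : ℝ) else 0) * (if ε j = false then 1 else 0)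
      = 2 ^ Fintype.card ι := by
  have h1 := Equiv.sum_comp ((flip_involutive i).toPerm _)
    (fun ε : ι → Bool => (if ε i = true then (1 : ℝ) else 0) * (if ε j = false then 1 else 0))
  have h2 := Equiv.sum_comp ((flip_involutive j).toPerm _)
    (fun ε : ι → Bool => (if ε j = false then (1 : ℝ) else 0))
  have h3 : ∑ ε : ι → Bool, (1 : ℝ) = 2 ^ Fintype.card ι := by simp
  have h4 : ∀ ε : ι → Bool, (if (((flip_involutive j).toPerm _) ε) j = false then (1 : ℝ) else 0)
      = 1 - if ε j = false then (1 : ℝ) else 0 := by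
    intro ε
    simp only [Function.Involutive.coe_toPerm, Function.update_self]
    cases ε j <;> simp
  have h5 : ∀ ε : ι → Bool, (if (((flip_involutive i).toPerm _) ε) i = true then (1 : ℝ) else 0)
        * (if (((flip_involutive i).toPerm _) ε) j = false then 1 else 0)
      = (if ε j = false then (1 : ℝ) else 0)
        - (if ε i = true then (1 : ℝ) else 0) * (if ε j = false then 1 else 0) := by
    intro ε
    simp only [Function.Involutive.coe_toPerm, Function.update_self,
      Function.update_of_ne hij.symm]
    cases ε i <;> cases ε j <;> simp
  simp_rw [h4] at h2
  simp_rw [h5] at h1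
  rw [Finset.sum_sub_distrib] at h1 h2
  linarith

lemma nsq_mulVec_expand (F : Matrix w ι ℝ) (x y : ι → ℝ) :
    (F *ᵥ x) ⬝ᵥ (F *ᵥ y) = ∑ i, ∑ j, (Fᵀ * F) i j * (x i * y j) := by
  have : (F *ᵥ x) ⬝ᵥ (F *ᵥ y) = x ⬝ᵥ ((Fᵀ * F) *ᵥ y) := by
    rw [← Matrix.mulVec_mulVec, Matrix.dotProduct_mulVec x, Matrix.vecMul_transpose]
  rw [this]
  simp only [dotProduct, Matrix.mulVec, Finset.mul_sum]
  exact Finset.sum_congr rfl fun i _ => Finset.sum_congr rfl fun j _ => by ring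

/-- Averaging over all splittings recovers a quarter of the off-diagonal part. -/
lemma sum_mask_eq [DecidableEq ι] (F : Matrix w ι ℝ) (x : ι → ℝ) :
    4 * ∑ ε : ι → Bool, (F *ᵥ mask ε true x) ⬝ᵥ (F *ᵥ mask ε false x)
      = 2 ^ Fintype.card ι * (nsq (F *ᵥ x) - ∑ i, (Fᵀ * F) i i * x i ^ 2) := by
  have h1 : ∀ ε : ι → Bool, (F *ᵥ mask ε true x) ⬝ᵥ (F *ᵥ mask ε false x)
      = ∑ i, ∑ j, (Fᵀ * F) i j * (x i * x j) *
        ((if ε i = true then (1 : ℝ) else 0) * (if ε j = false then 1 else 0)) := by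
    intro ε
    rw [nsq_mulVec_expand]
    refine Finset.sum_congr rfl fun i _ => Finset.sum_congr rfl fun j _ => ?_
    simp only [mask]
    split_ifs <;> ring
  simp_rw [h1]
  rw [Finset.sum_comm, nsq_eq_dotProduct, nsq_mulVec_expand, ← Finset.sum_sub_distrib,
    Finset.mul_sum, Finset.mul_sum]
  refine Finset.sum_congr rfl fun i _ => ?_
  rw [Finset.sum_comm]
  have h2 : ∑ j, (Fᵀ * F) i j * (x i * x j) - (Fᵀ * F) i i * x i ^ 2
      = ∑ j ∈ Finset.univ.erase i, (Fᵀ * F) i j * (x i * x j) := by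
    rw [← Finset.add_sum_erase _ _ (Finset.mem_univ i)]; ring
  rw [h2, ← Finset.add_sum_erase _ _ (Finset.mem_univ i)]
  have h3 : ∑ ε : ι → Bool, (Fᵀ * F) i i * (x i * x i) *
      ((if ε i = true then (1 : ℝ) else 0) * (if ε i = false then 1 else 0)) = 0 := by
    refine Finset.sum_eq_zero fun ε _ => ?_
    cases ε i <;> simp
  rw [h3, zero_add, Finset.mul_sum, Finset.mul_sum]
  refine Finset.sum_congr rfl fun j hj => ?_
  rw [← sum_signs (Finset.ne_of_mem_erase hj).symm, ← Finset.mul_sum]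
  ring

lemma indepFun_mask {ζ : ι → Ω → ℝ} (hm : ∀ i, Measurable (ζ i)) (hind : iIndepFun ζ Pr)
    (ε : ι → Bool) :
    IndepFun (fun ω => mask ε true fun i => ζ i ω) (fun ω => mask ε false fun i => ζ i ω) Pr := by
  classical
  have h := hind.indepFun_finset (Finset.univ.filter fun i => ε i = true)
    (Finset.univ.filter fun i => ε i = false)
    (Finset.disjoint_filter.2 fun i _ h1 h2 => by simp_all) hm
  let e : ∀ b : Bool, ((Finset.univ.filter fun i => ε i = b) → ℝ) → ι → ℝ :=
    fun b x i => if h : ε i = b then x ⟨i, by simp [h]⟩ else 0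
  have he : ∀ b, Measurable (e b) := by
    intro b
    refine measurable_pi_lambda _ fun i => ?_
    by_cases hi : ε i = b
    · simp only [e, hi, dite_true]; exact measurable_pi_apply _
    · simp only [e, hi, dite_false]; exact measurable_const
  have := h.comp (he true) (he false)
  convert! this using 1

/-- A matrix and its transpose have the same operator norm: `‖Fᵀv‖² = ⟨v, F Fᵀ v⟩`, then
Cauchy–Schwarz and division by `‖Fᵀv‖²`. -/
lemma nsq_vecMul_le (F : Matrix w ι ℝ) {b : ℝ} (hb : 0 ≤ b) (hF : ∀ x, nsq (F *ᵥ x) ≤ b * nsq x)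
    (v : w → ℝ) : nsq (v ᵥ* F) ≤ b * nsq v := by
  have h1 : nsq (v ᵥ* F) = v ⬝ᵥ (F *ᵥ (v ᵥ* F)) := by
    rw [nsq_eq_dotProduct, Matrix.dotProduct_mulVec]
  have h2 := dotProduct_sq_le v (F *ᵥ (v ᵥ* F))
  rw [← h1] at h2
  have h3 := hF (v ᵥ* F)
  have h4 := nsq_nonneg v
  have h5 := nsq_nonneg (v ᵥ* F)
  rcases h5.eq_or_lt with h | h
  · rw [← h]; positivity
  · have : nsq (v ᵥ* F) * nsq (v ᵥ* F) ≤ (b * nsq v) * nsq (v ᵥ* F) := by nlinarith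
    exact le_of_mul_le_mul_right this h

lemma nsq_mask_le (ε : ι → Bool) (b : Bool) (x : ι → ℝ) : nsq (mask ε b x) ≤ nsq x := by
  refine Finset.sum_le_sum fun i _ => ?_
  simp only [mask]
  split_ifs
  · exact le_rfl
  · simpa using sq_nonneg (x i)

lemma measurable_mask (ε : ι → Bool) (b : Bool) : Measurable (mask ε b : (ι → ℝ) → ι → ℝ) := by
  refine measurable_pi_lambda _ fun i => ?_
  simp only [mask]
  split_ifs
  · exact measurable_pi_apply i
  · exact measurable_const

/-- The two masked halves of `ζ` are independent. For a fixed first half the second enters linearly,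
so integrating it out leaves `exp (8 λ² κ² b ‖F x‖²)` in the first half, and the quadratic moment
bound applies. Its smallness condition `8 (λκ²b)² ≤ 1/4` is `hlam`. -/
lemma lintegral_decoupled_le [IsProbabilityMeasure Pr]
    {ζ : ι → Ω → ℝ} {κ : NNReal} (hm : ∀ i, Measurable (ζ i))
    (hind : iIndepFun ζ Pr) (hsub : ∀ i, HasSubgaussianMGF (ζ i) (κ ^ 2) Pr)
    (F : Matrix w ι ℝ) {b lam : ℝ} (hb : 0 ≤ b) (hF : ∀ x, nsq (F *ᵥ x) ≤ b * nsq x)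
    (hlam : 32 * (lam * κ ^ 2 * b) ^ 2 ≤ 1) (ε : ι → Bool) :
    ∫⁻ ω, eexp (4 * lam * ((F *ᵥ mask ε true fun i => ζ i ω) ⬝ᵥ
        (F *ᵥ mask ε false fun i => ζ i ω))) ∂Pr
      ≤ eexp (16 * (lam * κ ^ 2 * b) ^ 2 * Fintype.card w) := by
  have hmv : Measurable fun ω i => ζ i ω := measurable_pi_lambda _ hm
  rw [lintegral_comp_indepFun (X := fun ω => mask ε true fun i => ζ i ω)
    (Y := fun ω => mask ε false fun i => ζ i ω) ((measurable_mask ε true).comp hmv)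
    ((measurable_mask ε false).comp hmv) (indepFun_mask hm hind ε)
    (f := fun x y => eexp (4 * lam * ((F *ᵥ x) ⬝ᵥ (F *ᵥ y))))
    (measurable_eexp.comp (by simp only [Matrix.mulVec, dotProduct]; fun_prop))]
  -- The mask is moved from the vector to the columns of the matrix, so that the quadratic bound can
  -- be applied to the full vector `ζ`.
  set FI : Matrix w ι ℝ := Matrix.of fun k i => if ε i = true then F k i else 0 with hFI
  have hFIm : ∀ x : ι → ℝ, F *ᵥ mask ε true x = FI *ᵥ x := by
    intro x
    funext k
    simp only [Matrix.mulVec, dotProduct, mask, hFI, Matrix.of_apply]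
    refine Finset.sum_congr rfl fun i _ => ?_
    split_ifs <;> simp
  have hinner : ∀ x : ι → ℝ, ∫⁻ ω, eexp (4 * lam * ((F *ᵥ x) ⬝ᵥ
      (F *ᵥ mask ε false fun i => ζ i ω))) ∂Pr
      ≤ eexp ((8 * lam ^ 2 * κ ^ 2 * b) * nsq (F *ᵥ x)) := by
    intro x
    have e : ∀ ω, 4 * lam * ((F *ᵥ x) ⬝ᵥ (F *ᵥ mask ε false fun i => ζ i ω))
        = ∑ i, (mask ε false ((4 * lam) • ((F *ᵥ x) ᵥ* F))) i * ζ i ω := by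
      intro ω
      rw [Matrix.dotProduct_mulVec, dotProduct, Finset.mul_sum]
      refine Finset.sum_congr rfl fun i _ => ?_
      simp only [mask, Pi.smul_apply, smul_eq_mul]
      split_ifs <;> ring
    simp_rw [e]
    refine (lintegral_eexp_dotProduct_le hind hsub _).trans (eexp_mono ?_)
    have h1 := nsq_mask_le ε false ((4 * lam) • ((F *ᵥ x) ᵥ* F))
    rw [nsq_smul] at h1
    have h2 := nsq_vecMul_le F hb hF (F *ᵥ x)
    have h3 : nsq (mask ε false ((4 * lam) • ((F *ᵥ x) ᵥ* F)))
        ≤ (4 * lam) ^ 2 * (b * nsq (F *ᵥ x)) := h1.trans (by gcongr)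
    calc (κ : ℝ) ^ 2 * nsq (mask ε false ((4 * lam) • ((F *ᵥ x) ᵥ* F))) / 2
        ≤ (κ : ℝ) ^ 2 * ((4 * lam) ^ 2 * (b * nsq (F *ᵥ x))) / 2 := by gcongr
      _ = _ := by ring
  refine (lintegral_mono fun ω => hinner _).trans ?_
  simp_rw [hFIm]
  have hFIv : ∀ v, nsq (v ᵥ* FI) ≤ b * nsq v := by
    intro v
    refine le_trans ?_ (nsq_vecMul_le F hb hF v)
    have : v ᵥ* FI = mask ε true (v ᵥ* F) := by
      funext i
      simp only [Matrix.vecMul, dotProduct, mask, hFI, Matrix.of_apply]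
      split_ifs <;> simp
    rw [this]
    exact nsq_mask_le _ _ _
  refine (lintegral_eexp_nsq_mulVec_le hm hind hsub FI hFIv (by positivity) hb ?_).trans
    (eexp_mono (le_of_eq (by ring)))
  nlinarith

lemma eexp_average_le {α : Type*} [Fintype α] {c : ℝ} (hc0 : 0 ≤ c) (hcs : ∑ _a : α, c = 1)
    (f : α → ℝ) : eexp (c * ∑ a, f a) ≤ ∑ a, ENNReal.ofReal c * eexp (f a) := by
  have h4 := convexOn_exp.map_sum_le (t := Finset.univ) (w := fun _ : α => c)
    (p := f) (fun _ _ => hc0) hcs (fun _ _ => Set.mem_univ _)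
  simp only [smul_eq_mul] at h4
  rw [Finset.mul_sum]
  refine (ENNReal.ofReal_le_ofReal h4).trans (le_of_eq ?_)
  rw [ENNReal.ofReal_sum_of_nonneg fun _ _ => mul_nonneg hc0 (Real.exp_pos _).le]
  refine Finset.sum_congr rfl fun ε _ => ?_
  rw [ENNReal.ofReal_mul hc0]; rfl

lemma measurable_decoupled {ζ : ι → Ω → ℝ} (hm : ∀ i, Measurable (ζ i)) (F : Matrix w ι ℝ)
    (c : ℝ) (ε : ι → Bool) : Measurable fun ω => c *
      ((F *ᵥ mask ε true fun i => ζ i ω) ⬝ᵥ (F *ᵥ mask ε false fun i => ζ i ω)) := by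
  have hmv : Measurable fun ω i => ζ i ω := measurable_pi_lambda _ hm
  have h1 : ∀ b, Measurable fun ω => mask ε b fun i => ζ i ω :=
    fun b => (measurable_mask ε b).comp hmv
  have h2 : ∀ b i, Measurable fun ω => mask ε b (fun i => ζ i ω) i :=
    fun b i => (measurable_pi_apply i).comp (h1 b)
  simp only [Matrix.mulVec, dotProduct]
  fun_prop

/-- Exponential moments of the off-diagonal part of `‖F ζ‖²`. -/
lemma lintegral_offDiag_le [IsProbabilityMeasure Pr]
    {ζ : ι → Ω → ℝ} {κ : NNReal} (hm : ∀ i, Measurable (ζ i))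
    (hind : iIndepFun ζ Pr) (hsub : ∀ i, HasSubgaussianMGF (ζ i) (κ ^ 2) Pr)
    (F : Matrix w ι ℝ) {b lam : ℝ} (hb : 0 ≤ b) (hF : ∀ x, nsq (F *ᵥ x) ≤ b * nsq x)
    (hlam : 32 * (lam * κ ^ 2 * b) ^ 2 ≤ 1) :
    ∫⁻ ω, eexp (lam * (nsq (F *ᵥ fun i => ζ i ω) - ∑ i, (Fᵀ * F) i i * ζ i ω ^ 2)) ∂Pr
      ≤ eexp (16 * (lam * κ ^ 2 * b) ^ 2 * Fintype.card w) := by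
  classical
  obtain ⟨c, hc⟩ : ∃ c : ℝ, c = (2 ^ Fintype.card ι)⁻¹ := ⟨_, rfl⟩
  have hc0 : 0 ≤ c := by rw [hc]; positivity
  have hcs : ∑ _ε : ι → Bool, c = 1 := by simp [hc]
  -- The off-diagonal part is the uniform average over all splittings of four times the decoupled
  -- form; Jensen's inequality takes the average out of the exponential.
  have h1 : ∀ ω, eexp (lam * (nsq (F *ᵥ fun i => ζ i ω) - ∑ i, (Fᵀ * F) i i * ζ i ω ^ 2))
      ≤ ∑ ε : ι → Bool, ENNReal.ofReal c * eexp (4 * lam * ((F *ᵥ mask ε true fun i => ζ i ω) ⬝ᵥ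
        (F *ᵥ mask ε false fun i => ζ i ω))) := by
    intro ω
    refine le_trans (le_of_eq ?_) (eexp_average_le hc0 hcs _)
    congr 1
    rw [← Finset.mul_sum, mul_comm 4 lam, mul_assoc lam, sum_mask_eq F (fun i => ζ i ω), hc]
    have : (2 : ℝ) ^ Fintype.card ι ≠ 0 := by positivity
    field_simp
  refine (lintegral_mono h1).trans ?_
  have hmm := fun ε => measurable_eexp.comp (measurable_decoupled hm F (4 * lam) ε)
  simp only [Function.comp_def] at hmm
  rw [lintegral_finsetSum _ fun ε _ => (hmm ε).const_mul _]
  calc _ ≤ ∑ _ε : ι → Bool,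
        ENNReal.ofReal c * eexp (16 * (lam * κ ^ 2 * b) ^ 2 * Fintype.card w) := by
        refine Finset.sum_le_sum fun ε _ => ?_
        rw [lintegral_const_mul _ (hmm ε)]
        gcongr
        exact lintegral_decoupled_le hm hind hsub F hb hF hlam ε
    _ = _ := by
        rw [← Finset.sum_mul, ← ENNReal.ofReal_sum_of_nonneg fun _ _ => hc0, hcs]; simp

end hansonWright
end
end MLRHAR

namespace MLRHAR
open scoped Matrix
noncomputable section
-- Diagonal part and the Hanson–Wright inequality
section hansonWright
variable {Ω : Type*} [MeasurableSpace Ω] {Pr : Measure Ω}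
variable {ι w : Type*} [Fintype ι] [Fintype w]
set_option linter.unusedSectionVars false

lemma exp_le_quadratic (x : ℝ) : Real.exp x ≤ 1 + x + x ^ 2 * Real.exp |x| := by
  rcases le_or_gt |x| 1 with h | h
  · have h1 := Real.abs_exp_sub_one_sub_id_le h
    have h2 := abs_le.1 h1
    have h3 : 1 ≤ Real.exp |x| := Real.one_le_exp (abs_nonneg x)
    nlinarith [sq_nonneg x]
  · rcases le_or_gt 0 x with hx | hx
    · rw [abs_of_nonneg hx] at h ⊢
      have h5 := mul_le_mul_of_nonneg_right (one_le_pow₀ h.le (n := 2)) (Real.exp_pos x).le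
      linarith
    · rw [abs_of_neg hx] at h ⊢
      have h3 : Real.exp x ≤ 1 := Real.exp_le_one_iff.2 hx.le
      have h4 := Real.add_one_le_exp (-x)
      nlinarith [sq_nonneg x, Real.exp_pos (-x)]

lemma sq_le_exp {u : ℝ} (hu : 0 ≤ u) : u ^ 2 ≤ 512 * Real.exp (u / 16) := by
  have h := Real.quadratic_le_exp_of_nonneg (x := u / 16) (by positivity)
  nlinarith

lemma integrable_of_lintegral_eexp_le [IsProbabilityMeasure Pr] {Y : Ω → ℝ} (hY : Measurable Y)
    {K : ℝ} (h : ∫⁻ ω, eexp (Y ω) ∂Pr ≤ eexp K) :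
    Integrable (fun ω => Real.exp (Y ω)) Pr ∧ ∫ ω, Real.exp (Y ω) ∂Pr ≤ Real.exp K := by
  have hm : Measurable fun ω => Real.exp (Y ω) := Real.measurable_exp.comp hY
  have hi : Integrable (fun ω => Real.exp (Y ω)) Pr := by
    refine ⟨hm.aestronglyMeasurable, ?_⟩
    rw [hasFiniteIntegral_iff_ofReal (ae_of_all _ fun _ => (Real.exp_pos _).le)]
    exact lt_of_le_of_lt h ENNReal.ofReal_lt_top
  refine ⟨hi, ?_⟩
  have := ofReal_integral_eq_lintegral_ofReal hi (ae_of_all _ fun _ => (Real.exp_pos _).le)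
  have h2 : ENNReal.ofReal (∫ ω, Real.exp (Y ω) ∂Pr) ≤ eexp K := this ▸ h
  exact (ENNReal.ofReal_le_ofReal_iff (Real.exp_pos _).le).1 h2

/-- The case of one variable and `F = 1` of the quadratic moment bound, with `μ = 1/(8κ²)`, so that
`μκ²b = 1/8`. -/
lemma lintegral_eexp_sq_le [IsProbabilityMeasure Pr] {X : Ω → ℝ} {κ : NNReal} (hX : Measurable X)
    (hsub : HasSubgaussianMGF X (κ ^ 2) Pr) (hκ : (1 / 2 : ℝ) ≤ κ ^ 2) :
    ∫⁻ ω, eexp (X ω ^ 2 / (8 * κ ^ 2)) ∂Pr ≤ eexp (1 / 4) := by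
  have hind : iIndepFun (fun _ : Unit => X) Pr := iIndepFun.of_subsingleton
  have hκ0 : (κ : ℝ) ≠ 0 := by intro h0; rw [h0] at hκ; norm_num at hκ
  have h := lintegral_eexp_nsq_mulVec_le (w := Unit) (fun _ => hX) hind (fun _ => hsub) 1
    (b := 1) (μ := 1 / (8 * κ ^ 2)) (fun v => by simp) (by positivity) zero_le_one
    (by field_simp; norm_num)
  simp only [Matrix.one_mulVec, nsq, Finset.univ_unique, Finset.sum_singleton,
    Fintype.card_unit] at h
  convert h using 3
  · congr 1; ring
  · field_simp; norm_num

/-- Exponential moments of the centered square of a sub-Gaussian variable. -/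
lemma lintegral_eexp_centered_sq_le [IsProbabilityMeasure Pr] {X : Ω → ℝ} {κ : NNReal}
    (hX : Measurable X) (hsub : HasSubgaussianMGF X (κ ^ 2) Pr) (hκ : (1 / 2 : ℝ) ≤ κ ^ 2)
    (hvar : ∫ ω, X ω ^ 2 ∂Pr = 1) {s : ℝ} (hs : |s| * κ ^ 2 ≤ 1 / 16) :
    ∫⁻ ω, eexp (s * (X ω ^ 2 - 1)) ∂Pr ≤ eexp (1024 * (s * κ ^ 2) ^ 2) := by
  have hκ0 : (0 : ℝ) < κ ^ 2 := by linarith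
  have hκ1 : (κ : ℝ) ≠ 0 := by intro h0; rw [h0] at hκ; norm_num at hκ
  obtain ⟨hi1, hi2⟩ := integrable_of_lintegral_eexp_le (by fun_prop)
    (lintegral_eexp_sq_le hX hsub hκ)
  have hX2 : Integrable (fun ω => X ω ^ 2) Pr := by
    by_contra hc; rw [integral_undef hc] at hvar; exact zero_ne_one hvar
  -- The linear term will integrate to zero because the variance is one, which leaves a remainder
  -- quadratic in `s`. Its factor `Y²` and its factor `exp |sY|` each cost `exp (|Y|/(16κ²))`;
  -- together they use up exactly the available moment `exp (X²/(8κ²))`.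
  have hpt : ∀ ω, Real.exp (s * (X ω ^ 2 - 1)) ≤ 1 + s * (X ω ^ 2 - 1)
      + (512 * (s * κ ^ 2) ^ 2 * Real.exp (1 / 4)) * Real.exp (X ω ^ 2 / (8 * κ ^ 2)) := by
    intro ω
    refine (exp_le_quadratic _).trans ?_
    refine add_le_add le_rfl ?_
    set Y := X ω ^ 2 - 1 with hY
    have hYabs : |Y| ≤ X ω ^ 2 + 1 := by
      rw [abs_le]; constructor <;> nlinarith [sq_nonneg (X ω)]
    have h1 := sq_le_exp (u := |Y| / κ ^ 2) (by positivity)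
    have h2 : |s * Y| ≤ |Y| / κ ^ 2 / 16 := by
      rw [abs_mul, div_div, le_div_iff₀ (by positivity)]
      nlinarith [abs_nonneg Y]
    calc (s * Y) ^ 2 * Real.exp |s * Y|
        = (s * κ ^ 2) ^ 2 * (|Y| / κ ^ 2) ^ 2 * Real.exp |s * Y| := by
          rw [div_pow, sq_abs]; field_simp
      _ ≤ (s * κ ^ 2) ^ 2 * (512 * Real.exp (|Y| / κ ^ 2 / 16)) * Real.exp (|Y| / κ ^ 2 / 16) := by
          gcongr
      _ = 512 * (s * κ ^ 2) ^ 2 * Real.exp (|Y| / κ ^ 2 / 16 + |Y| / κ ^ 2 / 16) := by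
          rw [Real.exp_add]; ring
      -- The constant in `|Y| ≤ X² + 1` contributes `1/(8κ²)`, which is at most `1/4` since `κ² ≥
      -- 1/2`.
      _ ≤ 512 * (s * κ ^ 2) ^ 2 * Real.exp (1 / 4 + X ω ^ 2 / (8 * κ ^ 2)) := by
          refine mul_le_mul_of_nonneg_left (Real.exp_le_exp.2 ?_) (by positivity)
          have : |Y| / κ ^ 2 / 16 + |Y| / κ ^ 2 / 16 = |Y| / (8 * κ ^ 2) := by field_simp; ring
          rw [this]
          calc |Y| / (8 * κ ^ 2) ≤ (X ω ^ 2 + 1) / (8 * κ ^ 2) := by gcongr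
            _ = 1 / (8 * κ ^ 2) + X ω ^ 2 / (8 * κ ^ 2) := by ring
            _ ≤ 1 / 4 + X ω ^ 2 / (8 * κ ^ 2) := by
              gcongr ?_ + _
              rw [div_le_div_iff₀ (by positivity) (by norm_num)]; linarith
      _ = _ := by rw [Real.exp_add]; ring
  have hi3 : Integrable (fun ω => 1 + s * (X ω ^ 2 - 1)
      + (512 * (s * κ ^ 2) ^ 2 * Real.exp (1 / 4)) * Real.exp (X ω ^ 2 / (8 * κ ^ 2))) Pr :=
    ((integrable_const _).add ((hX2.sub (integrable_const _)).const_mul _)).add (hi1.const_mul _)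
  have hi4 : Integrable (fun ω => Real.exp (s * (X ω ^ 2 - 1))) Pr := by
    refine hi3.mono' (by fun_prop) (ae_of_all _ fun ω => ?_)
    rw [Real.norm_eq_abs, Real.abs_exp]; exact hpt ω
  have hint : ∫ ω, Real.exp (s * (X ω ^ 2 - 1)) ∂Pr ≤ Real.exp (1024 * (s * κ ^ 2) ^ 2) := by
    refine (integral_mono hi4 hi3 hpt).trans ?_
    have hi5 : Integrable (fun ω => s * (X ω ^ 2 - 1)) Pr :=
      (hX2.sub (integrable_const _)).const_mul _
    have hi6 : Integrable (fun ω => 1 + s * (X ω ^ 2 - 1)) Pr := (integrable_const _).add hi5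
    rw [integral_add hi6 (hi1.const_mul _), integral_add (integrable_const _) hi5,
      integral_const_mul, integral_const_mul,
      integral_sub hX2 (integrable_const _), hvar]
    simp only [integral_const, probReal_univ, one_smul, sub_self, mul_zero, add_zero]
    have h5 : Real.exp (1 / 4) * Real.exp (1 / 4) ≤ 2 := by
      rw [← Real.exp_add]
      have := Real.exp_bound_div_one_sub_of_interval (x := 1/2) (by norm_num) (by norm_num)
      norm_num at this ⊢; exact this
    have h6 := Real.add_one_le_exp (1024 * (s * κ ^ 2) ^ 2)
    calc 1 + 512 * (s * κ ^ 2) ^ 2 * Real.exp (1 / 4) * ∫ ω, Real.exp (X ω ^ 2 / (8 * κ ^ 2)) ∂Pr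
        ≤ 1 + 512 * (s * κ ^ 2) ^ 2 * Real.exp (1 / 4) * Real.exp (1 / 4) := by gcongr
      _ = 1 + 512 * (s * κ ^ 2) ^ 2 * (Real.exp (1 / 4) * Real.exp (1 / 4)) := by ring
      _ ≤ 1 + 512 * (s * κ ^ 2) ^ 2 * 2 := by gcongr
      _ ≤ _ := by linarith
  simp only [eexp]
  rw [← ofReal_integral_eq_lintegral_ofReal hi4 (ae_of_all _ fun _ => (Real.exp_pos _).le)]
  exact ENNReal.ofReal_le_ofReal hint

lemma chernoff {Y : Ω → ℝ} (hY : Measurable Y) {K lam t : ℝ} (hlam : 0 ≤ lam)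
    (h : ∫⁻ ω, eexp (lam * Y ω) ∂Pr ≤ eexp K) : Pr {ω | t ≤ Y ω} ≤ eexp (K - lam * t) := by
  have hm : Measurable fun ω => eexp (lam * Y ω) := measurable_eexp.comp (hY.const_mul _)
  have h1 := mul_meas_ge_le_lintegral hm (eexp (lam * t)) (μ := Pr)
  have h2 : Pr {ω | t ≤ Y ω} ≤ Pr {ω | eexp (lam * t) ≤ eexp (lam * Y ω)} :=
    measure_mono fun ω (hω : t ≤ Y ω) => eexp_mono (mul_le_mul_of_nonneg_left hω hlam)
  calc Pr {ω | t ≤ Y ω} = eexp (- (lam * t)) * (eexp (lam * t) * Pr {ω | t ≤ Y ω}) := by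
        rw [← mul_assoc, ← eexp_add]; simp [eexp_zero]
    _ ≤ eexp (- (lam * t)) * eexp K := by
        gcongr
        exact (mul_le_mul_right h2 _).trans (h1.trans h)
    _ = _ := by rw [← eexp_add]; congr 1; ring

lemma gram_diag_eq (F : Matrix w ι ℝ) (i : ι) : (Fᵀ * F) i i = ∑ k, F k i ^ 2 := by
  simp [Matrix.mul_apply, sq]

lemma gram_diag_le [DecidableEq ι] (F : Matrix w ι ℝ) {b : ℝ}
    (hF : ∀ x, nsq (F *ᵥ x) ≤ b * nsq x) (i : ι) : (Fᵀ * F) i i ≤ b := by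
  have := hF (Pi.single i 1)
  have h1 : nsq (Pi.single i (1 : ℝ)) = 1 := by simp [nsq, Pi.single_apply]
  rw [h1, mul_one] at this
  rw [gram_diag_eq]
  simpa [nsq] using this

lemma sum_gram_diag_le [DecidableEq w] (F : Matrix w ι ℝ) {b : ℝ} (hb : 0 ≤ b)
    (hF : ∀ x, nsq (F *ᵥ x) ≤ b * nsq x) : ∑ i, (Fᵀ * F) i i ≤ b * Fintype.card w := by
  simp_rw [gram_diag_eq]
  rw [Finset.sum_comm]
  have h : ∀ k, ∑ i, F k i ^ 2 ≤ b := by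
    intro k
    have := nsq_vecMul_le F hb hF (Pi.single k 1)
    have h1 : nsq (Pi.single k (1 : ℝ)) = 1 := by simp [nsq, Pi.single_apply]
    rw [h1, mul_one] at this
    simpa [nsq] using this
  refine (Finset.sum_le_sum fun k _ => h k).trans (le_of_eq ?_)
  simp [mul_comm]

/-- The summands are independent and each has a log-moment quadratic in its weight `qᵢ = (FᵀF)ᵢᵢ`.
The variance proxy is controlled by `∑ qᵢ² ≤ b ∑ qᵢ ≤ b² · card w`, the same order as for the
off-diagonal part. -/
lemma lintegral_diag_le [IsProbabilityMeasure Pr]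
    {ζ : ι → Ω → ℝ} {κ : NNReal} (hm : ∀ i, Measurable (ζ i))
    (hind : iIndepFun ζ Pr) (hsub : ∀ i, HasSubgaussianMGF (ζ i) (κ ^ 2) Pr)
    (hκ : (1 / 2 : ℝ) ≤ κ ^ 2) (hvar : ∀ i, ∫ ω, ζ i ω ^ 2 ∂Pr = 1)
    (F : Matrix w ι ℝ) {b lam : ℝ} (hb : 0 ≤ b) (hF : ∀ x, nsq (F *ᵥ x) ≤ b * nsq x)
    (hlam : |lam| * κ ^ 2 * b ≤ 1 / 16) :
    ∫⁻ ω, eexp (lam * ∑ i, (Fᵀ * F) i i * (ζ i ω ^ 2 - 1)) ∂Pr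
      ≤ eexp (1024 * (lam * κ ^ 2 * b) ^ 2 * Fintype.card w) := by
  classical
  have hq0 : ∀ i, 0 ≤ (Fᵀ * F) i i := fun i => by
    rw [gram_diag_eq]; exact Finset.sum_nonneg fun _ _ => sq_nonneg _
  have hqb := gram_diag_le F hF
  have hqs := sum_gram_diag_le F hb hF
  have e : ∀ ω, eexp (lam * ∑ i, (Fᵀ * F) i i * (ζ i ω ^ 2 - 1))
      = ∏ i, eexp (lam * (Fᵀ * F) i i * (ζ i ω ^ 2 - 1)) := by
    intro ω
    rw [← eexp_sum, Finset.mul_sum]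
    congr 1
    exact Finset.sum_congr rfl fun i _ => by ring
  simp_rw [e]
  have hind2 : iIndepFun (fun i ω => eexp (lam * (Fᵀ * F) i i * (ζ i ω ^ 2 - 1))) Pr :=
    hind.comp (fun i x => eexp (lam * (Fᵀ * F) i i * (x ^ 2 - 1)))
      (fun i => measurable_eexp.comp (by fun_prop))
  have hmi : ∀ i, Measurable fun ω => eexp (lam * (Fᵀ * F) i i * (ζ i ω ^ 2 - 1)) :=
    fun i => measurable_eexp.comp (by have := hm i; fun_prop)
  rw [lintegral_prod_eq_prod_lintegral_of_indepFun _ _ hind2 hmi]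
  calc _ ≤ ∏ i, eexp (1024 * (lam * (Fᵀ * F) i i * κ ^ 2) ^ 2) := by
        refine Finset.prod_le_prod' fun i _ => ?_
        refine lintegral_eexp_centered_sq_le (hm i) (hsub i) hκ (hvar i) ?_
        rw [abs_mul, abs_of_nonneg (hq0 i)]
        refine le_trans ?_ hlam
        have := hqb i
        have h2 : |lam| * κ ^ 2 * (Fᵀ * F) i i ≤ |lam| * κ ^ 2 * b := by gcongr
        linarith
    _ ≤ _ := by
        rw [← eexp_sum]
        apply eexp_mono
        have h3 : ∀ i, 1024 * (lam * (Fᵀ * F) i i * κ ^ 2) ^ 2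
            ≤ 1024 * (lam * κ ^ 2) ^ 2 * b * (Fᵀ * F) i i := by
          intro i
          have h4 : (Fᵀ * F) i i * (Fᵀ * F) i i ≤ b * (Fᵀ * F) i i :=
            mul_le_mul_of_nonneg_right (hqb i) (hq0 i)
          have h5 : 0 ≤ 1024 * (lam * κ ^ 2) ^ 2 := by positivity
          nlinarith [mul_le_mul_of_nonneg_left h4 h5]
        refine (Finset.sum_le_sum fun i _ => h3 i).trans ?_
        rw [← Finset.mul_sum]
        calc _ ≤ 1024 * (lam * κ ^ 2) ^ 2 * b * (b * Fintype.card w) := by gcongr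
          _ = _ := by ring

/-- A **Hanson–Wright inequality** for `‖F ζ‖²` with `ζ` a vector of independent sub-Gaussian
variables of variance one. -/
theorem hansonWright [IsProbabilityMeasure Pr]
    {ζ : ι → Ω → ℝ} {κ : NNReal} (hm : ∀ i, Measurable (ζ i))
    (hind : iIndepFun ζ Pr) (hsub : ∀ i, HasSubgaussianMGF (ζ i) (κ ^ 2) Pr)
    (hκ : (1 / 2 : ℝ) ≤ κ ^ 2) (hvar : ∀ i, ∫ ω, ζ i ω ^ 2 ∂Pr = 1)
    (F : Matrix w ι ℝ) {b ρ : ℝ} (hb : 0 < b) (hF : ∀ x, nsq (F *ᵥ x) ≤ b * nsq x)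
    (hρ : 0 ≤ ρ) (hρb : ρ ≤ b) :
    Pr {ω | ρ * Fintype.card w ≤ |nsq (F *ᵥ fun i => ζ i ω) - ∑ k, ∑ i, F k i ^ 2|}
      ≤ 4 * eexp (-(ρ ^ 2 * Fintype.card w / (16384 * κ ^ 4 * b ^ 2))) := by
  classical
  have hκ0 : (0 : ℝ) < κ ^ 2 := by linarith
  -- The minimizer of `1024 (λκ²b)² m - λρm/2`, with minimal value `-ρ²m/(16384 κ⁴ b²)`. The
  -- conditions `ρ ≤ b` and `κ² ≥ 1/2` keep it in the range where the moment bounds hold.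
  set lam : ℝ := ρ / (4096 * κ ^ 4 * b ^ 2) with hlam
  have hlam0 : 0 ≤ lam := by positivity
  have hl1 : lam * κ ^ 2 * b = (ρ / b) / κ ^ 2 / 4096 := by
    rw [hlam]; field_simp
  have hl2 : lam * κ ^ 2 * b ≤ 1 / 16 := by
    rw [hl1]
    have h1 : ρ / b ≤ 1 := (div_le_one hb).2 hρb
    have h2 : (ρ / b) / κ ^ 2 ≤ 2 := by rw [div_le_iff₀ hκ0]; linarith
    linarith
  have hl0 : 0 ≤ lam * κ ^ 2 * b := by positivity
  have hl3 : 32 * (lam * κ ^ 2 * b) ^ 2 ≤ 1 := by nlinarith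
  set off : Ω → ℝ := fun ω => nsq (F *ᵥ fun i => ζ i ω) - ∑ i, (Fᵀ * F) i i * ζ i ω ^ 2
  set dia : Ω → ℝ := fun ω => ∑ i, (Fᵀ * F) i i * (ζ i ω ^ 2 - 1)
  have hmo : Measurable off := by
    simp only [off, nsq, Matrix.mulVec, dotProduct]; fun_prop
  have hmd : Measurable dia := by simp only [dia]; fun_prop
  set m : ℝ := ((Fintype.card w : ℕ) : ℝ)
  have hm0 : 0 ≤ m := Nat.cast_nonneg _
  have hsum : ∀ ω, nsq (F *ᵥ fun i => ζ i ω) - ∑ k, ∑ i, F k i ^ 2 = off ω + dia ω := by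
    intro ω
    simp only [off, dia, mul_sub, mul_one, Finset.sum_sub_distrib, gram_diag_eq]
    rw [Finset.sum_comm]; ring
  have hsub' : {ω | ρ * m ≤ |nsq (F *ᵥ fun i => ζ i ω) - ∑ k, ∑ i, F k i ^ 2|}
      ⊆ ({ω | ρ * m / 2 ≤ off ω} ∪ {ω | ρ * m / 2 ≤ -off ω})
        ∪ ({ω | ρ * m / 2 ≤ dia ω} ∪ {ω | ρ * m / 2 ≤ -dia ω}) := by
    intro ω hω
    simp only [Set.mem_ofPred_eq, hsum, Set.mem_union] at hω ⊢
    by_contra hc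
    push Not at hc
    obtain ⟨⟨h1, h2⟩, h3, h4⟩ := hc
    have : |off ω + dia ω| < ρ * m := by rw [abs_lt]; constructor <;> linarith
    linarith
  have hK : ∀ c : ℝ, c ≤ 1024 → c * (lam * κ ^ 2 * b) ^ 2 * m - lam * (ρ * m / 2)
      ≤ -(ρ ^ 2 * m / (16384 * κ ^ 4 * b ^ 2)) := by
    intro c hc
    have h1 : c * (lam * κ ^ 2 * b) ^ 2 * m ≤ 1024 * (lam * κ ^ 2 * b) ^ 2 * m := by gcongr
    have h2 : 1024 * (lam * κ ^ 2 * b) ^ 2 * m - lam * (ρ * m / 2)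
        = -(ρ ^ 2 * m / (16384 * κ ^ 4 * b ^ 2)) := by
      rw [hlam]
      have : (κ : ℝ) ≠ 0 := by intro h0; rw [h0] at hκ0; norm_num at hκ0
      field_simp
      ring
    linarith
  have b1 := (chernoff (t := ρ * m / 2) hmo hlam0
    (lintegral_offDiag_le hm hind hsub F hb.le hF hl3)).trans (eexp_mono (hK 16 (by norm_num)))
  have b2 := (chernoff (Y := fun ω => -off ω) (t := ρ * m / 2) hmo.neg hlam0 (by
    have := lintegral_offDiag_le (lam := -lam) hm hind hsub F hb.le hF
      (by simpa only [neg_mul, neg_sq] using hl3)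
    simpa only [neg_mul, mul_neg, neg_sq] using this)).trans (eexp_mono (hK 16 (by norm_num)))
  have b3 := (chernoff (t := ρ * m / 2) hmd hlam0
    (lintegral_diag_le hm hind hsub hκ hvar F hb.le hF (by rwa [abs_of_nonneg hlam0]))).trans
    (eexp_mono (hK 1024 le_rfl))
  have b4 := (chernoff (Y := fun ω => -dia ω) (t := ρ * m / 2) hmd.neg hlam0 (by
    have := lintegral_diag_le (lam := -lam) hm hind hsub hκ hvar F hb.le hF
      (by rwa [abs_neg, abs_of_nonneg hlam0])
    simpa only [neg_mul, mul_neg, neg_sq] using this)).trans (eexp_mono (hK 1024 le_rfl))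
  refine (measure_mono hsub').trans ((measure_union_le _ _).trans ?_)
  refine (add_le_add ((measure_union_le _ _).trans (add_le_add b1 b2))
    ((measure_union_le _ _).trans (add_le_add b3 b4))).trans (le_of_eq ?_)
  ring

end hansonWright
end
end MLRHAR

namespace MLRHAR
open scoped Matrix
noncomputable section

/-! ### Nets of the unit ball and suprema of linear and bilinear forms -/

section nets
variable {E F : Type*} [NormedAddCommGroup E] [NormedSpace ℝ E] [FiniteDimensional ℝ E]
  [NormedAddCommGroup F] [NormedSpace ℝ F] [FiniteDimensional ℝ F]

/-- `s` is a `1/2`-net of the unit ball that is contained in it. -/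
def IsHalfNet (s : Finset E) : Prop :=
  (∀ c ∈ s, ‖c‖ ≤ 1) ∧ ∀ x : E, ‖x‖ ≤ 1 → ∃ c ∈ s, ‖x - c‖ ≤ 1 / 2

/-- Doubling the points makes them 1-separated in the ball of radius 2, where the volume argument
behind the Besicovitch packing bound gives `5 ^ dim`. -/
lemma card_le_of_half_separated (s : Finset E) (hs : ∀ c ∈ s, ‖c‖ ≤ 1)
    (h : ∀ c ∈ s, ∀ d ∈ s, c ≠ d → 1 / 2 ≤ ‖c - d‖) : s.card ≤ 5 ^ Module.finrank ℝ E := by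
  classical
  have hinj : Function.Injective fun x : E => (2 : ℝ) • x := smul_right_injective E two_ne_zero
  rw [← Finset.card_image_of_injective s hinj]
  apply Besicovitch.card_le_of_separated
  · intro c hc
    obtain ⟨x, hx, rfl⟩ := Finset.mem_image.1 hc
    have := hs x hx
    simp only [norm_smul, Real.norm_ofNat]; linarith
  · intro c hc d hd hcd
    obtain ⟨x, hx, rfl⟩ := Finset.mem_image.1 hc
    obtain ⟨y, hy, rfl⟩ := Finset.mem_image.1 hd
    have := h x hx y hy (fun e => hcd (by rw [e]))
    simp only [← smul_sub, norm_smul, Real.norm_ofNat]; linarith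

variable (E) in
-- A half-separated subset of the unit ball of maximal cardinality is a net: a point far from all
-- its elements could be added. The packing bound guarantees that a maximum exists.
lemma exists_isHalfNet : ∃ s : Finset E, s.card ≤ 5 ^ Module.finrank ℝ E ∧ IsHalfNet s := by
  classical
  let p : ℕ → Prop := fun n => ∃ s : Finset E, s.card = n ∧ (∀ c ∈ s, ‖c‖ ≤ 1) ∧
    ∀ c ∈ s, ∀ d ∈ s, c ≠ d → 1 / 2 ≤ ‖c - d‖
  have hp0 : p 0 := ⟨∅, by simp⟩
  obtain ⟨s, hcard, hs, hsep⟩ := Nat.findGreatest_spec (P := p) (Nat.zero_le _) hp0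
    (n := 5 ^ Module.finrank ℝ E)
  refine ⟨s, card_le_of_half_separated s hs hsep, hs, fun x hx => ?_⟩
  by_contra hc
  push Not at hc
  have hxs : x ∉ s := fun hxs => by have := hc x hxs; simp at this; linarith
  have hins : p (insert x s).card := by
    refine ⟨_, rfl, ?_, ?_⟩
    · intro c hcm
      rcases Finset.mem_insert.1 hcm with rfl | h
      exacts [hx, hs c h]
    · intro c hcm d hdm hne
      rcases Finset.mem_insert.1 hcm with rfl | h <;> rcases Finset.mem_insert.1 hdm with rfl | h'
      · exact absurd rfl hne
      · exact (hc d h').le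
      · rw [norm_sub_rev]; exact (hc c h).le
      · exact hsep c h d h' hne
  have hle : (insert x s).card ≤ 5 ^ Module.finrank ℝ E := by
    obtain ⟨s', h1, h2, h3⟩ := hins
    rw [← h1]; exact card_le_of_half_separated s' h2 h3
  have := Nat.le_findGreatest hle hins
  rw [← hcard, Finset.card_insert_of_notMem hxs] at this
  omega

/-- Approximating a unit vector by the net gives `‖f‖ ≤ t + ‖f‖/2`, hence `‖f‖ ≤ 2t`. -/
lemma IsHalfNet.abs_le {s : Finset E} (hs : IsHalfNet s) (f : E →ₗ[ℝ] ℝ) {t : ℝ}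
    (ht : ∀ c ∈ s, |f c| ≤ t) (x : E) : |f x| ≤ 2 * t * ‖x‖ := by
  set g := LinearMap.toContinuousLinearMap f
  have hg : ∀ y, g y = f y := fun _ => rfl
  have ht0 : 0 ≤ t := by
    obtain ⟨c, hc, -⟩ := hs.2 0 (by simp)
    exact (abs_nonneg _).trans (ht c hc)
  have h1 : ‖g‖ ≤ t + ‖g‖ / 2 := by
    refine g.opNorm_le_of_unit_norm (by positivity) fun y hy => ?_
    obtain ⟨c, hc, hyc⟩ := hs.2 y hy.le
    have h2 : g y = g c + g (y - c) := by simp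
    rw [h2]
    refine (norm_add_le _ _).trans (add_le_add (ht c hc) ?_)
    refine (g.le_opNorm _).trans ?_
    rw [div_eq_mul_one_div]
    gcongr
  have h2 : ‖g‖ ≤ 2 * t := by linarith
  exact (g.le_opNorm x).trans (by gcongr)

lemma IsHalfNet.abs_bilin_le {s : Finset E} (hs : IsHalfNet s) {s' : Finset F} (hs' : IsHalfNet s')
    (f : E →ₗ[ℝ] F →ₗ[ℝ] ℝ) {t : ℝ} (ht : ∀ c ∈ s, ∀ d ∈ s', |f c d| ≤ t) (x : E) (y : F) :
    |f x y| ≤ 4 * t * ‖x‖ * ‖y‖ := by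
  have h1 : ∀ d ∈ s', |f x d| ≤ 2 * t * ‖x‖ := fun d hd =>
    hs.abs_le (f.flip d) (fun c hc => ht c hc d hd) x
  have := hs'.abs_le (f x) h1 y
  linarith

end nets

section subgaussian
variable {Ω : Type*} [MeasurableSpace Ω] {Pr : Measure Ω}

/-- Integrating `2 + X² ≤ e^X + e^(-X)` gives `3 ≤ 2 exp (κ²/2)`; for `κ² < 1/2` the right side is
at most `2 exp (1/4) ≤ 8/3`. Thus `κ` is bounded away from zero, which later lets `κ` and constants
be absorbed into powers of `κ²`. -/
lemma half_le_of_subgaussian [IsProbabilityMeasure Pr] {X : Ω → ℝ} {κ : NNReal}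
    (hsub : HasSubgaussianMGF X (κ ^ 2) Pr) (hvar : ∫ ω, X ω ^ 2 ∂Pr = 1) :
    (1 / 2 : ℝ) ≤ κ ^ 2 := by
  by_contra hlt
  push Not at hlt
  have h1 := hsub.mgf_le 1
  have h2 := hsub.mgf_le (-1)
  have i1 := hsub.integrable_exp_mul 1
  have i2 := hsub.integrable_exp_mul (-1)
  have hX2 : Integrable (fun ω => X ω ^ 2) Pr := by
    by_contra hc; rw [integral_undef hc] at hvar; exact zero_ne_one hvar
  have hpt : ∀ ω, 2 + X ω ^ 2 ≤ Real.exp (1 * X ω) + Real.exp (-1 * X ω) := by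
    intro ω
    have h : 1 + X ω ^ 2 / 2 ≤ Real.cosh (X ω) := by
      have h1 : Real.cosh (X ω) = 1 + 2 * Real.sinh (X ω / 2) ^ 2 := by
        have := Real.cosh_two_mul (X ω / 2)
        rw [Real.cosh_sq] at this
        rw [show X ω = 2 * (X ω / 2) by ring, this]; ring_nf
      have h2 : |X ω / 2| ≤ |Real.sinh (X ω / 2)| := by
        rw [Real.abs_sinh]; exact Real.self_le_sinh_iff.2 (abs_nonneg _)
      have h3 := sq_le_sq.2 h2
      rw [h1]; nlinarith
    rw [Real.cosh_eq] at h
    rw [one_mul, neg_one_mul]; linarith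
  have h3 : ∫ ω, (2 + X ω ^ 2) ∂Pr ≤ ∫ ω, (Real.exp (1 * X ω) + Real.exp (-1 * X ω)) ∂Pr :=
    integral_mono ((integrable_const _).add hX2) (i1.add i2) hpt
  rw [integral_add (integrable_const _) hX2, integral_add i1 i2, hvar] at h3
  simp only [mgf] at h1 h2
  simp only [integral_const, probReal_univ, one_smul] at h3
  have h4 : Real.exp (((κ ^ 2 : NNReal) : ℝ) * 1 ^ 2 / 2) ≤ Real.exp (1 / 4) := by
    apply Real.exp_le_exp.2; push_cast; linarith
  have h5 : Real.exp (((κ ^ 2 : NNReal) : ℝ) * (-1) ^ 2 / 2) ≤ Real.exp (1 / 4) := by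
    apply Real.exp_le_exp.2; push_cast; linarith
  have h6 := Real.exp_bound_div_one_sub_of_interval (x := 1/4) (by norm_num) (by norm_num)
  norm_num at h6
  linarith

end subgaussian
end
end MLRHAR

namespace MLRHAR
open scoped Matrix
noncomputable section

/-! ### Near-contractivity of the truncated singular value decomposition -/

section truncatedSVD
variable {a b : Type*} [Fintype a] [Fintype b]
set_option linter.unusedSectionVars false

/-- A matrix as the family of its columns, with the Frobenius norm. -/
def cols (X : Matrix a b ℝ) : PiLp 2 fun _ : b => EuclideanSpace ℝ a :=
  WithLp.toLp 2 fun c => WithLp.toLp 2 fun i => X i c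

/-- The orthogonal projection onto `W` applied to every column. -/
def projCols (W : Submodule ℝ (EuclideanSpace ℝ a)) (x : PiLp 2 fun _ : b => EuclideanSpace ℝ a) :
    PiLp 2 fun _ : b => EuclideanSpace ℝ a :=
  WithLp.toLp 2 fun c => W.starProjection (x c)

lemma cols_apply (X : Matrix a b ℝ) (c : b) (i : a) : cols X c i = X i c := rfl

lemma cols_sub (X Y : Matrix a b ℝ) : cols (X - Y) = cols X - cols Y := rfl

lemma cols_add (X Y : Matrix a b ℝ) : cols (X + Y) = cols X + cols Y := rfl

lemma projCols_sub (W : Submodule ℝ (EuclideanSpace ℝ a))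
    (x y : PiLp 2 fun _ : b => EuclideanSpace ℝ a) :
    projCols W (x - y) = projCols W x - projCols W y := by
  ext c : 1
  simp [projCols]

lemma projCols_add (W : Submodule ℝ (EuclideanSpace ℝ a))
    (x y : PiLp 2 fun _ : b => EuclideanSpace ℝ a) :
    projCols W (x + y) = projCols W x + projCols W y := by
  ext c : 1
  simp [projCols]

lemma norm_cols_sq (X : Matrix a b ℝ) : ‖cols X‖ ^ 2 = ∑ c, ∑ i, X i c ^ 2 := by
  rw [PiLp.norm_sq_eq_of_L2]
  exact Finset.sum_congr rfl fun c _ => by rw [EuclideanSpace.norm_sq_eq]; simp [cols]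

lemma norm_projCols_sq (W : Submodule ℝ (EuclideanSpace ℝ a))
    (x : PiLp 2 fun _ : b => EuclideanSpace ℝ a) :
    ‖projCols W x‖ ^ 2 = ∑ c, ‖W.starProjection (x c)‖ ^ 2 := by
  rw [PiLp.norm_sq_eq_of_L2]; rfl

lemma norm_projCols_le (W : Submodule ℝ (EuclideanSpace ℝ a))
    (x : PiLp 2 fun _ : b => EuclideanSpace ℝ a) : ‖projCols W x‖ ≤ ‖x‖ := by
  refine le_of_sq_le_sq ?_ (norm_nonneg _)
  rw [norm_projCols_sq, PiLp.norm_sq_eq_of_L2]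
  refine Finset.sum_le_sum fun c _ => ?_
  gcongr
  exact W.norm_starProjection_apply_le (x c)

lemma finrank_span_cols_le {A : Matrix a b ℝ} {r : ℕ} (hA : A.rank ≤ r) :
    Module.finrank ℝ (Submodule.span ℝ (Set.range fun c => cols A c)) ≤ r := by
  refine le_trans (le_of_eq ?_) hA
  rw [Matrix.rank_eq_finrank_span_cols]
  have : Submodule.span ℝ (Set.range fun c => cols A c)
      = (Submodule.span ℝ (Set.range A.col)).map
        (WithLp.linearEquiv 2 ℝ (a → ℝ)).symm.toLinearMap := by
    rw [Submodule.map_span, ← Set.range_comp]; rfl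
  rw [this]
  exact LinearEquiv.finrank_map_eq _ _

lemma norm_sq_starProjection_eq_sum {E : Type*} [NormedAddCommGroup E] [InnerProductSpace ℝ E]
    [FiniteDimensional ℝ E] (K : Submodule ℝ E) (x : E) : ‖K.starProjection x‖ ^ 2
      = ∑ j, inner ℝ x (stdOrthonormalBasis ℝ K j : E) ^ 2 := by
  have : ‖K.starProjection x‖ = ‖K.orthogonalProjectionOnto x‖ := by
    rw [Submodule.starProjection_apply, Submodule.coe_norm]
  rw [this, ← (stdOrthonormalBasis ℝ K).sum_sq_norm_inner_right]
  refine Finset.sum_congr rfl fun j _ => ?_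
  rw [Real.norm_eq_abs, sq_abs, Submodule.inner_orthogonalProjectionOnto_eq_of_mem_left,
    real_inner_comm]

/-- The sum of the squared projections of an orthonormal family is at most the dimension. -/
lemma sum_norm_sq_starProjection_le {E ι : Type*} [NormedAddCommGroup E] [InnerProductSpace ℝ E]
    [FiniteDimensional ℝ E] (K : Submodule ℝ E) {v : ι → E} (hv : Orthonormal ℝ v)
    (s : Finset ι) : ∑ k ∈ s, ‖K.starProjection (v k)‖ ^ 2 ≤ Module.finrank ℝ K := by
  let β := stdOrthonormalBasis ℝ K
  have h1 := norm_sq_starProjection_eq_sum K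
  simp_rw [h1]
  rw [Finset.sum_comm]
  have h2 : ∀ j, ∑ k ∈ s, inner ℝ (v k) (β j : E) ^ 2 ≤ 1 := by
    intro j
    have := hv.sum_inner_products_le (β j : E) (s := s)
    have hn : ‖(β j : E)‖ = 1 := by rw [← Submodule.coe_norm]; exact β.orthonormal.1 j
    rw [hn, one_pow] at this
    refine le_trans (le_of_eq ?_) this
    exact Finset.sum_congr rfl fun k _ => by rw [Real.norm_eq_abs, sq_abs]
  refine (Finset.sum_le_sum fun j _ => h2 j).trans ?_
  simp

lemma sum_mul_orthonormal_sq {l : Type*} {v : l → EuclideanSpace ℝ b}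
    (hv : Orthonormal ℝ v) (s : Finset l) (t : l → ℝ) :
    ∑ c, (∑ k ∈ s, t k * v k c) ^ 2 = ∑ k ∈ s, t k ^ 2 := by
  have h1 : ∑ c, (∑ k ∈ s, t k * v k c) ^ 2 = ‖∑ k ∈ s, t k • v k‖ ^ 2 := by
    rw [EuclideanSpace.norm_sq_eq]
    refine Finset.sum_congr rfl fun c _ => ?_
    simp [WithLp.ofLp_sum]
  rw [h1, ← real_inner_self_eq_norm_sq, hv.inner_sum]
  exact Finset.sum_congr rfl fun k _ => by simp [sq]

/-- Near-contractivity of truncated singular value decompositions: it suffices to know the error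
after projection onto the span of the columns of both the low-rank matrices. -/
theorem IsTruncatedSVD.norm_sub_le {q r : ℕ} {M B A : Matrix a b ℝ} (h : IsTruncatedSVD q M B)
    (hA : A.rank ≤ r) {β : ℝ} (hβ : 0 ≤ β) (hr : (r : ℝ) ≤ β ^ 2 * ((q : ℝ) - r)) :
    ∃ W : Submodule ℝ (EuclideanSpace ℝ a), Module.finrank ℝ W ≤ r + q ∧
      ‖cols (B - A)‖ ≤ (1 + β) * ‖projCols W (cols (M - A))‖ := by
  classical
  obtain ⟨l, s, u, v, hu, hv, hs, hs0, hM, hB⟩ := h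
  set U : Submodule ℝ (EuclideanSpace ℝ a) :=
    Submodule.span ℝ (((Finset.univ.filter fun k : Fin l => k.val < q).image u : Finset _) : Set _)
    with hU
  set C : Submodule ℝ (EuclideanSpace ℝ a) := Submodule.span ℝ (Set.range fun c => cols A c)
    with hC
  have hCr : Module.finrank ℝ C ≤ r := finrank_span_cols_le hA
  have hUq : Module.finrank ℝ U ≤ q := by
    refine (finrank_span_finset_le_card _).trans (Finset.card_image_le.trans ?_)
    have : (Finset.univ.filter fun k : Fin l => k.val < q).card
        = ((Finset.univ.filter fun k : Fin l => k.val < q).image Fin.val).card :=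
      (Finset.card_image_of_injective _ Fin.val_injective).symm
    rw [this]
    refine (Finset.card_le_card (t := Finset.range q) ?_).trans (by simp)
    intro x hx
    simp only [Finset.mem_image, Finset.mem_filter, Finset.mem_univ, true_and] at hx
    obtain ⟨k, hk, rfl⟩ := hx
    simpa using hk
  have huU : ∀ k : Fin l, k.val < q → u k ∈ U := fun k hk =>
    Submodule.subset_span (by simp only [Finset.coe_image, Set.mem_image]; exact ⟨k, by simpa using hk, rfl⟩)
  have hcolM : ∀ c, cols M c = ∑ k, (s k * v k c) • u k := by
    intro c; ext i
    simp [cols, hM, Matrix.sum_apply, Matrix.vecMulVec_apply, WithLp.ofLp_sum, mul_comm,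
      mul_left_comm]
  have hcolB : ∀ c, cols B c = ∑ k with k.val < q, (s k * v k c) • u k := by
    intro c; ext i
    simp [cols, hB, Matrix.sum_apply, Matrix.vecMulVec_apply, WithLp.ofLp_sum, mul_comm,
      mul_left_comm]
  have hcolMB : ∀ c, cols (M - B) c = ∑ k with ¬ k.val < q, (s k * v k c) • u k := by
    intro c
    have : cols (M - B) c = cols M c - cols B c := rfl
    rw [this, hcolM, hcolB, sub_eq_iff_eq_add,
      ← Finset.sum_filter_add_sum_filter_not Finset.univ (fun k : Fin l => k.val < q), add_comm]
  set W := U ⊔ C with hW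
  have hCW : C ≤ W := le_sup_right
  have hUW : U ≤ W := le_sup_left
  refine ⟨W, (Submodule.finrank_add_le_finrank_add_finrank U C).trans (by omega), ?_⟩
  -- The largest discarded singular value, zero if nothing is discarded.
  set σ : ℝ := if h : q < l then s ⟨q, h⟩ else 0 with hσ
  have hσ0 : 0 ≤ σ := by rw [hσ]; split_ifs; exacts [hs0 _, le_rfl]
  have hsσ : ∀ k : Fin l, ¬ k.val < q → s k ≤ σ := by
    intro k hk
    have : q < l := by omega
    rw [hσ, dif_pos this]
    exact hs (show (⟨q, this⟩ : Fin l) ≤ k from by simpa [Fin.le_def] using hk)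
  -- the part of `W` orthogonal to `U`
  set K := W ⊓ Uᗮ with hK
  have hKr : Module.finrank ℝ K ≤ r := by
    have h1 := Submodule.finrank_sup_add_finrank_inf_eq U K
    have h2 : U ⊓ K = ⊥ := by
      rw [eq_bot_iff]
      intro x hx
      exact (Submodule.inf_orthogonal_eq_bot U).le ⟨hx.1, hx.2.2⟩
    have h3 : Module.finrank ℝ ↥(U ⊔ K) ≤ Module.finrank ℝ W :=
      Submodule.finrank_mono (sup_le hUW inf_le_left)
    have h4 := Submodule.finrank_add_le_finrank_add_finrank U C
    rw [h2, finrank_bot] at h1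
    rw [← hW] at h4
    omega
  -- On the orthogonal complement of the kept left singular vectors, projecting onto `W` is
  -- projecting onto `K`, whose dimension is only `r`.
  have hproj : ∀ x ∈ Uᗮ, W.starProjection x = K.starProjection x := by
    intro x hx
    symm
    apply Submodule.eq_starProjection_of_mem_of_inner_eq_zero
    · refine ⟨W.starProjection_apply_mem x, ?_⟩
      refine (Submodule.mem_orthogonal _ _).2 ?_
      intro y hy
      have h1 : W.starProjection y = y := Submodule.starProjection_eq_self_iff.2 (hUW hy)
      rw [← Submodule.inner_starProjection_left_eq_right, h1]
      exact (Submodule.mem_orthogonal _ _).1 hx y hy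
    · intro y hy
      exact Submodule.starProjection_inner_eq_zero x y hy.1
  have hMBorth : ∀ c, cols (M - B) c ∈ Uᗮ := by
    intro c
    rw [hcolMB]
    refine Submodule.sum_mem _ fun k hk => Submodule.smul_mem _ _ ?_
    rw [Submodule.mem_orthogonal]
    intro y hy
    refine Submodule.span_induction (p := fun y _ => inner ℝ y (u k) = 0) ?_ ?_ ?_ ?_ hy
    · intro x hx
      simp only [Finset.coe_image, Set.mem_image, Finset.coe_filter, Finset.mem_univ, true_and,
        Set.mem_ofPred_eq] at hx
      obtain ⟨j, hj, rfl⟩ := hx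
      refine hu.2 fun e => ?_
      rw [e] at hj
      simp at hk; omega
    · simp
    · intro x y _ _ hx hy; rw [inner_add_left, hx, hy, add_zero]
    · intro c x _ hx; rw [inner_smul_left, hx, mul_zero]
  -- `B - A` is the projection of `M - A` onto `W` minus this part of the discarded remainder. The
  -- remainder has singular values at most `σ` and is seen through the `r`-dimensional `K`, so its
  -- squared norm is at most `r σ²`.
  set R := projCols W (cols (M - B)) with hR
  have hRnorm : ‖R‖ ^ 2 ≤ r * σ ^ 2 := by
    rw [hR, norm_projCols_sq]
    let β := stdOrthonormalBasis ℝ K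
    have h1 := norm_sq_starProjection_eq_sum K
    have h2 : ∀ c, ‖W.starProjection (cols (M - B) c)‖ ^ 2
        = ∑ j, inner ℝ (cols (M - B) c) (β j : EuclideanSpace ℝ a) ^ 2 := fun c => by
      rw [hproj _ (hMBorth c), h1]
    simp_rw [h2]
    rw [Finset.sum_comm]
    have h3 : ∀ j, ∑ c, inner ℝ (cols (M - B) c) (β j : EuclideanSpace ℝ a) ^ 2 ≤ σ ^ 2 := by
      intro j
      have h4 : ∀ c, inner ℝ (cols (M - B) c) (β j : EuclideanSpace ℝ a)
          = ∑ k with ¬ k.val < q, (s k * inner ℝ (u k) (β j : EuclideanSpace ℝ a)) * v k c := by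
        intro c
        rw [hcolMB, sum_inner]
        refine Finset.sum_congr rfl fun k _ => ?_
        rw [real_inner_smul_left]; ring
      simp_rw [h4]
      rw [sum_mul_orthonormal_sq hv]
      have h5 := hu.sum_inner_products_le (β j : EuclideanSpace ℝ a)
        (s := Finset.univ.filter fun k : Fin l => ¬ k.val < q)
      have hn : ‖(β j : EuclideanSpace ℝ a)‖ = 1 := by
        rw [← Submodule.coe_norm]; exact β.orthonormal.1 j
      rw [hn, one_pow] at h5
      calc _ ≤ ∑ k with ¬ (k : Fin l).val < q,
            σ ^ 2 * ‖inner ℝ (u k) (β j : EuclideanSpace ℝ a)‖ ^ 2 := by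
            refine Finset.sum_le_sum fun k hk => ?_
            rw [mul_pow, Real.norm_eq_abs, sq_abs]
            have := hsσ k (Finset.mem_filter.1 hk).2
            have := hs0 k
            gcongr
        _ ≤ σ ^ 2 * 1 := by rw [← Finset.mul_sum]; gcongr
        _ = _ := mul_one _
    refine (Finset.sum_le_sum fun j _ => h3 j).trans ?_
    simp only [Finset.sum_const, Finset.card_univ, Fintype.card_fin, nsmul_eq_mul]
    gcongr
  set e := ‖projCols W (cols (M - A))‖ with he
  have hA' : projCols W (cols A) = cols A := by
    ext c : 1
    exact Submodule.starProjection_eq_self_iff.2 (hCW (Submodule.subset_span ⟨c, rfl⟩))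
  have hB' : projCols W (cols B) = cols B := by
    ext c : 1
    refine Submodule.starProjection_eq_self_iff.2 ?_
    show cols B c ∈ W
    rw [hcolB]
    exact Submodule.sum_mem _ fun k hk =>
      Submodule.smul_mem _ _ (hUW (huU k (Finset.mem_filter.1 hk).2))
  have htri : ‖cols (B - A)‖ ≤ e + ‖R‖ := by
    have : cols (B - A) = projCols W (cols (M - A)) - R := by
      rw [hR, ← projCols_sub, ← cols_sub, show M - A - (M - B) = B - A by abel, cols_sub,
        projCols_sub, hA', hB']
    rw [this]
    exact _root_.norm_sub_le _ _
  -- Conversely, a large `σ` forces a large error. All `q` kept singular values are at least `σ`,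
  -- and a matrix of rank `r` can account for at most `r` of these directions. Together with the
  -- bound for `R` this yields `‖R‖² ≤ r/(q - r) · e² ≤ β² e²`.
  have hlow : ((q : ℝ) - r) * σ ^ 2 ≤ e ^ 2 := by
    by_cases hql : q < l
    swap
    · have : σ = 0 := by rw [hσ, dif_neg hql]
      rw [this]; simpa using sq_nonneg e
    set R0 : Submodule ℝ (EuclideanSpace ℝ b) := Submodule.span ℝ (Set.range fun i => cols Aᵀ i)
    have hR0 : Module.finrank ℝ R0 ≤ r := finrank_span_cols_le (by rwa [Matrix.rank_transpose])
    -- The row `uₖᵀ(M - A)` is `sₖ vₖ` minus a vector in the row space of `A`, so its length is at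
    -- least that of the component of `sₖ vₖ` orthogonal to this row space.
    have hw : ∀ k : Fin l, k.val < q → s k ^ 2 * (1 - ‖R0.starProjection (v k)‖ ^ 2)
        ≤ ∑ c, inner ℝ (u k) (cols (M - A) c) ^ 2 := by
      intro k hk
      set ak : EuclideanSpace ℝ b := ∑ i, u k i • cols Aᵀ i with hak
      have hakm : ak ∈ R0 := Submodule.sum_mem _ fun i _ =>
        Submodule.smul_mem _ _ (Submodule.subset_span ⟨i, rfl⟩)
      have h1 : ∀ c, inner ℝ (u k) (cols (M - A) c) = (s k • v k - ak) c := by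
        intro c
        have e1 : cols (M - A) c = cols M c - cols A c := rfl
        rw [e1, inner_sub_right, hcolM, inner_sum]
        have e2 : ∑ j, inner ℝ (u k) ((s j * v j c) • u j) = s k * v k c := by
          rw [Finset.sum_eq_single k]
          · rw [real_inner_smul_right, real_inner_self_eq_norm_sq, hu.1 k]; ring
          · intro j _ hj
            rw [real_inner_smul_right, hu.2 hj.symm, mul_zero]
          · simp
        rw [e2]
        simp [hak, WithLp.ofLp_sum, PiLp.inner_apply, cols, mul_comm]
      simp_rw [h1]
      have h2 : ∑ c, (s k • v k - ak) c ^ 2 = ‖s k • v k - ak‖ ^ 2 := by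
        rw [EuclideanSpace.norm_sq_eq]; simp
      rw [h2]
      set x := s k • v k with hx
      have h3 : ‖x - R0.starProjection x‖ ≤ ‖x - ak‖ := by
        rw [Submodule.starProjection_minimal]
        exact ciInf_le ⟨0, by rintro _ ⟨y, rfl⟩; exact norm_nonneg _⟩ (⟨ak, hakm⟩ : R0)
      have h4 : ‖x‖ ^ 2 = ‖R0.starProjection x‖ ^ 2 + ‖x - R0.starProjection x‖ ^ 2 := by
        have h5 : inner ℝ (R0.starProjection x) (x - R0.starProjection x) = 0 := by
          rw [real_inner_comm]
          exact Submodule.starProjection_inner_eq_zero x _ (R0.starProjection_apply_mem x)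
        have := norm_add_sq_eq_norm_sq_add_norm_sq_of_inner_eq_zero _ _ h5
        rw [add_sub_cancel] at this
        simpa [sq] using this
      have h5 : ‖x‖ ^ 2 = s k ^ 2 := by rw [hx, norm_smul, hv.1 k]; simp
      have h6 : ‖R0.starProjection x‖ ^ 2 = s k ^ 2 * ‖R0.starProjection (v k)‖ ^ 2 := by
        rw [hx, map_smul, norm_smul, mul_pow, Real.norm_eq_abs, sq_abs]
      have h7 : ‖x - R0.starProjection x‖ ^ 2 ≤ ‖x - ak‖ ^ 2 := by gcongr
      nlinarith
    have hbes : ∀ c, ∑ k with (k : Fin l).val < q, inner ℝ (u k) (cols (M - A) c) ^ 2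
        ≤ ‖W.starProjection (cols (M - A) c)‖ ^ 2 := by
      intro c
      have := hu.sum_inner_products_le (W.starProjection (cols (M - A) c))
        (s := Finset.univ.filter fun k : Fin l => k.val < q)
      refine le_trans (le_of_eq ?_) this
      refine Finset.sum_congr rfl fun k hk => ?_
      have h1 : W.starProjection (u k) = u k :=
        Submodule.starProjection_eq_self_iff.2 (hUW (huU k (Finset.mem_filter.1 hk).2))
      rw [← Submodule.inner_starProjection_left_eq_right, h1, Real.norm_eq_abs, sq_abs]
    have hcard : (Finset.univ.filter fun k : Fin l => k.val < q).card = q := by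
      have := Fin.card_filter_val_lt (n := l) (m := q)
      rw [this]; omega
    rw [he, norm_projCols_sq]
    refine le_trans ?_ (Finset.sum_le_sum fun c _ => hbes c)
    rw [Finset.sum_comm]
    have hsig : ∀ k : Fin l, k.val < q → σ ≤ s k := by
      intro k hk
      rw [hσ, dif_pos hql]
      exact hs (show k ≤ ⟨q, hql⟩ from by simpa [Fin.le_def] using hk.le)
    have hsum := sum_norm_sq_starProjection_le R0 hv (Finset.univ.filter fun k : Fin l => k.val < q)
    have hRr : (Module.finrank ℝ R0 : ℝ) ≤ r := by exact_mod_cast hR0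
    calc ((q : ℝ) - r) * σ ^ 2
        ≤ σ ^ 2 * ∑ k with (k : Fin l).val < q, (1 - ‖R0.starProjection (v k)‖ ^ 2) := by
          rw [Finset.sum_sub_distrib, Finset.sum_const, hcard, mul_comm]
          gcongr
          · simp
          · exact hsum.trans hRr
      _ = ∑ k with (k : Fin l).val < q, σ ^ 2 * (1 - ‖R0.starProjection (v k)‖ ^ 2) :=
          Finset.mul_sum _ _ _
      _ ≤ ∑ k with (k : Fin l).val < q, s k ^ 2 * (1 - ‖R0.starProjection (v k)‖ ^ 2) := by
          refine Finset.sum_le_sum fun k hk => ?_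
          have h1 := hsig k (Finset.mem_filter.1 hk).2
          have h2 : ‖R0.starProjection (v k)‖ ≤ 1 :=
            (R0.norm_starProjection_apply_le _).trans (hv.1 k).le
          have h3 : 0 ≤ 1 - ‖R0.starProjection (v k)‖ ^ 2 := by
            nlinarith [norm_nonneg (R0.starProjection (v k))]
          gcongr
      _ ≤ _ := Finset.sum_le_sum fun k hk => hw k (Finset.mem_filter.1 hk).2
  have hRe : ‖R‖ ≤ β * e := by
    refine le_of_sq_le_sq ?_ (by positivity)
    calc ‖R‖ ^ 2 ≤ r * σ ^ 2 := hRnorm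
      _ ≤ β ^ 2 * ((q : ℝ) - r) * σ ^ 2 := by gcongr
      _ = β ^ 2 * (((q : ℝ) - r) * σ ^ 2) := by ring
      _ ≤ β ^ 2 * e ^ 2 := by gcongr
      _ = _ := by ring
  linarith

end truncatedSVD
end
end MLRHAR

namespace MLRHAR
open scoped Matrix
noncomputable section

/-! ### The gradient step: contraction in Frobenius norm and duality for the noise -/

section gradientDescent

/-- A symmetric operator whose quadratic form is bounded by `ρ` is a `ρ`-contraction; here for
`δ ↦ δ - c ∑ₙ (δ ⬝ᵥ xₙ) xₙ`. -/
lemma nsq_sub_gram_le {ι J : Type*} [Fintype ι] (I : Finset J) (x : J → ι → ℝ) {c ρ : ℝ}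
    (hρ : 0 ≤ ρ)
    (hlow : ∀ a : ι → ℝ, (1 - ρ) * nsq a ≤ c * ∑ n ∈ I, (a ⬝ᵥ x n) ^ 2)
    (hup : ∀ a : ι → ℝ, c * ∑ n ∈ I, (a ⬝ᵥ x n) ^ 2 ≤ (1 + ρ) * nsq a) (δ : ι → ℝ) :
    nsq (δ - c • ∑ n ∈ I, (δ ⬝ᵥ x n) • x n) ≤ ρ ^ 2 * nsq δ := by
  set H : (ι → ℝ) → (ι → ℝ) := fun δ => δ - c • ∑ n ∈ I, (δ ⬝ᵥ x n) • x n with hH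
  have hB : ∀ a b : ι → ℝ, a ⬝ᵥ H b = a ⬝ᵥ b - c * ∑ n ∈ I, (a ⬝ᵥ x n) * (b ⬝ᵥ x n) := by
    intro a b
    simp only [hH, dotProduct_sub, dotProduct_smul, dotProduct_sum, smul_eq_mul]
    congr 2
    exact Finset.sum_congr rfl fun n _ => by ring
  set X := nsq (H δ) with hX
  set Y := nsq δ with hY
  -- Polarization for the symmetric operator `H`, tested at `Hδ ± sδ`: the difference of the two
  -- quadratic forms is `4s ‖Hδ‖²`, and each is bounded by `ρ` times a squared norm. The choice `s =
  -- ρ` gives the claim, with `s = 1` in the degenerate case `ρ = 0`.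
  have key : ∀ s : ℝ, 2 * s * X ≤ ρ * (X + s ^ 2 * Y) := by
    intro s
    have h1 := hlow (H δ + s • δ)
    have h2 := hup (H δ - s • δ)
    have h3 : X = H δ ⬝ᵥ δ - c * ∑ n ∈ I, (H δ ⬝ᵥ x n) * (δ ⬝ᵥ x n) := by
      rw [← hB, hX, nsq_eq_dotProduct]
    have e1 : ∑ n ∈ I, ((H δ + s • δ) ⬝ᵥ x n) ^ 2 - ∑ n ∈ I, ((H δ - s • δ) ⬝ᵥ x n) ^ 2
        = 4 * s * ∑ n ∈ I, (H δ ⬝ᵥ x n) * (δ ⬝ᵥ x n) := by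
      rw [← Finset.sum_sub_distrib, Finset.mul_sum]
      refine Finset.sum_congr rfl fun n _ => ?_
      simp only [add_dotProduct, sub_dotProduct, smul_dotProduct, smul_eq_mul]; ring
    have e2 : nsq (H δ + s • δ) = X + 2 * s * (H δ ⬝ᵥ δ) + s ^ 2 * Y := by
      simp only [hX, hY, nsq_eq_dotProduct, add_dotProduct, dotProduct_add, smul_dotProduct,
        dotProduct_smul, smul_eq_mul, dotProduct_comm δ (H δ)]; ring
    have e3 : nsq (H δ - s • δ) = X - 2 * s * (H δ ⬝ᵥ δ) + s ^ 2 * Y := by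
      simp only [hX, hY, nsq_eq_dotProduct, sub_dotProduct, dotProduct_sub, smul_dotProduct,
        dotProduct_smul, smul_eq_mul, dotProduct_comm δ (H δ)]; ring
    have e4 : c * ∑ n ∈ I, ((H δ + s • δ) ⬝ᵥ x n) ^ 2 - c * ∑ n ∈ I, ((H δ - s • δ) ⬝ᵥ x n) ^ 2
        = 4 * s * (H δ ⬝ᵥ δ - X) := by
      rw [← mul_sub, e1, h3]; ring
    rw [e2] at h1
    rw [e3] at h2
    linarith
  have hX0 : 0 ≤ X := nsq_nonneg _
  have hY0 : 0 ≤ Y := nsq_nonneg _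
  rcases hρ.eq_or_lt with h | h
  · have := key 1
    rw [← h] at this ⊢; linarith
  · have := key ρ
    have h2 : ρ * X ≤ ρ * (ρ ^ 2 * Y) := by linarith
    exact le_of_mul_le_mul_left h2 h

/-- Duality. Take for `U` an orthonormal basis of `W`, padded by zeros to `q` vectors, and for `V`
the coefficients of `G` in it; the pairing is then the squared norm of the projection and the right
side is `g` times the norm. Uniformity over `U` is essential since `W` depends on the data. -/
lemma norm_projCols_le_of_forall {a b : Type*} [Fintype a] [Fintype b] {q : ℕ}
    (W : Submodule ℝ (EuclideanSpace ℝ a)) (hW : Module.finrank ℝ W ≤ q) (G : Matrix a b ℝ) {g : ℝ}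
    (hg : 0 ≤ g)
    (hG : ∀ U : EuclideanSpace ℝ (Fin q) →L[ℝ] EuclideanSpace ℝ a, ‖U‖ ≤ 1 →
      ∀ V : Fin q → b → ℝ, ∑ k, ∑ c, V k c * inner ℝ (U (EuclideanSpace.single k 1)) (cols G c)
        ≤ g * √(∑ k, nsq (V k))) :
    ‖projCols W (cols G)‖ ≤ g := by
  obtain ⟨m, rfl⟩ := Nat.exists_eq_add_of_le hW
  set β := stdOrthonormalBasis ℝ W
  set w : Fin (Module.finrank ℝ W + m) → EuclideanSpace ℝ a :=
    Fin.append (fun j => (β j : EuclideanSpace ℝ a)) (fun _ => 0) with hw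
  set U : EuclideanSpace ℝ (Fin (Module.finrank ℝ W + m)) →L[ℝ] EuclideanSpace ℝ a :=
    LinearMap.toContinuousLinearMap
      { toFun := fun z => ∑ k, z k • w k
        map_add' := fun x y => by simp [add_smul, Finset.sum_add_distrib]
        map_smul' := fun c x => by simp [mul_smul, Finset.smul_sum] } with hU
  have hUz : ∀ z, U z = ∑ k, z k • w k := fun z => rfl
  have hβo : Orthonormal ℝ (fun j => (β j : EuclideanSpace ℝ a)) :=
    β.orthonormal.comp_linearIsometry W.subtypeₗᵢ
  have hU1 : ‖U‖ ≤ 1 := by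
    refine ContinuousLinearMap.opNorm_le_bound _ zero_le_one fun z => ?_
    rw [one_mul]
    refine le_of_sq_le_sq ?_ (norm_nonneg _)
    rw [hUz, Fin.sum_univ_add]
    simp only [hw, Fin.append_left, Fin.append_right, smul_zero, Finset.sum_const_zero, add_zero]
    rw [← real_inner_self_eq_norm_sq, hβo.inner_sum, EuclideanSpace.norm_sq_eq, Fin.sum_univ_add]
    have h0 : 0 ≤ ∑ i : Fin m, ‖z (Fin.natAdd (Module.finrank ℝ W) i)‖ ^ 2 :=
      Finset.sum_nonneg fun _ _ => sq_nonneg _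
    have h1 : ∀ i : Fin (Module.finrank ℝ W), (starRingEnd ℝ) (z (Fin.castAdd m i)) * z (Fin.castAdd m i)
        = ‖z (Fin.castAdd m i)‖ ^ 2 := fun i => by simp [sq]
    simp_rw [h1]
    linarith
  have hUs : ∀ k, U (EuclideanSpace.single k 1) = w k := by
    intro k
    rw [hUz, Finset.sum_eq_single k]
    · simp
    · intro j _ hj; simp [hj]
    · simp
  set V : Fin (Module.finrank ℝ W + m) → b → ℝ := fun k c => inner ℝ (w k) (cols G c) with hV
  have h1 := hG U hU1 V
  have hsq : ‖projCols W (cols G)‖ ^ 2 = ∑ k, nsq (V k) := by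
    rw [norm_projCols_sq]
    simp only [nsq]
    rw [Finset.sum_comm]
    refine Finset.sum_congr rfl fun c _ => ?_
    rw [norm_sq_starProjection_eq_sum, Fin.sum_univ_add]
    simp only [hV, hw, Fin.append_left, Fin.append_right, inner_zero_left]
    simp [real_inner_comm, β]
  have h2 : ∑ k, ∑ c, V k c * inner ℝ (U (EuclideanSpace.single k 1)) (cols G c)
      = ∑ k, nsq (V k) := by
    simp only [hUs, nsq]
    exact Finset.sum_congr rfl fun k _ => Finset.sum_congr rfl fun c _ => by simp only [hV]; ring
  rw [h2, ← hsq, Real.sqrt_sq (norm_nonneg _)] at h1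
  rcases (norm_nonneg (projCols W (cols G))).eq_or_lt with h | h
  · rw [← h]; exact hg
  · rw [sq] at h1; exact le_of_mul_le_mul_right h1 h

variable {N P : ℕ}

lemma norm_tensor_sq (B : Tensor3 N P) : ‖B‖ ^ 2 = ∑ i, ∑ j, ∑ k, B (i, j, k) ^ 2 := by
  rw [EuclideanSpace.norm_sq_eq, Fintype.sum_prod_type]
  refine Finset.sum_congr rfl fun i _ => ?_
  rw [Fintype.sum_prod_type]
  simp

lemma norm_cols_unfold1 (B : Tensor3 N P) : ‖cols (unfold1 B)‖ = ‖B‖ := by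
  refine (sq_eq_sq₀ (norm_nonneg _) (norm_nonneg _)).1 ?_
  rw [norm_cols_sq, norm_tensor_sq, Finset.sum_comm]
  refine Finset.sum_congr rfl fun i _ => ?_
  rw [Fintype.sum_prod_type]; rfl

lemma norm_cols_unfold2 (B : Tensor3 N P) : ‖cols (unfold2 B)‖ = ‖B‖ := by
  refine (sq_eq_sq₀ (norm_nonneg _) (norm_nonneg _)).1 ?_
  rw [norm_cols_sq, norm_tensor_sq, Fintype.sum_prod_type]
  refine Finset.sum_congr rfl fun i _ => ?_
  rw [Finset.sum_comm]; rfl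

lemma norm_cols_unfold3 (B : Tensor3 N P) : ‖cols (unfold3 B)‖ = ‖B‖ := by
  refine (sq_eq_sq₀ (norm_nonneg _) (norm_nonneg _)).1 ?_
  rw [norm_cols_sq, norm_tensor_sq, Fintype.sum_prod_type]
  rfl

/-- The tensor `H ↦ (H₍₁₎ x)_i` as a vector. -/
def rowVec (i : Fin N) (x : Fin N × Fin P → ℝ) : Tensor3 N P :=
  WithLp.toLp 2 fun p => if p.1 = i then x p.2 else 0

lemma inner_rowVec (i : Fin N) (x : Fin N × Fin P → ℝ) (B : Tensor3 N P) :
    inner ℝ (rowVec i x) B = (unfold1 B *ᵥ x) i := by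
  simp only [PiLp.inner_apply, rowVec, Matrix.mulVec, dotProduct, unfold1, Matrix.of_apply]
  rw [Fintype.sum_prod_type, Finset.sum_eq_single i]
  · simp
  · intro j _ hj; simp [hj]
  · simp

lemma gradient_loss (T : ℕ) (v : ℤ → Fin N → ℝ) (B : Tensor3 N P) :
    gradient (loss T v) B = (1 / (T : ℝ)) • ∑ n ∈ Finset.Icc ((P : ℤ) + 1) (T : ℤ),
      ∑ i, (2 * ((unfold1 B *ᵥ lagVec P v n) i - v n i)) • rowVec i (lagVec P v n) := by
  apply HasGradientAt.gradient
  rw [hasGradientAt_iff_hasFDerivAt]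
  have h1 : ∀ n i, HasFDerivAt (fun B : Tensor3 N P =>
      (v n i - (unfold1 B *ᵥ lagVec P v n) i) ^ 2)
      ((2 * ((unfold1 B *ᵥ lagVec P v n) i - v n i)) •
        (innerSL ℝ (rowVec i (lagVec P v n)) : Tensor3 N P →L[ℝ] ℝ)) B := by
    intro n i
    have h2 : HasFDerivAt (fun B : Tensor3 N P => v n i - (unfold1 B *ᵥ lagVec P v n) i)
        (-(innerSL ℝ (rowVec i (lagVec P v n)) : Tensor3 N P →L[ℝ] ℝ)) B := by
      have h3 := (innerSL ℝ (rowVec i (lagVec P v n)) : Tensor3 N P →L[ℝ] ℝ).hasFDerivAt (x := B)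
      have := h3.const_sub (v n i)
      refine this.congr_of_eventuallyEq (Filter.Eventually.of_forall fun B => ?_)
      simp [inner_rowVec]
    have := h2.pow 2
    refine this.congr_fderiv ?_
    ext H
    simp; ring
  have h4 := (HasFDerivAt.fun_sum (u := Finset.Icc ((P : ℤ) + 1) (T : ℤ)) fun n _ =>
    HasFDerivAt.fun_sum (u := Finset.univ) fun i _ => h1 n i).const_mul (1 / (T : ℝ))
  refine h4.congr_fderiv ?_
  ext H
  simp

end gradientDescent
end
end MLRHAR

namespace MLRHAR
open scoped Matrix
noncomputable section

/-! ### Linear convergence of projected gradient descent -/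

section gradientDescent
variable {N P : ℕ}

/-- The residual `v_n - A₍₁₎ (v_{n-1}, …, v_{n-P})`. -/
def resid (A : Tensor3 N P) (v : ℤ → Fin N → ℝ) (n : ℤ) : Fin N → ℝ :=
  v n - unfold1 A *ᵥ lagVec P v n

/-- `∑ₙ ∑ₖ ⟨U eₖ, eₙ⟩ (Vₖ ⬝ᵥ xₙ)` for the residuals `eₙ` and the lag vectors `xₙ`. -/
def scoreForm {q : ℕ} (I : Finset ℤ) (e : ℤ → Fin N → ℝ) (x : ℤ → Fin N × Fin P → ℝ)
    (U : EuclideanSpace ℝ (Fin q) →L[ℝ] EuclideanSpace ℝ (Fin N))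
    (V : Fin q → Fin N × Fin P → ℝ) : ℝ :=
  ∑ n ∈ I, ∑ k, inner ℝ (U (EuclideanSpace.single k 1)) (WithLp.toLp 2 (e n)) * (V k ⬝ᵥ x n)

/-- The residual at `B` is the residual at `A` minus `(B - A)₍₁₎ xₙ`. Inserting this into the
gradient separates a linear map of the rows of `B - A` from a term that does not depend on `B`. -/
lemma unfold1_gradientStep (T : ℕ) (v : ℤ → Fin N → ℝ) (A B : Tensor3 N P) (τ : ℝ) :
    unfold1 (B - τ • gradient (loss T v) B) - unfold1 A
      = (Matrix.of fun i => unfold1 (B - A) i - (2 * τ / T) •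
          ∑ n ∈ Finset.Icc ((P : ℤ) + 1) (T : ℤ),
            (unfold1 (B - A) i ⬝ᵥ lagVec P v n) • lagVec P v n)
        + (2 * τ) • (Matrix.of fun i c => (1 / (T : ℝ)) *
          ∑ n ∈ Finset.Icc ((P : ℤ) + 1) (T : ℤ), resid A v n i * lagVec P v n c) := by
  ext i c
  obtain ⟨j, k⟩ := c
  have hrow : ∀ n, ∑ i', (2 * ((unfold1 B *ᵥ lagVec P v n) i' - v n i')) *
      rowVec i' (lagVec P v n) (i, j, k)
      = 2 * ((unfold1 B *ᵥ lagVec P v n) i - v n i) * lagVec P v n (j, k) := by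
    intro n
    rw [Finset.sum_eq_single i]
    · simp [rowVec]
    · intro i' _ hi; simp [rowVec, hi.symm]
    · simp
  have hg : gradient (loss T v) B (i, j, k) = (1 / (T : ℝ)) *
      ∑ n ∈ Finset.Icc ((P : ℤ) + 1) (T : ℤ),
        2 * ((unfold1 B *ᵥ lagVec P v n) i - v n i) * lagVec P v n (j, k) := by
    rw [gradient_loss]
    simp only [PiLp.smul_apply, WithLp.ofLp_sum, Finset.sum_apply, smul_eq_mul]
    congr 1
    refine Finset.sum_congr rfl fun n _ => ?_
    rw [← hrow n]
  have hdot : ∀ n, unfold1 (B - A) i ⬝ᵥ lagVec P v n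
      = (unfold1 B *ᵥ lagVec P v n) i - (unfold1 A *ᵥ lagVec P v n) i := by
    intro n
    have : unfold1 (B - A) i = unfold1 B i - unfold1 A i := rfl
    rw [this, sub_dotProduct]; rfl
  have e1 : (unfold1 (B - τ • gradient (loss T v) B) - unfold1 A) i (j, k)
      = B (i, j, k) - τ * gradient (loss T v) B (i, j, k) - A (i, j, k) := rfl
  have e2 : unfold1 (B - A) i (j, k) = B (i, j, k) - A (i, j, k) := rfl
  rw [e1, hg]
  simp only [Matrix.add_apply, Matrix.of_apply, Matrix.smul_apply, Pi.sub_apply, Pi.smul_apply,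
    Finset.sum_apply, smul_eq_mul, e2, hdot, resid]
  have e3 : ∑ n ∈ Finset.Icc ((P : ℤ) + 1) (T : ℤ),
        2 * ((unfold1 B *ᵥ lagVec P v n) i - v n i) * lagVec P v n (j, k)
      = 2 * (∑ n ∈ Finset.Icc ((P : ℤ) + 1) (T : ℤ), ((unfold1 B *ᵥ lagVec P v n) i
          - (unfold1 A *ᵥ lagVec P v n) i) * lagVec P v n (j, k))
        - 2 * ∑ n ∈ Finset.Icc ((P : ℤ) + 1) (T : ℤ),
          (v n i - (unfold1 A *ᵥ lagVec P v n) i) * lagVec P v n (j, k) := by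
    rw [← mul_sub, ← Finset.sum_sub_distrib, Finset.mul_sum]
    exact Finset.sum_congr rfl fun n _ => by ring
  rw [e3]
  ring

/-- One step of projected gradient descent under restricted eigenvalue bounds for the Gram matrix
of the lag vectors and a bound for the score on matrices of low rank. -/
theorem pgd_step {T : ℕ} {v : ℤ → Fin N → ℝ} {A B B' : Tensor3 N P} {r r' : Fin 3 → ℕ}
    {τ β ρ g : ℝ} (hT : 0 < T) (hstep : IsPGDStep (loss T v) τ r' B B')
    (hA : A ∈ tuckerSet N P r) (hβ0 : 0 ≤ β)
    (hβ : ∀ i, (r i : ℝ) ≤ β ^ 2 * ((r' i : ℝ) - r i)) (hρ : 0 ≤ ρ) (hτ : 0 ≤ τ)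
    (hlow : ∀ a, (1 - ρ) * nsq a
      ≤ (2 * τ / T) * ∑ n ∈ Finset.Icc ((P : ℤ) + 1) (T : ℤ), (a ⬝ᵥ lagVec P v n) ^ 2)
    (hup : ∀ a, (2 * τ / T) * ∑ n ∈ Finset.Icc ((P : ℤ) + 1) (T : ℤ), (a ⬝ᵥ lagVec P v n) ^ 2
      ≤ (1 + ρ) * nsq a)
    (hg : 0 ≤ g)
    (hG : ∀ U : EuclideanSpace ℝ (Fin (r 0 + r' 0)) →L[ℝ] EuclideanSpace ℝ (Fin N), ‖U‖ ≤ 1 →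
      ∀ V, scoreForm (Finset.Icc ((P : ℤ) + 1) (T : ℤ)) (resid A v) (lagVec P v) U V
        ≤ T * (g * √(∑ k, nsq (V k)))) :
    ‖B' - A‖ ≤ (1 + β) ^ 3 * (ρ * ‖B - A‖ + 2 * τ * g) := by
  obtain ⟨B₁, B₂, h1, h2, h3⟩ := hstep
  obtain ⟨W1, hW1, hb1⟩ := h1.norm_sub_le hA.1 hβ0 (hβ 0)
  obtain ⟨W2, -, hb2⟩ := h2.norm_sub_le hA.2.1 hβ0 (hβ 1)
  obtain ⟨W3, -, hb3⟩ := h3.norm_sub_le hA.2.2 hβ0 (hβ 2)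
  have n3 : ‖B' - A‖ ≤ (1 + β) * ‖B₂ - A‖ := by
    have e1 : cols (unfold3 B' - unfold3 A) = cols (unfold3 (B' - A)) := rfl
    have e2 : cols (unfold3 B₂ - unfold3 A) = cols (unfold3 (B₂ - A)) := rfl
    rw [e1, e2, norm_cols_unfold3] at hb3
    refine hb3.trans ?_
    gcongr
    exact (norm_projCols_le _ _).trans (norm_cols_unfold3 _).le
  have n2 : ‖B₂ - A‖ ≤ (1 + β) * ‖B₁ - A‖ := by
    have e1 : cols (unfold2 B₂ - unfold2 A) = cols (unfold2 (B₂ - A)) := rfl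
    have e2 : cols (unfold2 B₁ - unfold2 A) = cols (unfold2 (B₁ - A)) := rfl
    rw [e1, e2, norm_cols_unfold2] at hb2
    refine hb2.trans ?_
    gcongr
    exact (norm_projCols_le _ _).trans (norm_cols_unfold2 _).le
  have hT0 : (0 : ℝ) < T := by exact_mod_cast hT
  -- Only the truncation in mode 1 needs the refined form with the projection onto `W1`: it
  -- restricts the noise to a subspace of dimension `r 0 + r' 0`. The truncations in modes 2 and 3
  -- merely cost a factor `1 + β` each.
  have n1 : ‖B₁ - A‖ ≤ (1 + β) * (ρ * ‖B - A‖ + 2 * τ * g) := by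
    have e1 : cols (unfold1 B₁ - unfold1 A) = cols (unfold1 (B₁ - A)) := rfl
    rw [e1, norm_cols_unfold1, unfold1_gradientStep, cols_add, projCols_add] at hb1
    refine hb1.trans ?_
    gcongr
    refine (norm_add_le _ _).trans (add_le_add ?_ ?_)
    · refine (norm_projCols_le _ _).trans ?_
      refine le_of_sq_le_sq ?_ (by positivity)
      rw [norm_cols_sq, mul_pow, ← norm_cols_unfold1, norm_cols_sq, Finset.sum_comm,
        Finset.sum_comm (s := Finset.univ (α := Fin N × Fin P)), Finset.mul_sum]
      exact Finset.sum_le_sum fun i _ => nsq_sub_gram_le _ (lagVec P v) hρ hlow hup _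
    · set G : Matrix (Fin N) (Fin N × Fin P) ℝ := Matrix.of fun i c => (1 / (T : ℝ)) *
          ∑ n ∈ Finset.Icc ((P : ℤ) + 1) (T : ℤ), resid A v n i * lagVec P v n c with hGd
      have e2 : projCols W1 (cols ((2 * τ) • G)) = (2 * τ) • projCols W1 (cols G) := by
        have e3 : cols ((2 * τ) • G) = (2 * τ) • cols G := rfl
        rw [e3]; ext c : 1
        simp [projCols]
      rw [e2, norm_smul, Real.norm_of_nonneg (by positivity)]
      refine mul_le_mul_of_nonneg_left ?_ (by positivity)
      refine norm_projCols_le_of_forall W1 hW1 G hg fun U hU V => ?_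
      have h5 := hG U hU V
      have e4 : ∑ k, ∑ c, V k c * inner ℝ (U (EuclideanSpace.single k 1)) (cols G c)
          = (1 / (T : ℝ)) *
            scoreForm (Finset.Icc ((P : ℤ) + 1) (T : ℤ)) (resid A v) (lagVec P v) U V := by
        have e5 : ∀ c, cols G c = (1 / (T : ℝ)) • ∑ n ∈ Finset.Icc ((P : ℤ) + 1) (T : ℤ),
            lagVec P v n c • WithLp.toLp 2 (resid A v n) := by
          intro c; ext i
          simp [cols, hGd, WithLp.ofLp_sum, mul_comm]
        simp only [e5, real_inner_smul_right, inner_sum, scoreForm]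
        rw [Finset.sum_comm (s := Finset.Icc ((P : ℤ) + 1) (T : ℤ)), Finset.mul_sum]
        refine Finset.sum_congr rfl fun k _ => ?_
        simp only [dotProduct, Finset.mul_sum]
        rw [Finset.sum_comm]
        exact Finset.sum_congr rfl fun n _ => Finset.sum_congr rfl fun c _ => by ring
      rw [e4]
      calc _ ≤ (1 / (T : ℝ)) * (T * (g * √(∑ k, nsq (V k)))) := by gcongr
        _ = _ := by field_simp
  have hb0 : 0 ≤ 1 + β := by linarith
  calc ‖B' - A‖ ≤ (1 + β) * ((1 + β) * ((1 + β) * (ρ * ‖B - A‖ + 2 * τ * g))) :=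
        n3.trans (mul_le_mul_of_nonneg_left (n2.trans (mul_le_mul_of_nonneg_left n1 hb0)) hb0)
    _ = _ := by ring

lemma le_of_affine_recursion {a : ℕ → ℝ} {θ c : ℝ} (hθ0 : 0 ≤ θ)
    (h : ∀ k, a (k + 1) ≤ θ * a k + (1 - θ) * c) (hc : 0 ≤ c) (K : ℕ) :
    a K ≤ θ ^ K * a 0 + c := by
  have : a K ≤ θ ^ K * a 0 + (1 - θ ^ K) * c := by
    induction K with
    | zero => simp
    | succ K ih =>
      calc a (K + 1) ≤ θ * a K + (1 - θ) * c := h K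
        _ ≤ θ * (θ ^ K * a 0 + (1 - θ ^ K) * c) + (1 - θ) * c := by gcongr
        _ = _ := by ring
  nlinarith [pow_nonneg hθ0 K, mul_nonneg (pow_nonneg hθ0 K) hc]

/-- The running-rank condition in the form used for the truncation step. -/
lemma rank_condition {x : ℝ} (hx0 : 0 < x) (hx1 : x ≤ 1) {r r' : ℕ}
    (h : ((1 + x / 24) ^ (1 / 3 : ℝ) - 1) ^ (-2 : ℤ) * (r : ℝ) ≤ (r' : ℝ)) :
    (r : ℝ) ≤ (x / 36) ^ 2 * ((r' : ℝ) - r) := by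
  set s : ℝ := (1 + x / 24) ^ (1 / 3 : ℝ) - 1 with hs
  have hs0 : 0 < s := by
    have : 1 < (1 + x / 24) ^ (1 / 3 : ℝ) := Real.one_lt_rpow (by linarith) (by norm_num)
    linarith
  -- By Bernoulli's inequality `(1 + x/72)³ ≥ 1 + x/24`. The factor two between `x/72` and the
  -- claimed `x/36` pays for replacing `r'` by `r' - r`.
  have hs1 : s ≤ x / 72 := by
    have h1 : (1 + x / 24) ^ (1 / 3 : ℝ) ≤ ((1 + x / 72) ^ (3 : ℕ)) ^ (1 / 3 : ℝ) := by
      apply Real.rpow_le_rpow (by linarith) _ (by norm_num)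
      nlinarith [sq_nonneg x, pow_pos hx0 3]
    have h2 : ((1 + x / 72) ^ (3 : ℕ)) ^ (1 / 3 : ℝ) = 1 + x / 72 := by
      have := Real.pow_rpow_inv_natCast (x := 1 + x / 72) (n := 3) (by linarith) (by norm_num)
      simpa using this
    rw [h2] at h1; linarith
  have h3 : (r : ℝ) ≤ s ^ 2 * r' := by
    rw [zpow_neg, inv_mul_le_iff₀ (by positivity)] at h
    exact_mod_cast h
  have h4 : s ^ 2 ≤ (x / 72) ^ 2 := by gcongr
  have hr' : (0 : ℝ) ≤ r' := Nat.cast_nonneg _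
  have h5 : (r : ℝ) ≤ (x / 72) ^ 2 * r' := h3.trans (by gcongr)
  have h6 : (x / 36) ^ 2 ≤ 1 := by nlinarith
  nlinarith [mul_nonneg (sq_nonneg x) hr']

/-- Linear convergence of projected gradient descent on a good data set. -/
theorem pgd_converges {T : ℕ} {v : ℤ → Fin N → ℝ} {A : Tensor3 N P} {B : ℕ → Tensor3 N P}
    {r r' : Fin 3 → ℕ} {kl ku g : ℝ} (hT : 0 < T) (hkl : 0 < kl) (hklu : kl ≤ ku)
    (hA : A ∈ tuckerSet N P r)
    (hstep : ∀ k, IsPGDStep (loss T v) (2 / (3 * ku)) r' (B k) (B (k + 1)))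
    (hr : ∀ i, ((1 + kl / (24 * ku)) ^ (1 / 3 : ℝ) - 1) ^ (-2 : ℤ) * (r i : ℝ) ≤ (r' i : ℝ))
    (hlow : ∀ a, 4 / 5 * kl * T * nsq a
      ≤ ∑ n ∈ Finset.Icc ((P : ℤ) + 1) (T : ℤ), (a ⬝ᵥ lagVec P v n) ^ 2)
    (hup : ∀ a, ∑ n ∈ Finset.Icc ((P : ℤ) + 1) (T : ℤ), (a ⬝ᵥ lagVec P v n) ^ 2
      ≤ 6 / 5 * ku * T * nsq a)
    (hg : 0 ≤ g)
    (hG : ∀ U : EuclideanSpace ℝ (Fin (r 0 + r' 0)) →L[ℝ] EuclideanSpace ℝ (Fin N), ‖U‖ ≤ 1 →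
      ∀ V, scoreForm (Finset.Icc ((P : ℤ) + 1) (T : ℤ)) (resid A v) (lagVec P v) U V
        ≤ T * (g * √(∑ k, nsq (V k)))) (K : ℕ) :
    ‖B K - A‖ ≤ (1 - kl / (24 * ku)) ^ K * ‖B 0 - A‖ + 14 / kl * g := by
  have hku : 0 < ku := hkl.trans_le hklu
  have hT0 : (0 : ℝ) < T := by exact_mod_cast hT
  set x : ℝ := kl / ku with hx
  have hx0 : 0 < x := div_pos hkl hku
  have hx1 : x ≤ 1 := (div_le_one hku).2 hklu
  have hx24 : kl / (24 * ku) = x / 24 := by rw [hx]; field_simp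
  rw [hx24] at hr ⊢
  have hsc : 2 * (2 / (3 * ku)) / T = 4 / (3 * ku * T) := by field_simp; norm_num
  -- With this step size the rescaled Gram matrix lies between `16/15 · x` and `8/5`, hence between
  -- `1 - ρ` and `1 + ρ` for `ρ = 1 - x/3`, because `x ≤ 1`.
  have step : ∀ k, ‖B (k + 1) - A‖ ≤ (1 + x / 36) ^ 3 *
      ((1 - x / 3) * ‖B k - A‖ + 2 * (2 / (3 * ku)) * g) := by
    intro k
    refine pgd_step hT (hstep k) hA (by positivity) (fun i => rank_condition hx0 hx1 (hr i))
      (by linarith) (by positivity) ?_ ?_ hg hG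
    · intro a
      have h1 := hlow a
      have h2 := nsq_nonneg a
      rw [hsc]
      calc (1 - (1 - x / 3)) * nsq a ≤ 16 / 15 * x * nsq a := by nlinarith
        _ = 4 / (3 * ku * T) * (4 / 5 * kl * T * nsq a) := by rw [hx]; field_simp; ring
        _ ≤ _ := by gcongr
    · intro a
      have h1 := hup a
      have h2 := nsq_nonneg a
      rw [hsc]
      calc _ ≤ 4 / (3 * ku * T) * (6 / 5 * ku * T * nsq a) := by gcongr
        _ = 8 / 5 * nsq a := by field_simp; ring
        _ ≤ _ := by nlinarith
  have hc3 : (1 + x / 36) ^ 3 ≤ 1 + x / 11 := by nlinarith [sq_nonneg x, mul_pos hx0 hx0]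
  -- The product `(1 + x/11)(1 - x/3)` is at most `1 - x/5`, which is better than the rate `1 -
  -- x/24` finally claimed. The noise term is written as `x/5` times its fixed point, in the form
  -- required for iterating.
  have hrec : ∀ k, ‖B (k + 1) - A‖ ≤ (1 - x / 5) * ‖B k - A‖ + (1 - (1 - x / 5)) * (14 / kl * g) := by
    intro k
    have h0 : 0 ≤ ‖B k - A‖ := norm_nonneg _
    have h1 : 0 ≤ (1 - x / 3) * ‖B k - A‖ + 2 * (2 / (3 * ku)) * g := by
      have : 0 ≤ 1 - x / 3 := by linarith
      positivity
    refine (step k).trans ((mul_le_mul_of_nonneg_right hc3 h1).trans ?_)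
    rw [mul_add]
    refine add_le_add ?_ ?_
    · rw [← mul_assoc]
      refine mul_le_mul_of_nonneg_right ?_ h0
      nlinarith
    · calc (1 + x / 11) * (2 * (2 / (3 * ku)) * g) ≤ (12 / 11) * (2 * (2 / (3 * ku)) * g) := by
            gcongr; linarith
        _ ≤ 14 / 5 * (1 / ku) * g := by
            have : (12 / 11 : ℝ) * (2 * (2 / (3 * ku)) * g) = 16 / 11 * (1 / ku) * g := by
              field_simp; ring
            rw [this]
            have : 0 ≤ 1 / ku * g := by positivity
            linarith
        _ = _ := by rw [hx]; field_simp; ring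
  refine (le_of_affine_recursion (a := fun k => ‖B k - A‖) (by linarith) hrec
    (by positivity) K).trans ?_
  gcongr
  · linarith
  · linarith

end gradientDescent
end
end MLRHAR

namespace MLRHAR
open scoped Matrix
noncomputable section

/-! ### Extreme eigenvalues on the unit circle as bounds for quadratic forms -/

section spectralBounds
variable {N P : ℕ} {𝕜 : Type*} [RCLike 𝕜]

lemma re_quadForm_eq (M : Matrix (Fin N) (Fin N) 𝕜) (hM : M.IsHermitian) (v : Fin N → 𝕜) :
    RCLike.re (star v ⬝ᵥ (M *ᵥ v))
      = ∑ i, hM.eigenvalues i * ‖inner 𝕜 (hM.eigenvectorBasis i) (WithLp.toLp 2 v)‖ ^ 2 := by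
  set b := hM.eigenvectorBasis
  set x : EuclideanSpace 𝕜 (Fin N) := WithLp.toLp 2 v
  set y : EuclideanSpace 𝕜 (Fin N) := WithLp.toLp 2 (M *ᵥ v)
  have h1 : star v ⬝ᵥ (M *ᵥ v) = inner 𝕜 x y := by
    simp [x, y, PiLp.inner_apply, dotProduct, mul_comm]
  have h2 : ∀ i, inner 𝕜 (b i) y = hM.eigenvalues i * inner 𝕜 (b i) x := by
    intro i
    have h3 : inner 𝕜 (b i) y = star (M *ᵥ (b i).ofLp) ⬝ᵥ v := by
      rw [Matrix.star_mulVec, hM.eq, ← Matrix.dotProduct_mulVec]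
      simp [y, PiLp.inner_apply, dotProduct, mul_comm]
    rw [h3, hM.mulVec_eigenvectorBasis]
    simp only [x, PiLp.inner_apply, dotProduct, Finset.mul_sum, b, Pi.star_apply, Pi.smul_apply]
    refine Finset.sum_congr rfl fun j _ => ?_
    rw [star_smul, RCLike.real_smul_eq_coe_mul, RCLike.inner_apply, star_trivial]
    simp only [RCLike.star_def]
    ring
  rw [h1, ← b.sum_inner_mul_inner, map_sum]
  refine Finset.sum_congr rfl fun i _ => ?_
  rw [h2, mul_left_comm, ← inner_conj_symm x (b i), RCLike.conj_mul]
  norm_cast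

lemma sum_norm_inner_eigenvectorBasis (M : Matrix (Fin N) (Fin N) 𝕜) (hM : M.IsHermitian)
    (v : Fin N → 𝕜) :
    ∑ i, ‖inner 𝕜 (hM.eigenvectorBasis i) (WithLp.toLp 2 v)‖ ^ 2 = ∑ i, ‖v i‖ ^ 2 := by
  rw [hM.eigenvectorBasis.sum_sq_norm_inner_right, EuclideanSpace.norm_sq_eq]

lemma eigenvalues_mem_spectrum (M : Matrix (Fin N) (Fin N) 𝕜) (hM : M.IsHermitian) (i : Fin N) :
    hM.eigenvalues i ∈ spectrum ℝ M := by
  rw [hM.spectrum_real_eq_range_eigenvalues]; exact ⟨i, rfl⟩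

lemma finite_spectrum (M : Matrix (Fin N) (Fin N) 𝕜) (hM : M.IsHermitian) :
    (spectrum ℝ M).Finite := by
  rw [hM.spectrum_real_eq_range_eigenvalues]; exact Set.finite_range _

lemma lambdaMin_mul_le (M : Matrix (Fin N) (Fin N) 𝕜) (hM : M.IsHermitian) (v : Fin N → 𝕜) :
    lambdaMin M * ∑ i, ‖v i‖ ^ 2 ≤ RCLike.re (star v ⬝ᵥ (M *ᵥ v)) := by
  rw [re_quadForm_eq M hM, ← sum_norm_inner_eigenvectorBasis M hM, Finset.mul_sum]
  refine Finset.sum_le_sum fun i _ => ?_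
  gcongr
  exact csInf_le (finite_spectrum M hM).bddBelow (eigenvalues_mem_spectrum M hM i)

lemma le_lambdaMax_mul (M : Matrix (Fin N) (Fin N) 𝕜) (hM : M.IsHermitian) (v : Fin N → 𝕜) :
    RCLike.re (star v ⬝ᵥ (M *ᵥ v)) ≤ lambdaMax M * ∑ i, ‖v i‖ ^ 2 := by
  rw [re_quadForm_eq M hM, ← sum_norm_inner_eigenvectorBasis M hM, Finset.mul_sum]
  refine Finset.sum_le_sum fun i _ => ?_
  gcongr
  exact le_csSup (finite_spectrum M hM).bddAbove (eigenvalues_mem_spectrum M hM i)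

lemma eigenvalue_eq_re_quadForm (M : Matrix (Fin N) (Fin N) 𝕜) (hM : M.IsHermitian) (i : Fin N) :
    ∃ v : Fin N → 𝕜, ∑ j, ‖v j‖ ^ 2 = 1 ∧ hM.eigenvalues i = RCLike.re (star v ⬝ᵥ (M *ᵥ v)) := by
  classical
  refine ⟨(hM.eigenvectorBasis i).ofLp, ?_, ?_⟩
  · rw [← EuclideanSpace.norm_sq_eq, hM.eigenvectorBasis.orthonormal.1 i, one_pow]
  · rw [re_quadForm_eq M hM, Finset.sum_eq_single i]
    · have : inner 𝕜 (hM.eigenvectorBasis i) (WithLp.toLp 2 (hM.eigenvectorBasis i).ofLp)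
          = (1 : 𝕜) := by
        rw [WithLp.toLp_ofLp, inner_self_eq_norm_sq_to_K, hM.eigenvectorBasis.orthonormal.1 i]
        simp
      rw [this]; simp
    · intro j _ hj
      have : inner 𝕜 (hM.eigenvectorBasis j) (WithLp.toLp 2 (hM.eigenvectorBasis i).ofLp)
          = (0 : 𝕜) := by
        rw [WithLp.toLp_ofLp]; exact hM.eigenvectorBasis.orthonormal.2 hj
      rw [this]; simp
    · simp

lemma le_lambdaMin (hN : 1 ≤ N) (M : Matrix (Fin N) (Fin N) 𝕜) (hM : M.IsHermitian) {c : ℝ}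
    (hc : ∀ v : Fin N → 𝕜, ∑ j, ‖v j‖ ^ 2 = 1 → c ≤ RCLike.re (star v ⬝ᵥ (M *ᵥ v))) :
    c ≤ lambdaMin M := by
  refine le_csInf ⟨_, eigenvalues_mem_spectrum M hM ⟨0, hN⟩⟩ fun x hx => ?_
  rw [hM.spectrum_real_eq_range_eigenvalues] at hx
  obtain ⟨i, rfl⟩ := hx
  obtain ⟨v, hv, he⟩ := eigenvalue_eq_re_quadForm M hM i
  rw [he]; exact hc v hv

lemma lambdaMax_le (hN : 1 ≤ N) (M : Matrix (Fin N) (Fin N) 𝕜) (hM : M.IsHermitian) {c : ℝ}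
    (hc : ∀ v : Fin N → 𝕜, ∑ j, ‖v j‖ ^ 2 = 1 → RCLike.re (star v ⬝ᵥ (M *ᵥ v)) ≤ c) :
    lambdaMax M ≤ c := by
  refine csSup_le ⟨_, eigenvalues_mem_spectrum M hM ⟨0, hN⟩⟩ fun x hx => ?_
  rw [hM.spectrum_real_eq_range_eigenvalues] at hx
  obtain ⟨i, rfl⟩ := hx
  obtain ⟨v, hv, he⟩ := eigenvalue_eq_re_quadForm M hM i
  rw [he]; exact hc v hv

lemma re_quadForm_gram (M : Matrix (Fin N) (Fin N) 𝕜) (v : Fin N → 𝕜) :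
    RCLike.re (star v ⬝ᵥ ((Mᴴ * M) *ᵥ v)) = ∑ i, ‖(M *ᵥ v) i‖ ^ 2 := by
  rw [← Matrix.mulVec_mulVec, Matrix.dotProduct_mulVec, ← Matrix.star_mulVec, dotProduct, map_sum]
  refine Finset.sum_congr rfl fun i _ => ?_
  rw [Pi.star_apply, RCLike.star_def, RCLike.conj_mul]
  norm_cast

lemma continuous_charPoly_energy (A : Tensor3 N P) :
    Continuous fun p : Circle × EuclideanSpace ℂ (Fin N) =>
      ∑ i, ‖(charPoly A (p.1 : ℂ) *ᵥ p.2.ofLp) i‖ ^ 2 := by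
  simp only [Matrix.mulVec, dotProduct, charPoly, Matrix.sub_apply, Matrix.sum_apply,
    Matrix.smul_apply, Matrix.of_apply, smul_eq_mul]
  fun_prop

/-- Compactness of the circle times the unit sphere. The bound makes the supremum in `muMax` a
genuine one; a real supremum over an unbounded family would be zero by convention. -/
lemma exists_charPoly_energy_le (A : Tensor3 N P) : ∃ C : ℝ, ∀ (z : Circle) (v : Fin N → ℂ),
    ∑ j, ‖v j‖ ^ 2 = 1 → ∑ i, ‖(charPoly A (z : ℂ) *ᵥ v) i‖ ^ 2 ≤ C := by
  have hK : IsCompact ((Set.univ : Set Circle) ×ˢ Metric.sphere (0 : EuclideanSpace ℂ (Fin N)) 1) :=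
    isCompact_univ.prod (isCompact_sphere _ _)
  obtain ⟨C, hC⟩ := hK.bddAbove_image (continuous_charPoly_energy A).continuousOn
  refine ⟨C, fun z v hv => hC ⟨(z, WithLp.toLp 2 v), ⟨Set.mem_univ _, ?_⟩, rfl⟩⟩
  rw [mem_sphere_zero_iff_norm, ← sq_eq_sq₀ (norm_nonneg _) zero_le_one, EuclideanSpace.norm_sq_eq,
    one_pow]
  exact hv

lemma bddBelow_muMin (hN : 1 ≤ N) (A : Tensor3 N P) : BddBelow (Set.range fun z : Circle =>
    lambdaMin ((charPoly A (z : ℂ)).conjTranspose * charPoly A (z : ℂ))) := by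
  refine ⟨0, ?_⟩
  rintro _ ⟨z, rfl⟩
  refine le_lambdaMin hN _ (Matrix.isHermitian_conjTranspose_mul_self _) fun v _ => ?_
  rw [re_quadForm_gram]; positivity

lemma bddAbove_muMax (hN : 1 ≤ N) (A : Tensor3 N P) : BddAbove (Set.range fun z : Circle =>
    lambdaMax ((charPoly A (z : ℂ)).conjTranspose * charPoly A (z : ℂ))) := by
  obtain ⟨C, hC⟩ := exists_charPoly_energy_le A
  refine ⟨C, ?_⟩
  rintro _ ⟨z, rfl⟩
  refine lambdaMax_le hN _ (Matrix.isHermitian_conjTranspose_mul_self _) fun v hv => ?_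
  rw [re_quadForm_gram]; exact hC z v hv

lemma muMin_mul_le (hN : 1 ≤ N) (A : Tensor3 N P) {z : ℂ} (hz : ‖z‖ = 1) (v : Fin N → ℂ) :
    muMin A * ∑ i, ‖v i‖ ^ 2 ≤ ∑ i, ‖(charPoly A z *ᵥ v) i‖ ^ 2 := by
  obtain ⟨w, rfl⟩ : ∃ w : Circle, (w : ℂ) = z := ⟨⟨z, mem_sphere_zero_iff_norm.2 hz⟩, rfl⟩
  rw [← re_quadForm_gram]
  refine le_trans ?_ (lambdaMin_mul_le _ (Matrix.isHermitian_conjTranspose_mul_self _) v)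
  gcongr
  exact ciInf_le (bddBelow_muMin hN A) w

lemma le_muMax_mul (hN : 1 ≤ N) (A : Tensor3 N P) {z : ℂ} (hz : ‖z‖ = 1) (v : Fin N → ℂ) :
    ∑ i, ‖(charPoly A z *ᵥ v) i‖ ^ 2 ≤ muMax A * ∑ i, ‖v i‖ ^ 2 := by
  obtain ⟨w, rfl⟩ : ∃ w : Circle, (w : ℂ) = z := ⟨⟨z, mem_sphere_zero_iff_norm.2 hz⟩, rfl⟩
  rw [← re_quadForm_gram]
  refine (le_lambdaMax_mul _ (Matrix.isHermitian_conjTranspose_mul_self _) v).trans ?_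
  gcongr
  exact le_ciSup (bddAbove_muMax hN A) w

/-- The energy `‖A(z)v‖²` attains its minimum on the compact product of the circle and the unit
sphere, and it vanishes nowhere there because `A(z)` is invertible. -/
lemma muMin_pos (hN : 1 ≤ N) (A : Tensor3 N P)
    (h : ∀ z : Circle, (charPoly A (z : ℂ)).det ≠ 0) : 0 < muMin A := by
  have hK : IsCompact ((Set.univ : Set Circle) ×ˢ Metric.sphere (0 : EuclideanSpace ℂ (Fin N)) 1) :=
    isCompact_univ.prod (isCompact_sphere _ _)
  have hne : ((Set.univ : Set Circle) ×ˢ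
      Metric.sphere (0 : EuclideanSpace ℂ (Fin N)) 1).Nonempty := by
    refine ⟨(1, EuclideanSpace.single ⟨0, hN⟩ 1), Set.mem_univ _, ?_⟩
    simp
  obtain ⟨⟨z₀, v₀⟩, ⟨-, hv₀⟩, hmin⟩ := hK.exists_isMinOn hne
    (continuous_charPoly_energy A).continuousOn
  set c := ∑ i, ‖(charPoly A (z₀ : ℂ) *ᵥ v₀.ofLp) i‖ ^ 2 with hc
  have hc0 : 0 < c := by
    have h1 : charPoly A (z₀ : ℂ) *ᵥ v₀.ofLp ≠ 0 := by
      intro h0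
      have := Matrix.eq_zero_of_mulVec_eq_zero (h z₀) h0
      have h2 : v₀ = 0 := by ext i; exact congrFun this i
      rw [h2] at hv₀; simp at hv₀
    obtain ⟨i, hi⟩ := Function.ne_iff.1 h1
    refine Finset.sum_pos' (fun _ _ => sq_nonneg _) ⟨i, Finset.mem_univ i, ?_⟩
    have : 0 < ‖(charPoly A (z₀ : ℂ) *ᵥ v₀.ofLp) i‖ := norm_pos_iff.2 hi
    positivity
  refine hc0.trans_le (le_ciInf fun z => ?_)
  refine le_lambdaMin hN _ (Matrix.isHermitian_conjTranspose_mul_self _) fun v hv => ?_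
  rw [re_quadForm_gram]
  refine hmin (a := (z, WithLp.toLp 2 v)) ⟨Set.mem_univ _, ?_⟩
  rw [mem_sphere_zero_iff_norm, ← sq_eq_sq₀ (norm_nonneg _) zero_le_one, EuclideanSpace.norm_sq_eq,
    one_pow]
  exact hv

lemma muMax_nonneg (hN : 1 ≤ N) (A : Tensor3 N P) : 0 ≤ muMax A := by
  have h := le_muMax_mul hN A (z := 1) norm_one (Pi.single ⟨0, hN⟩ 1)
  have h1 : ∑ i, ‖(Pi.single (⟨0, hN⟩ : Fin N) (1 : ℂ) : Fin N → ℂ) i‖ ^ 2 = 1 := by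
    simp [Pi.single_apply, apply_ite]
  rw [h1, mul_one] at h
  exact le_trans (Finset.sum_nonneg fun _ _ => sq_nonneg _) h

end spectralBounds

/-! ### Energy bounds for the autoregressive filter by discrete Fourier transform -/

section parseval
variable {N P : ℕ}

/-- Orthogonality of the characters of the cyclic group of order `L`. For finitely supported
sequences the roots of unity replace integration over the circle. -/
lemma parseval_roots (L : ℕ) (hL : 0 < L) (h : ℕ → ℂ) :
    ∑ j ∈ Finset.range L, ‖∑ n ∈ Finset.range L,
        (Complex.exp (2 * Real.pi * Complex.I / L) ^ j) ^ n * h n‖ ^ 2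
      = L * ∑ n ∈ Finset.range L, ‖h n‖ ^ 2 := by
  set ζ := Complex.exp (2 * Real.pi * Complex.I / L) with hζd
  have hζ : IsPrimitiveRoot ζ L := Complex.isPrimitiveRoot_exp L hL.ne'
  have hn1 : ‖ζ‖ = 1 := hζ.norm'_eq_one hL.ne'
  have hconj : (starRingEnd ℂ) ζ = ζ⁻¹ := (Complex.inv_eq_conj hn1).symm
  have hζ0 : ζ ≠ 0 := Complex.exp_ne_zero _
  have key : ∀ n ∈ Finset.range L, ∀ m ∈ Finset.range L,
      ∑ j ∈ Finset.range L, (ζ ^ n * (ζ⁻¹) ^ m) ^ j = if n = m then (L : ℂ) else 0 := by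
    intro n hn m hm
    split_ifs with hnm
    · subst hnm
      rw [← mul_pow, mul_inv_cancel₀ hζ0]; simp
    · have hw : ζ ^ n * (ζ⁻¹) ^ m ≠ 1 := by
        intro h1
        rw [inv_pow, mul_inv_eq_one₀ (pow_ne_zero _ hζ0)] at h1
        exact hnm (hζ.pow_inj (Finset.mem_range.1 hn) (Finset.mem_range.1 hm) h1)
      rw [geom_sum_eq hw]
      have : (ζ ^ n * (ζ⁻¹) ^ m) ^ L = 1 := by
        rw [mul_pow, ← pow_mul, ← pow_mul, mul_comm n, mul_comm m, pow_mul, pow_mul, inv_pow,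
          hζ.pow_eq_one]; simp
      rw [this]; simp
  have h1 : ∀ w : ℂ, ((‖w‖ ^ 2 : ℝ) : ℂ) = w * (starRingEnd ℂ) w := fun w => by
    rw [Complex.mul_conj, Complex.normSq_eq_norm_sq]
  have hgoal : ((∑ j ∈ Finset.range L, ‖∑ n ∈ Finset.range L, (ζ ^ j) ^ n * h n‖ ^ 2 : ℝ) : ℂ)
      = ((L * ∑ n ∈ Finset.range L, ‖h n‖ ^ 2 : ℝ) : ℂ) := by
    rw [Complex.ofReal_sum, Complex.ofReal_mul, Complex.ofReal_sum]
    simp_rw [h1, map_sum, map_mul, map_pow, hconj, Finset.sum_mul_sum]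
    rw [Finset.sum_comm, Finset.mul_sum]
    refine Finset.sum_congr rfl fun n hn => ?_
    rw [Finset.sum_comm]
    have h2 : ∀ m ∈ Finset.range L, ∑ j ∈ Finset.range L,
        (ζ ^ j) ^ n * h n * (((ζ⁻¹) ^ j) ^ m * (starRingEnd ℂ) (h m))
        = h n * (starRingEnd ℂ) (h m) * if n = m then (L : ℂ) else 0 := by
      intro m hm
      rw [← key n hn m hm, Finset.mul_sum]
      refine Finset.sum_congr rfl fun j _ => ?_
      rw [mul_pow, ← pow_mul, ← pow_mul, ← pow_mul, ← pow_mul, mul_comm j n, mul_comm j m]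
      ring
    rw [Finset.sum_congr rfl h2, Finset.sum_eq_single n]
    · simp [mul_comm]
    · intro m _ hm; simp [hm.symm]
    · intro h3; exact absurd hn h3
  exact_mod_cast hgoal

/-- The window has room for the shift: since `M + s ≤ L`, the shifted support does not leave it and
there is no wrap-around term. -/
lemma sum_range_shift (z : ℂ) (F : ℤ → ℂ) {L M s : ℕ} (hF : ∀ n : ℤ, n < 0 ∨ (M : ℤ) ≤ n → F n = 0)
    (hL : M + s ≤ L) :
    ∑ n ∈ Finset.range L, z ^ n * F ((n : ℤ) - s)
      = z ^ s * ∑ n ∈ Finset.range L, z ^ n * F n := by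
  obtain ⟨K, rfl⟩ := Nat.exists_eq_add_of_le (le_trans (Nat.le_add_left s M) hL)
  have h1 : ∑ n ∈ Finset.range (s + K), z ^ n * F ((n : ℤ) - s)
      = z ^ s * ∑ n ∈ Finset.range K, z ^ n * F n := by
    rw [Finset.sum_range_add, Finset.sum_eq_zero, zero_add, Finset.mul_sum]
    · refine Finset.sum_congr rfl fun n _ => ?_
      rw [pow_add]
      push_cast
      rw [show (s : ℤ) + n - s = n by ring]; ring
    · intro n hn
      rw [hF _ (Or.inl (by have := Finset.mem_range.1 hn; omega)), mul_zero]
  have h2 : ∑ n ∈ Finset.range (s + K), z ^ n * F n = ∑ n ∈ Finset.range K, z ^ n * F n := by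
    rw [add_comm s K, Finset.sum_range_add]
    have : ∑ x ∈ Finset.range s, z ^ (K + x) * F ((K + x : ℕ) : ℤ) = 0 :=
      Finset.sum_eq_zero fun n _ => by rw [hF _ (Or.inr (by push_cast; omega)), mul_zero]
    rw [this, add_zero]
  rw [h1, h2]

/-- Convolution becomes multiplication: a lag by `k + 1` multiplies the transform by `z ^ (k + 1)`,
which assembles `charPoly A z`. The window `M + P` accommodates all lags. -/
lemma transform_resid (A : Tensor3 N P) (f : ℤ → Fin N → ℝ) {M : ℕ}
    (hf : ∀ n : ℤ, n < 0 ∨ (M : ℤ) ≤ n → f n = 0) (z : ℂ) (i : Fin N) :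
    ∑ n ∈ Finset.range (M + P), z ^ n * (resid A f n i : ℂ)
      = (charPoly A z *ᵥ fun j => ∑ n ∈ Finset.range (M + P), z ^ n * (f n j : ℂ)) i := by
  have h1 : ∀ n : ℕ, (resid A f n i : ℂ) = (f n i : ℂ)
      - ∑ j, ∑ k : Fin P, (A (i, j, k) : ℂ) * (f ((n : ℤ) - (k.val + 1 : ℕ)) j : ℂ) := by
    intro n
    simp only [resid, Pi.sub_apply, Matrix.mulVec, dotProduct, Fintype.sum_prod_type, unfold1,
      lagVec, Matrix.of_apply]
    push_cast
    congr 1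
    refine Finset.sum_congr rfl fun j _ => Finset.sum_congr rfl fun k _ => ?_
    rw [show (n : ℤ) - 1 - (k.val : ℤ) = (n : ℤ) - ((k.val : ℤ) + 1) by ring]
  simp_rw [h1, mul_sub, Finset.sum_sub_distrib, Finset.mul_sum]
  rw [Finset.sum_comm]
  have h2 : ∀ j, ∑ n ∈ Finset.range (M + P), ∑ k : Fin P,
      z ^ n * ((A (i, j, k) : ℂ) * (f ((n : ℤ) - (k.val + 1 : ℕ)) j : ℂ))
      = ∑ k : Fin P, z ^ (k.val + 1) * (A (i, j, k) : ℂ)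
        * ∑ n ∈ Finset.range (M + P), z ^ n * (f n j : ℂ) := by
    intro j
    rw [Finset.sum_comm]
    refine Finset.sum_congr rfl fun k _ => ?_
    have := sum_range_shift z (fun n => (f n j : ℂ)) (L := M + P) (M := M) (s := k.val + 1)
      (fun n hn => by rw [hf n hn]; simp) (by have := k.isLt; omega)
    rw [mul_right_comm, ← this, Finset.sum_mul]
    exact Finset.sum_congr rfl fun n _ => by ring
  simp_rw [h2]
  simp only [charPoly, Matrix.sub_mulVec, Matrix.one_mulVec, Pi.sub_apply]
  congr 1
  simp only [Matrix.mulVec, dotProduct, Matrix.sum_apply, Matrix.smul_apply, Matrix.of_apply,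
    smul_eq_mul, Finset.sum_mul]

/-- Energy bounds for the autoregressive filter on finitely supported sequences. -/
lemma resid_energy_bounds (hN : 1 ≤ N) (hP : 1 ≤ P) (A : Tensor3 N P) (f : ℤ → Fin N → ℝ) {M : ℕ}
    (hf : ∀ n : ℤ, n < 0 ∨ (M : ℤ) ≤ n → f n = 0) :
    muMin A * ∑ n ∈ Finset.range (M + P), nsq (f n)
        ≤ ∑ n ∈ Finset.range (M + P), nsq (resid A f n) ∧
    ∑ n ∈ Finset.range (M + P), nsq (resid A f n)
        ≤ muMax A * ∑ n ∈ Finset.range (M + P), nsq (f n) := by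
  set L := M + P with hL
  have hL0 : 0 < L := by omega
  have hL0' : (0 : ℝ) < L := by exact_mod_cast hL0
  set ζ := Complex.exp (2 * Real.pi * Complex.I / L) with hζd
  have hζ : IsPrimitiveRoot ζ L := Complex.isPrimitiveRoot_exp L hL0.ne'
  have hn1 : ∀ j, ‖ζ ^ j‖ = 1 := fun j => by
    rw [norm_pow, hζ.norm'_eq_one hL0.ne', one_pow]
  have hpars : ∀ g : ℤ → Fin N → ℝ, L * ∑ n ∈ Finset.range L, nsq (g n)
      = ∑ j ∈ Finset.range L, ∑ i, ‖∑ n ∈ Finset.range L, (ζ ^ j) ^ n * (g n i : ℂ)‖ ^ 2 := by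
    intro g
    rw [Finset.sum_comm]
    have : ∀ i, ∑ j ∈ Finset.range L, ‖∑ n ∈ Finset.range L, (ζ ^ j) ^ n * (g n i : ℂ)‖ ^ 2
        = L * ∑ n ∈ Finset.range L, ‖(g n i : ℂ)‖ ^ 2 := fun i =>
      parseval_roots L hL0 (fun n => (g n i : ℂ))
    simp_rw [this]
    rw [← Finset.mul_sum, Finset.sum_comm]
    simp [nsq]
  clear_value ζ
  have hr := hpars (resid A f)
  have hf' := hpars f
  have e : ∀ j i, ∑ n ∈ Finset.range L, (ζ ^ j) ^ n * (resid A f n i : ℂ)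
      = (charPoly A (ζ ^ j) *ᵥ
        fun i => ∑ n ∈ Finset.range L, (ζ ^ j) ^ n * (f n i : ℂ)) i :=
    fun j i => transform_resid A f hf (ζ ^ j) i
  simp_rw [e] at hr
  -- After Parseval both inequalities are pointwise in the frequency, and all frequencies `ζ ^ j`
  -- lie on the unit circle.
  constructor
  · refine le_of_mul_le_mul_left ?_ hL0'
    rw [hr, mul_left_comm, hf', Finset.mul_sum]
    exact Finset.sum_le_sum fun j _ => muMin_mul_le hN A (hn1 j) _
  · refine le_of_mul_le_mul_left ?_ hL0'
    rw [hr, mul_left_comm, hf', Finset.mul_sum]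
    exact Finset.sum_le_sum fun j _ => le_muMax_mul hN A (hn1 j) _

end parseval
end
end MLRHAR

namespace MLRHAR
open scoped Matrix
noncomputable section

/-! ### The companion matrix and stability -/

section companion
variable {N P : ℕ} {R : Type*} [CommRing R]

/-- The block vector with first block `w`, followed by all but the last block of `x`. -/
def push {R : Type*} (w : Fin N → R) (x : Fin N × Fin P → R) : Fin N × Fin P → R := fun c =>
  if c.2.val = 0 then w c.1 else x (c.1, ⟨c.2.val - 1, lt_of_le_of_lt (Nat.sub_le _ _) c.2.2⟩)

/-- The companion matrix of an autoregression with coefficient matrices `a`. -/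
def companion (a : Matrix (Fin N) (Fin N × Fin P) R) :
    Matrix (Fin N × Fin P) (Fin N × Fin P) R :=
  Matrix.of fun c c' => if c.2.val = 0 then a c.1 c' else
    if c' = (c.1, ⟨c.2.val - 1, lt_of_le_of_lt (Nat.sub_le _ _) c.2.2⟩) then 1 else 0

lemma companion_mulVec (a : Matrix (Fin N) (Fin N × Fin P) R) (x : Fin N × Fin P → R) :
    companion a *ᵥ x = push (a *ᵥ x) x := by
  ext c
  by_cases h : c.2.val = 0
  · simp [companion, push, h, Matrix.mulVec, dotProduct]
  · simp [companion, push, h, Matrix.mulVec, dotProduct]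

lemma companion_map {R' : Type*} [CommRing R'] (f : R →+* R')
    (a : Matrix (Fin N) (Fin N × Fin P) R) : (companion a).map f = companion (a.map f) := by
  ext c c'
  simp only [companion, Matrix.map_apply, Matrix.of_apply]
  split_ifs <;> simp

lemma lagVec_succ (v : ℤ → Fin N → ℝ) (n : ℤ) :
    lagVec P v (n + 1) = push (v n) (lagVec P v n) := by
  ext ⟨i, k⟩
  by_cases h : k.val = 0
  · simp [lagVec, push, h]
  · simp only [lagVec, push, h, if_false]
    congr 1
    have : ((k.val - 1 : ℕ) : ℤ) = (k.val : ℤ) - 1 := by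
      rw [Nat.cast_sub (Nat.one_le_iff_ne_zero.2 h)]; simp
    rw [this]; ring

lemma push_add (w w' : Fin N → ℝ) (x x' : Fin N × Fin P → ℝ) :
    push (w + w') (x + x') = push w x + push w' x' := by
  ext c; simp only [push, Pi.add_apply]; split_ifs <;> rfl

lemma push_smul (b : ℝ) (w : Fin N → ℝ) (x : Fin N × Fin P → ℝ) :
    push (b • w) (b • x) = b • push w x := by
  ext c; simp only [push, Pi.smul_apply]; split_ifs <;> rfl

/-- The coefficient matrix `A₍₁₎` with complex entries. -/
abbrev unfoldC (A : Tensor3 N P) : Matrix (Fin N) (Fin N × Fin P) ℂ :=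
  (unfold1 A).map Complex.ofRealHom

lemma charPoly_mulVec (A : Tensor3 N P) (z : ℂ) (w : Fin N → ℂ) :
    charPoly A z *ᵥ w = w - z • unfoldC A *ᵥ fun c => z ^ c.2.val * w c.1 := by
  ext i
  simp only [charPoly, Matrix.sub_mulVec, Matrix.one_mulVec, Pi.sub_apply, Pi.smul_apply,
    smul_eq_mul]
  congr 1
  simp only [Matrix.mulVec, dotProduct, Matrix.sum_apply, Matrix.smul_apply, Matrix.of_apply,
    smul_eq_mul, Matrix.map_apply, unfold1, Fintype.sum_prod_type, Finset.mul_sum, Finset.sum_mul]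
  refine Finset.sum_congr rfl fun j _ => Finset.sum_congr rfl fun k _ => ?_
  simp only [Complex.ofRealHom_eq_coe]
  ring

/-- The shift rows force the blocks of an eigenvector to be geometric in `l⁻¹`; the first block row
then says that the leading block is in the kernel of `A(l⁻¹)`. Nonzero eigenvalues are thus inverses
of roots of the determinant. -/
lemma companion_eigenvector (A : Tensor3 N P) {l : ℂ} (hl : l ≠ 0) {v : Fin N × Fin P → ℂ}
    (hv : companion (unfoldC A) *ᵥ v = l • v) (hP : 0 < P) :
    v = (fun c => (l⁻¹) ^ c.2.val * v (c.1, ⟨0, hP⟩)) ∧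
      charPoly A l⁻¹ *ᵥ (fun i => v (i, ⟨0, hP⟩)) = 0 := by
  rw [companion_mulVec] at hv
  have h0 : ∀ i, (unfoldC A *ᵥ v) i = l * v (i, ⟨0, hP⟩) := fun i => by
    have := congrFun hv (i, ⟨0, hP⟩); simpa [push] using this
  have hs : ∀ i (k : ℕ) (hk : k < P), v (i, ⟨k, hk⟩) = (l⁻¹) ^ k * v (i, ⟨0, hP⟩) := by
    intro i k
    induction k with
    | zero => intro hk; simp
    | succ k ih =>
      intro hk
      have h1 := congrFun hv (i, ⟨k + 1, hk⟩)
      simp only [push, Nat.add_sub_cancel, Pi.smul_apply, smul_eq_mul, Nat.succ_ne_zero,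
        if_false] at h1
      have h2 : v (i, ⟨k + 1, hk⟩) = l⁻¹ * v (i, ⟨k, by omega⟩) := by
        rw [h1, inv_mul_cancel_left₀ hl]
      rw [h2, ih, pow_succ]; ring
  have hv' : v = (fun c => (l⁻¹) ^ c.2.val * v (c.1, ⟨0, hP⟩)) := by
    ext ⟨i, k⟩; exact hs i k k.2
  refine ⟨hv', ?_⟩
  rw [charPoly_mulVec]
  have : (fun c : Fin N × Fin P => (l⁻¹) ^ c.2.val * v (c.1, ⟨0, hP⟩)) = v := hv'.symm
  rw [this]
  ext i
  simp only [Pi.sub_apply, Pi.smul_apply, smul_eq_mul, Pi.zero_apply, h0,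
    inv_mul_cancel_left₀ hl, sub_self]

lemma companion_mulVec_of_charPoly (A : Tensor3 N P) {z : ℂ} (hz : z ≠ 0) {w : Fin N → ℂ}
    (hw : charPoly A z *ᵥ w = 0) :
    companion (unfoldC A) *ᵥ (fun c => z ^ c.2.val * w c.1)
      = z⁻¹ • fun c : Fin N × Fin P => z ^ c.2.val * w c.1 := by
  rw [companion_mulVec]
  rw [charPoly_mulVec, sub_eq_zero] at hw
  ext ⟨i, k⟩
  by_cases h : k.val = 0
  · have := congrFun hw i
    simp only [Pi.smul_apply, smul_eq_mul] at this
    simp only [push, h, if_true, Pi.smul_apply, smul_eq_mul, pow_zero, one_mul]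
    rw [this, inv_mul_cancel_left₀ hz]
  · simp only [push, h, if_false, Pi.smul_apply, smul_eq_mul]
    obtain ⟨k', hk'⟩ := Nat.exists_eq_succ_of_ne_zero h
    simp only [hk', Nat.succ_eq_add_one, Nat.add_sub_cancel, pow_succ]
    field_simp

/-- Powers of the companion matrix of a stable autoregression tend to zero. -/
lemma tendsto_companion_pow (A : Tensor3 N P) (hP : 0 < P)
    (h : ∀ z : ℂ, ‖z‖ ≤ 1 → (charPoly A z).det ≠ 0) (x : Fin N × Fin P → ℝ) :
    Filter.Tendsto (fun n : ℕ => (companion (unfold1 A)) ^ n *ᵥ x) Filter.atTop (nhds 0) := by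
  -- Any Banach algebra norm on matrices would do; it is needed for Gelfand's formula.
  let _ : NormedRing (Matrix (Fin N × Fin P) (Fin N × Fin P) ℂ) := Matrix.linftyOpNormedRing
  let _ : NormedAlgebra ℂ (Matrix (Fin N × Fin P) (Fin N × Fin P) ℂ) :=
    Matrix.linftyOpNormedAlgebra
  have _ : CompleteSpace (Matrix (Fin N × Fin P) (Fin N × Fin P) ℂ) := FiniteDimensional.complete ℂ _
  set M : Matrix (Fin N × Fin P) (Fin N × Fin P) ℂ := companion (unfoldC A) with hM
  -- An eigenvalue with `|l| ≥ 1` would give a singular `A(l⁻¹)` at a point of the closed unit disc.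
  have hspec : ∀ l ∈ spectrum ℂ M, ‖l‖ < 1 := by
    intro l hl
    by_contra! hcon
    have hl0 : l ≠ 0 := by rintro rfl; simp at hcon; linarith
    have hl' : Module.End.HasEigenvalue (Matrix.toLin' M) l := by
      rw [Module.End.hasEigenvalue_iff_mem_spectrum, Matrix.spectrum_toLin']; exact hl
    obtain ⟨v, hv⟩ := hl'.exists_hasEigenvector
    have hv1 : M *ᵥ v = l • v := by
      have := hv.apply_eq_smul; rwa [Matrix.toLin'_apply] at this
    obtain ⟨e1, e2⟩ := companion_eigenvector A hl0 hv1 hP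
    refine h l⁻¹ (by rw [norm_inv]; exact inv_le_one_of_one_le₀ hcon) ?_
    rw [← Matrix.exists_mulVec_eq_zero_iff]
    refine ⟨_, fun h0 => hv.2 ?_, e2⟩
    rw [e1]; ext c
    simp [congrFun h0 c.1]
  have hrad : spectralRadius ℂ M < 1 := by
    refine lt_of_le_of_ne ?_ ?_
    · refine iSup₂_le fun l hl => ?_
      exact_mod_cast (hspec l hl).le
    · intro hcon
      rcases (spectrum ℂ M).eq_empty_or_nonempty with he | hne
      · simp [spectralRadius, he] at hcon
      · obtain ⟨l, hl, hle⟩ := spectrum.exists_nnnorm_eq_spectralRadius_of_nonempty hne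
        have := hspec l hl
        rw [hcon] at hle
        have h1 : ‖l‖₊ = 1 := by exact_mod_cast hle
        have h2 : ‖l‖ = 1 := by rw [← coe_nnnorm, h1]; rfl
        linarith
  have hpow : Filter.Tendsto (fun n : ℕ => M ^ n) Filter.atTop (nhds 0) := by
    obtain ⟨q, hq1, hq2⟩ := exists_between hrad
    -- Gelfand's formula: a spectral radius below `q < 1` makes `‖M ^ n‖` eventually at most `q ^
    -- n`.
    have hg := spectrum.pow_nnnorm_pow_one_div_tendsto_nhds_spectralRadius M
    have hev : ∀ᶠ n : ℕ in Filter.atTop, (‖M ^ n‖₊ : ENNReal) ≤ q ^ n := by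
      filter_upwards [hg.eventually (gt_mem_nhds hq1), Filter.eventually_gt_atTop 0] with n hn hn0
      have hn0' : (0 : ℝ) < n := by exact_mod_cast hn0
      have := ENNReal.rpow_le_rpow hn.le hn0'.le
      rwa [← ENNReal.rpow_mul, one_div, inv_mul_cancel₀ hn0'.ne', ENNReal.rpow_one,
        ENNReal.rpow_natCast] at this
    have hq0 : Filter.Tendsto (fun n : ℕ => q ^ n) Filter.atTop (nhds 0) :=
      ENNReal.tendsto_pow_atTop_nhds_zero_iff.2 hq2
    have h3 : Filter.Tendsto (fun n : ℕ => (‖M ^ n‖₊ : ENNReal)) Filter.atTop (nhds 0) :=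
      tendsto_of_tendsto_of_tendsto_of_le_of_le' tendsto_const_nhds hq0
        (Filter.Eventually.of_forall fun _ => zero_le) hev
    refine tendsto_zero_iff_norm_tendsto_zero.2 ?_
    have h4 := (ENNReal.tendsto_coe (m := fun n : ℕ => ‖M ^ n‖₊) (a := 0)).1 (by simpa using h3)
    exact (NNReal.tendsto_coe.2 h4)
  rw [tendsto_pi_nhds]
  intro c
  have hc : Filter.Tendsto (fun n : ℕ => ((M ^ n) *ᵥ fun j => (x j : ℂ)) c) Filter.atTop (nhds 0) := by
    have h5 : Continuous fun B : Matrix (Fin N × Fin P) (Fin N × Fin P) ℂ =>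
        (B *ᵥ fun j => (x j : ℂ)) c := by
      unfold Matrix.mulVec dotProduct
      fun_prop
    have := (h5.tendsto 0).comp hpow
    simpa [Function.comp_def] using this
  have hre : ∀ n : ℕ, (((companion (unfold1 A)) ^ n *ᵥ x) c : ℝ)
      = (((M ^ n) *ᵥ fun j => (x j : ℂ)) c).re := by
    intro n
    have : M ^ n = ((companion (unfold1 A)) ^ n).map Complex.ofRealHom := by
      rw [hM, ← companion_map]
      exact (Complex.ofRealHom.mapMatrix.map_pow (companion (unfold1 A)) n).symm
    rw [this]
    simp [Matrix.mulVec, dotProduct]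
  simp_rw [hre]
  simpa [Function.comp_def] using (Complex.continuous_re.tendsto 0).comp hc

end companion
end
end MLRHAR

namespace MLRHAR
open scoped Matrix
noncomputable section

/-! ### Response of the autoregression to an input sequence -/

section response
variable {N P : ℕ}

/-- The state `(v_{t-1}, …, v_{t-P})` of the autoregression with input `e`, started at `x`. -/
def run (A : Tensor3 N P) (x : Fin N × Fin P → ℝ) (e : ℕ → Fin N → ℝ) : ℕ → Fin N × Fin P → ℝ
  | 0 => x
  | t + 1 => push (unfold1 A *ᵥ run A x e t + e t) (run A x e t)

lemma run_add (A : Tensor3 N P) (x x' : Fin N × Fin P → ℝ) (e e' : ℕ → Fin N → ℝ) (t : ℕ) :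
    run A (x + x') (e + e') t = run A x e t + run A x' e' t := by
  induction t with
  | zero => rfl
  | succ t ih =>
    simp only [run, ih, Matrix.mulVec_add, Pi.add_apply]
    rw [← push_add]; congr 1; abel

lemma run_smul (A : Tensor3 N P) (b : ℝ) (x : Fin N × Fin P → ℝ) (e : ℕ → Fin N → ℝ) (t : ℕ) :
    run A (b • x) (b • e) t = b • run A x e t := by
  induction t with
  | zero => rfl
  | succ t ih =>
    simp only [run, ih, Matrix.mulVec_smul, Pi.smul_apply]
    rw [← push_smul]; congr 1; rw [smul_add]

lemma run_congr (A : Tensor3 N P) (x : Fin N × Fin P → ℝ) {e e' : ℕ → Fin N → ℝ} {t : ℕ}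
    (h : ∀ s < t, e s = e' s) : run A x e t = run A x e' t := by
  induction t with
  | zero => rfl
  | succ t ih =>
    simp only [run, ih fun s hs => h s (by omega), h t (by omega)]

lemma run_zero_input (A : Tensor3 N P) (x : Fin N × Fin P → ℝ) (t : ℕ) :
    run A x 0 t = companion (unfold1 A) ^ t *ᵥ x := by
  induction t with
  | zero => simp [run]
  | succ t ih =>
    rw [pow_succ', ← Matrix.mulVec_mulVec, ← ih, companion_mulVec]
    simp [run]

lemma run_add_steps (A : Tensor3 N P) (x : Fin N × Fin P → ℝ) (e : ℕ → Fin N → ℝ) (s t : ℕ) :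
    run A x e (s + t) = run A (run A x e s) (fun j => e (s + j)) t := by
  induction t with
  | zero => rfl
  | succ t ih => rw [← add_assoc]; simp only [run, ih]

lemma lagVec_eq_run (A : Tensor3 N P) (v : ℤ → Fin N → ℝ) (e : ℕ → Fin N → ℝ) (a : ℤ) {t : ℕ}
    (h : ∀ s : ℕ, s < t → v (a + s) = unfold1 A *ᵥ lagVec P v (a + s) + e s) :
    lagVec P v (a + t) = run A (lagVec P v a) e t := by
  induction t with
  | zero => simp [run]
  | succ t ih =>
    rw [Nat.cast_succ, ← add_assoc, lagVec_succ, h t (by omega), ih fun s hs => h s (by omega)]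
    rfl

/-- The response of the autoregression started at zero to the input `e`. -/
def resp (A : Tensor3 N P) (e : ℕ → Fin N → ℝ) (n : ℤ) : Fin N → ℝ :=
  if n < 0 then 0 else unfold1 A *ᵥ run A 0 e n.toNat + e n.toNat

lemma resp_of_neg (A : Tensor3 N P) (e : ℕ → Fin N → ℝ) {n : ℤ} (h : n < 0) : resp A e n = 0 :=
  if_pos h

lemma resp_natCast (A : Tensor3 N P) (e : ℕ → Fin N → ℝ) (t : ℕ) :
    resp A e t = unfold1 A *ᵥ run A 0 e t + e t := by
  simp [resp]

lemma resp_add (A : Tensor3 N P) (e e' : ℕ → Fin N → ℝ) (n : ℤ) :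
    resp A (e + e') n = resp A e n + resp A e' n := by
  unfold resp
  split_ifs
  · simp
  · have := run_add A 0 0 e e' n.toNat
    rw [add_zero] at this
    rw [this, Matrix.mulVec_add, Pi.add_apply]; abel

lemma resp_smul (A : Tensor3 N P) (b : ℝ) (e : ℕ → Fin N → ℝ) (n : ℤ) :
    resp A (b • e) n = b • resp A e n := by
  unfold resp
  split_ifs
  · simp
  · have := run_smul A b 0 e n.toNat
    rw [smul_zero] at this
    rw [this, Matrix.mulVec_smul, Pi.smul_apply, smul_add]

lemma lagVec_resp (A : Tensor3 N P) (e : ℕ → Fin N → ℝ) (t : ℕ) :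
    lagVec P (resp A e) t = run A 0 e t := by
  induction t with
  | zero =>
    ext c
    simp only [lagVec, Nat.cast_zero, run]
    rw [resp_of_neg]
    · rfl
    · omega
  | succ t ih => rw [Nat.cast_succ, lagVec_succ, ih, resp_natCast]; rfl

lemma resp_congr (A : Tensor3 N P) {e e' : ℕ → Fin N → ℝ} {n : ℤ}
    (h : ∀ s : ℕ, (s : ℤ) ≤ n → e s = e' s) : resp A e n = resp A e' n := by
  unfold resp
  split_ifs with hn
  · rfl
  · rw [run_congr A 0 (fun s hs => h s (by omega)), h n.toNat (by omega)]

lemma resid_resp (A : Tensor3 N P) (e : ℕ → Fin N → ℝ) (t : ℕ) : resid A (resp A e) t = e t := by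
  rw [resid, lagVec_resp, resp_natCast, add_sub_cancel_left]

lemma lagVec_congr {v w : ℤ → Fin N → ℝ} {n : ℤ} (h : ∀ k : ℕ, k < P → v (n - 1 - k) = w (n - 1 - k)) :
    lagVec P v n = lagVec P w n := by
  ext c; simp only [lagVec, h c.2 c.2.2]

/-- A sequence that vanishes at negative times is the response to its residuals. -/
lemma resp_resid (A : Tensor3 N P) (w : ℤ → Fin N → ℝ) (hw : ∀ n < 0, w n = 0) (n : ℤ) :
    resp A (fun t : ℕ => resid A w t) n = w n := by
  rcases lt_or_ge n 0 with hn | hn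
  · rw [resp_of_neg _ _ hn, hw n hn]
  lift n to ℕ using hn
  have h0 : lagVec P w 0 = 0 := by
    ext c; simp only [lagVec]; rw [hw _ (by omega)]; rfl
  have := lagVec_eq_run A w (fun t : ℕ => resid A w t) 0 (t := n)
    (fun s _ => by simp [resid])
  rw [zero_add, h0] at this
  rw [resp_natCast, ← this]
  simp [resid]

lemma continuous_nsq {ι : Type*} [Fintype ι] : Continuous (nsq : (ι → ℝ) → ℝ) := by
  unfold nsq; fun_prop

/-- A stable autoregression has a bounded response. -/
lemma resp_energy_le (hN : 1 ≤ N) (hP : 1 ≤ P) (A : Tensor3 N P)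
    (hst : ∀ z : ℂ, ‖z‖ ≤ 1 → (charPoly A z).det ≠ 0) (e : ℕ → Fin N → ℝ) (M : ℕ) :
    muMin A * ∑ t ∈ Finset.range M, nsq (resp A e t) ≤ ∑ t ∈ Finset.range M, nsq (e t) := by
  have hmu : 0 < muMin A := muMin_pos hN A fun z => hst z (Circle.norm_coe z).le
  -- Switching the input off at time `M` does not change the first `M` outputs, by causality, and
  -- lets the output decay afterwards.
  set e' : ℕ → Fin N → ℝ := fun t => if t < M then e t else 0 with he'
  have h1 : ∀ t ∈ Finset.range M, nsq (resp A e t) = nsq (resp A e' t) := by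
    intro t ht
    rw [Finset.mem_range] at ht
    rw [resp_congr A (e' := e')]
    intro s hs
    have : s < M := by omega
    simp [he', this]
  rw [Finset.sum_congr rfl h1]
  set z := resp A e' with hz
  -- From time `M` on the state evolves by powers of the companion matrix alone.
  have hdecay : Filter.Tendsto (fun t : ℕ => z t) Filter.atTop (nhds 0) := by
    have h2 : ∀ t : ℕ, z ((t + M : ℕ) : ℤ)
        = unfold1 A *ᵥ (companion (unfold1 A) ^ t *ᵥ run A 0 e' M) := by
      intro t
      rw [hz, resp_natCast, add_comm t M, run_add_steps, ← run_zero_input]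
      have h3 : (fun j => e' (M + j)) = 0 := by ext j : 1; simp [he']
      rw [h3]
      have h4 : e' (M + t) = 0 := by simp [he']
      rw [h4, add_zero]
    rw [← Filter.tendsto_add_atTop_iff_nat M]
    simp_rw [h2]
    have h5 : Continuous fun x : Fin N × Fin P → ℝ => unfold1 A *ᵥ x :=
      Continuous.matrix_mulVec continuous_const continuous_id
    have := (h5.tendsto 0).comp (tendsto_companion_pow A hP hst (run A 0 e' M))
    simpa [Function.comp_def] using this
  have hlag : ∀ j : ℕ, Filter.Tendsto (fun L : ℕ =>
      lagVec P (fun n : ℤ => if n < L then z n else 0) ((L + j : ℕ) : ℤ)) Filter.atTop (nhds 0) := by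
    intro j
    rw [tendsto_pi_nhds]
    intro c
    have h6 : Filter.Tendsto (fun L : ℕ => |z ((L + j - 1 - c.2.val : ℕ) : ℤ) c.1|) Filter.atTop
        (nhds 0) := by
      have h7 : Filter.Tendsto (fun L : ℕ => L + j - 1 - c.2.val) Filter.atTop Filter.atTop := by
        refine Filter.tendsto_atTop_atTop.2 fun b => ⟨b + 1 + c.2.val, fun a ha => by omega⟩
      have h8 := ((tendsto_pi_nhds.1 hdecay c.1).comp h7).abs
      simpa [Function.comp_def] using h8
    refine squeeze_zero_norm' ?_ h6
    filter_upwards [Filter.eventually_ge_atTop (1 + c.2.val)] with L hL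
    simp only [lagVec, Real.norm_eq_abs]
    have h9 : ((L + j : ℕ) : ℤ) - 1 - (c.2.val : ℤ) = ((L + j - 1 - c.2.val : ℕ) : ℤ) := by omega
    rw [h9]
    split_ifs
    · exact le_rfl
    · simp
  -- The Fourier bound needs finite support, so the output is cut off at `L`. The residuals of the
  -- cut sequence are the input before `L`, plus `P` boundary terms after `L`; the latter vanish as
  -- `L → ∞`.
  have hbd : Filter.Tendsto (fun L : ℕ => ∑ t ∈ Finset.range M, nsq (e t)
      + ∑ j ∈ Finset.range P, nsq (unfold1 A *ᵥ
        lagVec P (fun n : ℤ => if n < L then z n else 0) ((L + j : ℕ) : ℤ))) Filter.atTop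
      (nhds (∑ t ∈ Finset.range M, nsq (e t) + ∑ j ∈ Finset.range P, 0)) := by
    refine tendsto_const_nhds.add (tendsto_finsetSum _ fun j _ => ?_)
    have h5 : Continuous fun x : Fin N × Fin P → ℝ => nsq (unfold1 A *ᵥ x) :=
      continuous_nsq.comp (Continuous.matrix_mulVec continuous_const continuous_id)
    have := (h5.tendsto 0).comp (hlag j)
    simpa [Function.comp_def, nsq_zero] using this
  rw [Finset.sum_const_zero, add_zero] at hbd
  refine ge_of_tendsto hbd ?_
  filter_upwards [Filter.eventually_ge_atTop M] with L hL
  set f : ℤ → Fin N → ℝ := fun n => if n < L then z n else 0 with hf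
  have h10 := (resid_energy_bounds hN hP A f (M := L) (by
    rintro n (hn | hn)
    · simp only [hf]; split_ifs
      · rw [hz, resp_of_neg _ _ hn]
      · rfl
    · simp only [hf, if_neg (not_lt.2 hn)])).1
  have h11 : ∑ t ∈ Finset.range M, nsq (z t) ≤ ∑ n ∈ Finset.range (L + P), nsq (f n) := by
    calc ∑ t ∈ Finset.range M, nsq (z t) = ∑ t ∈ Finset.range M, nsq (f t) := by
          refine Finset.sum_congr rfl fun t ht => ?_
          rw [Finset.mem_range] at ht
          have : ((t : ℤ) < L) := by omega
          simp [hf, this]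
      _ ≤ _ := Finset.sum_le_sum_of_subset_of_nonneg
          (Finset.range_subset_range.2 (by omega)) fun _ _ _ => nsq_nonneg _
  refine (mul_le_mul_of_nonneg_left h11 hmu.le).trans (h10.trans (le_of_eq ?_))
  rw [Finset.sum_range_add]
  congr 1
  · have h12 : ∀ t ∈ Finset.range L, nsq (resid A f t) = nsq (e' t) := by
      intro t ht
      rw [Finset.mem_range] at ht
      have h13 : resid A f t = resid A z t := by
        have h14 : lagVec P f t = lagVec P z t := lagVec_congr fun k _ => by
          have : (t : ℤ) - 1 - k < L := by omega
          simp only [hf, if_pos this]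
        have h15 : f t = z t := by
          have : (t : ℤ) < L := by omega
          simp only [hf, if_pos this]
        rw [resid, resid, h14, h15]
      rw [h13, hz, resid_resp]
    rw [Finset.sum_congr rfl h12]
    rw [← Finset.sum_subset (Finset.range_subset_range.2 hL)]
    · refine Finset.sum_congr rfl fun t ht => ?_
      rw [Finset.mem_range] at ht; simp [he', ht]
    · intro t _ ht
      rw [Finset.mem_range] at ht; simp [he', ht, nsq_zero]
  · refine Finset.sum_congr rfl fun j _ => ?_
    have h16 : f ((L + j : ℕ) : ℤ) = 0 := by
      have : ¬ ((L + j : ℕ) : ℤ) < L := by omega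
      simp only [hf, if_neg this]
    rw [resid, h16, zero_sub]
    simp [nsq]

/-- The filter `v ↦ v_n - ∑ A_j v_{n-j}` at a single time. -/
lemma nsq_resid_le (hN : 1 ≤ N) (hP : 1 ≤ P) (A : Tensor3 N P) (v : ℤ → Fin N → ℝ) (n : ℤ) :
    nsq (resid A v n) ≤ muMax A * nsq (lagVec (P + 1) v (n + 1)) := by
  -- The `P + 1` values that enter the residual at time `n`, moved to the times `0, …, P` and
  -- extended by zero. The residual of `f` at time `P` is then the one at time `n`, and one term is
  -- at most the total energy.
  set f : ℤ → Fin N → ℝ := fun l => if 0 ≤ l ∧ l < (P + 1 : ℕ) then v (n - P + l) else 0 with hf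
  have h := (resid_energy_bounds hN hP A f (M := P + 1) (by
    rintro l (hl | hl)
    · simp only [hf, if_neg (show ¬ (0 ≤ l ∧ l < ((P + 1 : ℕ) : ℤ)) by omega)]
    · simp only [hf, if_neg (show ¬ (0 ≤ l ∧ l < ((P + 1 : ℕ) : ℤ)) by omega)])).2
  have h1 : resid A f (P : ℕ) = resid A v n := by
    have e1 : lagVec P f (P : ℕ) = lagVec P v n := by
      ext c
      have := c.2.2
      simp only [lagVec, hf]
      rw [if_pos (by omega)]
      congr 1; ring
    have e2 : f (P : ℕ) = v n := by
      simp only [hf]; rw [if_pos (by omega)]; congr 1; ring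
    rw [resid, resid, e1, e2]
  have h2 : nsq (resid A v n) ≤ ∑ l ∈ Finset.range (P + 1 + P), nsq (resid A f l) := by
    rw [← h1]
    exact Finset.single_le_sum (f := fun l : ℕ => nsq (resid A f l)) (fun _ _ => nsq_nonneg _)
      (Finset.mem_range.2 (by omega))
  have h3 : ∑ l ∈ Finset.range (P + 1 + P), nsq (f l) = nsq (lagVec (P + 1) v (n + 1)) := by
    rw [Finset.sum_range_add, Finset.sum_eq_zero (s := Finset.range P), add_zero]
    · rw [← Finset.sum_range_reflect]
      unfold nsq
      rw [Fintype.sum_prod_type_right, ← Fin.sum_univ_eq_sum_range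
        (fun l => ∑ i, f ((P + 1 - 1 - l : ℕ) : ℤ) i ^ 2) (P + 1)]
      refine Finset.sum_congr rfl fun k _ => Finset.sum_congr rfl fun i _ => ?_
      have := k.2
      simp only [lagVec, hf]
      rw [if_pos (by omega)]
      have e : n - P + ((P + 1 - 1 - k.val : ℕ) : ℤ) = n + 1 - 1 - k.val := by omega
      rw [e]
    · intro l _
      have : ¬ (0 ≤ ((P + 1 + l : ℕ) : ℤ) ∧ ((P + 1 + l : ℕ) : ℤ) < (P + 1 : ℕ)) := by omega
      simp only [hf, if_neg this, nsq_zero]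
  rw [h3] at h
  exact h2.trans h

end response
end
end MLRHAR

namespace MLRHAR
open scoped Matrix
noncomputable section

/-! ### Second moments of the noise and absence of unit roots -/

section noise
variable {Ω : Type*} [MeasurableSpace Ω] {Pr : Measure Ω} {N P : ℕ}

lemma IsSubGaussianNoise.measurable_entry {κ : NNReal} {ξ : ℤ → Ω → Fin N → ℝ}
    (h : IsSubGaussianNoise Pr κ ξ) (n : ℤ) (i : Fin N) : Measurable fun ω => ξ n ω i :=
  (measurable_pi_apply i).comp (h.measurable n)

lemma IsSubGaussianNoise.iIndepFun_entries {κ : NNReal} {ξ : ℤ → Ω → Fin N → ℝ}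
    (h : IsSubGaussianNoise Pr κ ξ) : iIndepFun (fun (p : ℤ × Fin N) ω => ξ p.1 ω p.2) Pr :=
  iIndepFun_uncurry' (X := fun n i ω => ξ n ω i) h.measurable_entry h.indep h.indep_entries

lemma IsSubGaussianNoise.memLp_entry {κ : NNReal} {ξ : ℤ → Ω → Fin N → ℝ}
    (h : IsSubGaussianNoise Pr κ ξ) (n : ℤ) (i : Fin N) : MemLp (fun ω => ξ n ω i) 2 Pr := by
  simpa using (h.subGaussian n i).memLp 2

lemma IsSubGaussianNoise.integral_mul {κ : NNReal} {ξ : ℤ → Ω → Fin N → ℝ}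
    (h : IsSubGaussianNoise Pr κ ξ) (p q : ℤ × Fin N) :
    ∫ ω, ξ p.1 ω p.2 * ξ q.1 ω q.2 ∂Pr = if p = q then 1 else 0 := by
  by_cases hpq : p.1 = q.1
  · rw [hpq, h.cov]
    have : (p.2 = q.2) ↔ p = q := ⟨fun h2 => Prod.ext hpq h2, fun h2 => h2 ▸ rfl⟩
    simp only [this]
  · have hne : p ≠ q := fun h2 => hpq (by rw [h2])
    rw [if_neg hne]
    have h3 : IndepFun (fun ω => ξ p.1 ω p.2) (fun ω => ξ q.1 ω q.2) Pr :=
      h.iIndepFun_entries.indepFun hne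
    have := h3.integral_mul_eq_mul_integral (h.measurable_entry _ _).aestronglyMeasurable
      (h.measurable_entry _ _).aestronglyMeasurable
    have e : ∫ ω, ξ p.1 ω p.2 * ξ q.1 ω q.2 ∂Pr
      = ∫ ω, ((fun ω => ξ p.1 ω p.2) * fun ω => ξ q.1 ω q.2) ω ∂Pr := rfl
    rw [e, this, h.mean, zero_mul]

/-- Second moments of linear combinations of orthonormal random variables. -/
lemma integral_sum_sq {ι : Type*} [Fintype ι] [DecidableEq ι] {ζ : ι → Ω → ℝ}
    (hL : ∀ i, MemLp (ζ i) 2 Pr) (ho : ∀ i j, ∫ ω, ζ i ω * ζ j ω ∂Pr = if i = j then 1 else 0)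
    (c : ι → ℝ) :
    ∫ ω, (∑ i, c i * ζ i ω) ^ 2 ∂Pr = nsq c := by
  have e : ∀ ω, (∑ i, c i * ζ i ω) ^ 2 = ∑ i, ∑ j, (c i * c j) * (ζ i ω * ζ j ω) := by
    intro ω
    rw [sq, Finset.sum_mul_sum]
    exact Finset.sum_congr rfl fun i _ => Finset.sum_congr rfl fun j _ => by ring
  have hint : ∀ i j, Integrable (fun ω => (c i * c j) * (ζ i ω * ζ j ω)) Pr := fun i j =>
    ((hL i).integrable_mul (hL j)).const_mul _
  simp_rw [e]
  rw [integral_finsetSum _ fun i _ => integrable_finsetSum _ fun j _ => hint i j]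
  simp_rw [integral_finsetSum _ fun j _ => hint _ j, integral_const_mul, ho]
  simp [nsq, sq]

lemma IsSubGaussianNoise.integral_dotProduct_sq {κ : NNReal} {ξ : ℤ → Ω → Fin N → ℝ}
    (h : IsSubGaussianNoise Pr κ ξ) (n : ℕ) (a : ℕ → Fin N → ℝ) :
    ∫ ω, (∑ s ∈ Finset.range n, a s ⬝ᵥ ξ s ω) ^ 2 ∂Pr = ∑ s ∈ Finset.range n, nsq (a s) := by
  have h1 := integral_sum_sq (Pr := Pr) (ζ := fun (p : Fin n × Fin N) ω => ξ (p.1.val : ℤ) ω p.2)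
    (fun p => h.memLp_entry _ _) (fun p q => by
      rw [h.integral_mul (p.1.val, p.2) (q.1.val, q.2)]
      have : ((p.1.val : ℤ), p.2) = ((q.1.val : ℤ), q.2) ↔ p = q := by
        constructor
        · intro h2
          simp only [Prod.mk.injEq, Nat.cast_inj] at h2
          exact Prod.ext (Fin.ext h2.1) h2.2
        · rintro rfl; rfl
      simp only [this]) (fun p => a p.1 p.2)
  have e1 : ∀ ω, ∑ p : Fin n × Fin N, a p.1 p.2 * ξ (p.1.val : ℤ) ω p.2
      = ∑ s ∈ Finset.range n, a s ⬝ᵥ ξ s ω := by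
    intro ω
    rw [Fintype.sum_prod_type, ← Fin.sum_univ_eq_sum_range (fun s => a s ⬝ᵥ ξ s ω)]
    rfl
  have e2 : nsq (fun p : Fin n × Fin N => a p.1 p.2) = ∑ s ∈ Finset.range n, nsq (a s) := by
    rw [nsq, Fintype.sum_prod_type, ← Fin.sum_univ_eq_sum_range (fun s => nsq (a s))]
    rfl
  simp_rw [e1] at h1
  rw [h1, e2]

lemma IsSubGaussianNoise.memLp_sum_dotProduct {κ : NNReal} {ξ : ℤ → Ω → Fin N → ℝ}
    (h : IsSubGaussianNoise Pr κ ξ) (n : ℕ) (a : ℕ → Fin N → ℝ) :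
    MemLp (fun ω => ∑ s ∈ Finset.range n, a s ⬝ᵥ ξ s ω) 2 Pr :=
  memLp_finsetSum _ fun s _ => memLp_finsetSum _ fun i _ => (h.memLp_entry s i).const_mul (a s i)

lemma IsStationaryVAR.integral_sq_eq {A : Tensor3 N P} {S : Matrix (Fin N) (Fin N) ℝ}
    {ξ y : ℤ → Ω → Fin N → ℝ} (h : IsStationaryVAR Pr A S ξ y) (n : ℤ) (i : Fin N) :
    ∫ ω, y n ω i ^ 2 ∂Pr = ∫ ω, y 0 ω i ^ 2 ∂Pr := by
  have hu : Measurable fun f : ℤ → Fin N → ℝ => f 0 i ^ 2 := by fun_prop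
  have := ((h.stationary n).comp hu).integral_eq
  simpa [Function.comp_def] using this.symm

/-- A stationary square integrable autoregression with nondegenerate noise has no unit root. -/
theorem IsStationaryVAR.det_charPoly_ne_zero [IsProbabilityMeasure Pr] (hP : 1 ≤ P)
    {A : Tensor3 N P} {S : Matrix (Fin N) (Fin N) ℝ} {κ : NNReal} {ξ y : ℤ → Ω → Fin N → ℝ}
    (hy : IsStationaryVAR Pr A S ξ y) (hξ : IsSubGaussianNoise Pr κ ξ) (hS : S.det ≠ 0)
    {z : ℂ} (hz : ‖z‖ = 1) : (charPoly A z).det ≠ 0 := by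
  intro hdet
  have hz0 : z ≠ 0 := by rintro rfl; simp at hz
  obtain ⟨w, hw0, hw⟩ := Matrix.exists_mulVec_eq_zero_iff.2 hdet
  have hM := companion_mulVec_of_charPoly A hz0 hw
  set M := companion (unfoldC A) with hMd
  -- A kernel vector of `A(z)` makes `z⁻¹` an eigenvalue of the companion matrix. A left eigenvector
  -- is what is needed, since it turns the state into a scalar recursion.
  have hdetM : (M - z⁻¹ • (1 : Matrix (Fin N × Fin P) (Fin N × Fin P) ℂ)).det = 0 := by
    rw [← Matrix.exists_mulVec_eq_zero_iff]
    refine ⟨fun c => z ^ c.2.val * w c.1, fun h0 => hw0 ?_, ?_⟩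
    · ext i
      have := congrFun h0 (i, ⟨0, hP⟩)
      simpa using this
    · rw [Matrix.sub_mulVec, Matrix.smul_mulVec, Matrix.one_mulVec, hM, sub_self]
  obtain ⟨l, hl0, hl⟩ := Matrix.exists_vecMul_eq_zero_iff.2 hdetM
  rw [Matrix.vecMul_sub, Matrix.vecMul_smul, Matrix.vecMul_one, sub_eq_zero] at hl
  have hdual : ∀ x : Fin N × Fin P → ℂ, l ⬝ᵥ (M *ᵥ x) = z⁻¹ * (l ⬝ᵥ x) := by
    intro x
    rw [Matrix.dotProduct_mulVec, hl, smul_dotProduct, smul_eq_mul]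
  -- the leading block of the left eigenvector does not vanish
  have hlead : ∃ i, l (i, ⟨0, hP⟩) ≠ 0 := by
    by_contra! hcon
    refine hl0 ?_
    have : ∀ (k : ℕ) (hk : k < P) i, l (i, ⟨k, hk⟩) = 0 := by
      intro k
      induction k with
      | zero => intro hk i; exact hcon i
      | succ k ih =>
        intro hk i
        have h1 := congrFun hl (i, ⟨k, by omega⟩)
        simp only [Pi.smul_apply, ih, smul_zero] at h1
        rw [← h1]
        simp only [Matrix.vecMul, dotProduct, hMd, companion, Matrix.of_apply]
        rw [Finset.sum_eq_single (i, ⟨k + 1, hk⟩)]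
        · simp
        · rintro ⟨j, k'⟩ _ hne
          by_cases hk' : k'.val = 0
          · have : k' = ⟨0, hP⟩ := Fin.ext hk'
            rw [this, hcon j, zero_mul]
          · rw [if_neg hk', if_neg, mul_zero]
            intro h2
            simp only [Prod.mk.injEq, Fin.mk.injEq] at h2
            refine hne (Prod.ext h2.1.symm (Fin.ext ?_))
            simp only; omega
        · simp
    ext ⟨i, k⟩
    exact this k k.2 i
  set L : Fin N → ℂ := fun j => ∑ i, l (i, ⟨0, hP⟩) * (S i j : ℂ) with hLd
  -- The variance of the noise entering the scalar recursion in each step. It is positive because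
  -- the leading block of the left eigenvector is nonzero and `S` is invertible.
  set c : ℝ := ∑ j, ‖L j‖ ^ 2 with hc
  have hcpos : 0 < c := by
    refine lt_of_le_of_ne (by positivity) fun h0 => ?_
    rw [eq_comm, hc, Finset.sum_eq_zero_iff_of_nonneg fun _ _ => sq_nonneg _] at h0
    have hL0 : (fun i => l (i, ⟨0, hP⟩)) ᵥ* S.map Complex.ofRealHom = 0 := by
      ext j
      have := h0 j (Finset.mem_univ j)
      have h1 : L j = 0 := by simpa using this
      simpa [hLd, Matrix.vecMul, dotProduct] using h1
    have hdS : (S.map Complex.ofRealHom).det = 0 := by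
      rw [← Matrix.exists_vecMul_eq_zero_iff]
      obtain ⟨i, hi⟩ := hlead
      exact ⟨_, fun h => hi (congrFun h i), hL0⟩
    have h2 := Complex.ofRealHom.map_det S
    rw [RingHom.mapMatrix_apply, hdS] at h2
    exact hS (by simpa using h2)
  -- This scalar satisfies `G (n + 1) = z⁻¹ G n + L · ξₙ`. As `|z| = 1`, the rotated process `zⁿ G
  -- n` is a random walk.
  set G : ℤ → Ω → ℂ := fun n ω => l ⬝ᵥ fun c => (lagVec P (fun m => y m ω) n c : ℂ) with hG
  have hstep : ∀ n : ℕ, ∀ᵐ ω ∂Pr, G (n + 1 : ℕ) ω = z⁻¹ * G n ω + ∑ j, L j * (ξ n ω j : ℂ) := by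
    intro n
    filter_upwards [hy.recursion n] with ω hω
    have e1 : (fun c => (lagVec P (fun m => y m ω) ((n + 1 : ℕ) : ℤ) c : ℂ))
        = M *ᵥ (fun c => (lagVec P (fun m => y m ω) n c : ℂ))
          + push (fun i => ((S *ᵥ ξ n ω) i : ℂ)) 0 := by
      rw [hMd, companion_mulVec]
      push_cast
      rw [lagVec_succ]
      ext ⟨i, k⟩
      by_cases hk : k.val = 0
      · simp only [push, hk, if_true, Pi.add_apply]
        rw [hω]
        simp [Matrix.mulVec, dotProduct]
      · simp [push, hk]
    simp only [hG]
    rw [e1, dotProduct_add, hdual]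
    congr 1
    have e2 : ∑ j, L j * (ξ n ω j : ℂ)
        = ∑ i, ∑ j, l (i, ⟨0, hP⟩) * (S i j : ℂ) * (ξ n ω j : ℂ) := by
      rw [Finset.sum_comm]
      simp only [hLd, Finset.sum_mul]
    rw [e2]
    simp only [dotProduct, push, Fintype.sum_prod_type]
    refine Finset.sum_congr rfl fun i _ => ?_
    rw [Finset.sum_eq_single (⟨0, hP⟩ : Fin P)]
    · simp [Matrix.mulVec, dotProduct, Finset.mul_sum, mul_assoc]
    · intro k _ hk
      have : k.val ≠ 0 := fun h => hk (Fin.ext h)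
      simp [this]
    · simp
  set W : ℕ → Ω → ℂ := fun n ω => ∑ s ∈ Finset.range n, z ^ (s + 1) * ∑ j, L j * (ξ s ω j : ℂ)
  have hsum : ∀ᵐ ω ∂Pr, ∀ n : ℕ, z ^ n * G n ω - G 0 ω = W n ω := by
    filter_upwards [ae_all_iff.2 hstep] with ω hω n
    induction n with
    | zero => simp [W]
    | succ n ih =>
      have : W (n + 1) ω = W n ω + z ^ (n + 1) * ∑ j, L j * (ξ n ω j : ℂ) :=
        Finset.sum_range_succ _ _
      rw [this, ← ih, hω n, pow_succ]
      field_simp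
      ring
  set a : ℕ → Fin N → ℝ := fun s j => (z ^ (s + 1) * L j).re
  set b : ℕ → Fin N → ℝ := fun s j => (z ^ (s + 1) * L j).im
  have hW : ∀ n ω, ‖W n ω‖ ^ 2 = (∑ s ∈ Finset.range n, a s ⬝ᵥ ξ s ω) ^ 2
      + (∑ s ∈ Finset.range n, b s ⬝ᵥ ξ s ω) ^ 2 := by
    intro n ω
    have e : W n ω = ∑ s ∈ Finset.range n, ∑ j, z ^ (s + 1) * L j * (ξ s ω j : ℂ) := by
      refine Finset.sum_congr rfl fun s _ => ?_
      rw [Finset.mul_sum]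
      exact Finset.sum_congr rfl fun j _ => by ring
    rw [e, Complex.sq_norm, Complex.normSq_apply]
    simp only [Complex.re_sum, Complex.im_sum, Complex.re_mul_ofReal, Complex.im_mul_ofReal,
      dotProduct, a, b]
    ring
  have hEW : ∀ n, ∫ ω, ‖W n ω‖ ^ 2 ∂Pr = n * c := by
    intro n
    simp_rw [hW]
    rw [integral_add (hξ.memLp_sum_dotProduct n a).integrable_sq
      (hξ.memLp_sum_dotProduct n b).integrable_sq, hξ.integral_dotProduct_sq,
      hξ.integral_dotProduct_sq, ← Finset.sum_add_distrib]
    have : ∀ s ∈ Finset.range n, nsq (a s) + nsq (b s) = c := by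
      intro s _
      rw [nsq, nsq, ← Finset.sum_add_distrib, hc]
      refine Finset.sum_congr rfl fun j _ => ?_
      have h1 : ‖z ^ (s + 1) * L j‖ ^ 2 = ‖L j‖ ^ 2 := by
        rw [norm_mul, norm_pow, hz, one_pow, one_mul]
      rw [← h1, Complex.sq_norm, Complex.normSq_apply]
      simp only [a, b]; ring
    rw [Finset.sum_congr rfl this]; simp
  have hlag : ∀ n : ℤ, Integrable (fun ω => nsq (lagVec P (fun m => y m ω) n)) Pr := fun n =>
    integrable_finsetSum _ fun c _ => (hy.memLp _ _).integrable_sq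
  set K : ℝ := ∑ c : Fin N × Fin P, ∫ ω, y 0 ω c.1 ^ 2 ∂Pr
  have hElag : ∀ n : ℤ, ∫ ω, nsq (lagVec P (fun m => y m ω) n) ∂Pr = K := by
    intro n
    unfold nsq lagVec
    rw [integral_finsetSum _ fun c _ => (hy.memLp _ _).integrable_sq]
    exact Finset.sum_congr rfl fun c _ => hy.integral_sq_eq _ _
  set B : ℝ := ∑ c, ‖l c‖ ^ 2
  have hGle : ∀ n ω, ‖G n ω‖ ^ 2 ≤ B * nsq (lagVec P (fun m => y m ω) n) := by
    intro n ω
    have h1 : ‖G n ω‖ ≤ ∑ c, ‖l c‖ * |lagVec P (fun m => y m ω) n c| := by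
      refine (norm_sum_le _ _).trans (le_of_eq ?_)
      simp
    refine (pow_le_pow_left₀ (norm_nonneg _) h1 2).trans ?_
    refine (Finset.sum_mul_sq_le_sq_mul_sq _ _ _).trans (le_of_eq ?_)
    simp [B, nsq, sq_abs]
  -- The walk has variance `n c`, whereas stationarity bounds the second moments of `G n` and `G 0`
  -- independently of `n`.
  have hbound : ∀ n : ℕ, n * c ≤ 4 * (B * K) := by
    intro n
    rw [← hEW n]
    have h1 : ∫ ω, ‖W n ω‖ ^ 2 ∂Pr ≤ ∫ ω, (2 * (B * nsq (lagVec P (fun m => y m ω) n))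
        + 2 * (B * nsq (lagVec P (fun m => y m ω) 0))) ∂Pr := by
      refine integral_mono_ae ?_ ?_ ?_
      · simp_rw [hW]
        exact (hξ.memLp_sum_dotProduct n a).integrable_sq.add
          (hξ.memLp_sum_dotProduct n b).integrable_sq
      · exact (((hlag n).const_mul _).const_mul _).add (((hlag 0).const_mul _).const_mul _)
      · filter_upwards [hsum] with ω hω
        rw [← hω n]
        have h2 : ‖z ^ n * G n ω - G 0 ω‖ ≤ ‖G n ω‖ + ‖G 0 ω‖ := by
          refine (norm_sub_le _ _).trans (le_of_eq ?_)
          rw [norm_mul, norm_pow, hz, one_pow, one_mul]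
        have h3 := hGle n ω
        have h4 := hGle 0 ω
        have h5 := pow_le_pow_left₀ (norm_nonneg _) h2 2
        nlinarith [sq_nonneg (‖G n ω‖ - ‖G 0 ω‖)]
    refine h1.trans (le_of_eq ?_)
    rw [integral_add (((hlag n).const_mul _).const_mul _) (((hlag 0).const_mul _).const_mul _)]
    simp_rw [integral_const_mul, hElag]
    ring
  obtain ⟨n, hn⟩ := exists_nat_gt (4 * (B * K) / c)
  rw [div_lt_iff₀ hcpos] at hn
  linarith [hbound n]

end noise
end
end MLRHAR

namespace MLRHAR
open scoped Matrix
noncomputable section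

/-! ### The response blocks as a linear image of finitely many noise variables -/

section gram
variable {N P : ℕ}

lemma sum_comp_le_sum_range {s : Finset ℕ} {M : ℕ} {f : ℕ → ℕ} (hf : Set.InjOn f s)
    (hM : ∀ k ∈ s, f k < M) {g : ℕ → ℝ} (hg : ∀ t, 0 ≤ g t) :
    ∑ k ∈ s, g (f k) ≤ ∑ t ∈ Finset.range M, g t := by
  rw [← Finset.sum_image (f := g) (g := f) hf]
  refine Finset.sum_le_sum_of_subset_of_nonneg ?_ fun _ _ _ => hg _
  intro t ht
  obtain ⟨k, hk, rfl⟩ := Finset.mem_image.1 ht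
  exact Finset.mem_range.2 (hM k hk)

lemma nsq_lagVec (v : ℤ → Fin N → ℝ) {t : ℕ} (ht : P ≤ t) :
    nsq (lagVec P v t) = ∑ j ∈ Finset.range P, nsq (v ((t - 1 - j : ℕ) : ℤ)) := by
  unfold nsq
  rw [Fintype.sum_prod_type_right,
    ← Fin.sum_univ_eq_sum_range (fun j => ∑ i, v ((t - 1 - j : ℕ) : ℤ) i ^ 2)]
  refine Finset.sum_congr rfl fun k _ => Finset.sum_congr rfl fun i _ => ?_
  have := k.2
  have e : (t : ℤ) - 1 - (k.val : ℤ) = ((t - 1 - k.val : ℕ) : ℤ) := by omega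
  simp only [lagVec, e]

lemma nsq_lagVec_le (v : ℤ → Fin N → ℝ) {t M : ℕ} (ht : P ≤ t) (htM : t ≤ M) :
    nsq (lagVec P v t) ≤ ∑ s ∈ Finset.range M, nsq (v s) := by
  rw [nsq_lagVec v ht]
  refine sum_comp_le_sum_range (f := fun j => t - 1 - j) (g := fun s => nsq (v s)) ?_ ?_
    fun _ => nsq_nonneg _
  · intro j hj k hk h
    simp only [Finset.coe_range, Set.mem_Iio] at hj hk
    simp only at h; omega
  · intro j hj
    rw [Finset.mem_range] at hj; omega

lemma sum_nsq_lagVec_le (v : ℤ → Fin N → ℝ) {a L M : ℕ} (ha : P ≤ a) (hM : a + L ≤ M + 1) :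
    ∑ k ∈ Finset.range L, nsq (lagVec P v ((a + k : ℕ) : ℤ))
      ≤ P * ∑ s ∈ Finset.range M, nsq (v s) := by
  have h1 : ∀ k ∈ Finset.range L, nsq (lagVec P v ((a + k : ℕ) : ℤ))
      = ∑ j ∈ Finset.range P, nsq (v ((a + k - 1 - j : ℕ) : ℤ)) := fun k _ =>
    nsq_lagVec v (by omega)
  rw [Finset.sum_congr rfl h1, Finset.sum_comm]
  calc _ ≤ ∑ j ∈ Finset.range P, ∑ s ∈ Finset.range M, nsq (v s) := by
        refine Finset.sum_le_sum fun j hj => ?_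
        rw [Finset.mem_range] at hj
        refine sum_comp_le_sum_range (f := fun k => a + k - 1 - j) (g := fun s => nsq (v s)) ?_ ?_
          fun _ => nsq_nonneg _
        · intro k hk k' hk' h
          simp only at h; omega
        · intro k hk
          rw [Finset.mem_range] at hk; omega
    _ = _ := by simp

lemma nsq_mulVec_sqrt {Sig S : Matrix (Fin N) (Fin N) ℝ} (hS : S.IsHermitian) (hSS : S * S = Sig)
    (v : Fin N → ℝ) : nsq (S *ᵥ v) = star v ⬝ᵥ (Sig *ᵥ v) := by
  have hT : Sᵀ = S := by simpa [Matrix.IsHermitian] using hS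
  rw [← hSS, ← Matrix.mulVec_mulVec, nsq_eq_dotProduct, star_trivial]
  rw [Matrix.dotProduct_mulVec v S, ← Matrix.mulVec_transpose, hT]

lemma lambdaMin_mul_nsq_le {Sig S : Matrix (Fin N) (Fin N) ℝ} (hS : S.IsHermitian)
    (hSS : S * S = Sig) (hSig : Sig.IsHermitian) (v : Fin N → ℝ) :
    lambdaMin Sig * nsq v ≤ nsq (S *ᵥ v) := by
  rw [nsq_mulVec_sqrt hS hSS]
  simpa [nsq] using lambdaMin_mul_le Sig hSig v

lemma nsq_mulVec_le_lambdaMax {Sig S : Matrix (Fin N) (Fin N) ℝ} (hS : S.IsHermitian)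
    (hSS : S * S = Sig) (hSig : Sig.IsHermitian) (v : Fin N → ℝ) :
    nsq (S *ᵥ v) ≤ lambdaMax Sig * nsq v := by
  rw [nsq_mulVec_sqrt hS hSS]
  simpa [nsq] using le_lambdaMax_mul Sig hSig v

/-- The response to `S e` is controlled by `κ_U`. -/
lemma resp_mulVec_energy_le (hN : 1 ≤ N) (hP : 1 ≤ P) {A : Tensor3 N P}
    (hst : ∀ z : ℂ, ‖z‖ ≤ 1 → (charPoly A z).det ≠ 0) {Sig S : Matrix (Fin N) (Fin N) ℝ}
    (hS : S.IsHermitian) (hSS : S * S = Sig) (hSig : Sig.IsHermitian) (e : ℕ → Fin N → ℝ) (M : ℕ) :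
    ∑ t ∈ Finset.range M, nsq (resp A (fun t => S *ᵥ e t) t)
      ≤ kappaU A Sig * ∑ t ∈ Finset.range M, nsq (e t) := by
  have hmu : 0 < muMin A := muMin_pos hN A fun z => hst z (Circle.norm_coe z).le
  have h := resp_energy_le hN hP A hst (fun t => S *ᵥ e t) M
  rw [kappaU, div_mul_eq_mul_div, le_div_iff₀ hmu, mul_comm]
  refine h.trans ?_
  rw [Finset.mul_sum]
  exact Finset.sum_le_sum fun t _ => nsq_mulVec_le_lambdaMax hS hSS hSig _

/-- A finitely supported sequence is the response to an input controlled by `κ_L`. -/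
lemma exists_input (hN : 1 ≤ N) (hP : 1 ≤ P) {A : Tensor3 N P}
    {Sig S : Matrix (Fin N) (Fin N) ℝ} (hS : S.IsHermitian) (hSS : S * S = Sig)
    (hSig : Sig.PosDef) (hkl : 0 < kappaL A Sig) (w : ℤ → Fin N → ℝ) {M : ℕ}
    (hw : ∀ n : ℤ, n < 0 ∨ (M : ℤ) ≤ n → w n = 0) :
    ∃ e : ℕ → Fin N → ℝ, (∀ t : ℕ, S *ᵥ e t = resid A w t) ∧
      kappaL A Sig * ∑ t ∈ Finset.range M, nsq (e t) ≤ ∑ t ∈ Finset.range M, nsq (w t) := by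
  have hdet : IsUnit S.det := by
    have h1 : 0 < Sig.det := hSig.det_pos
    rw [← hSS, Matrix.det_mul] at h1
    exact isUnit_iff_ne_zero.2 fun h0 => by simp [h0] at h1
  refine ⟨fun t => S⁻¹ *ᵥ resid A w t, fun t => ?_, ?_⟩
  · rw [Matrix.mulVec_mulVec, Matrix.mul_nonsing_inv _ hdet, Matrix.one_mulVec]
  · have hmu : 0 < muMax A := (muMax_nonneg hN A).lt_of_ne fun h0 => by
      simp [kappaL, ← h0] at hkl
    rw [kappaL, div_mul_eq_mul_div, div_le_iff₀ hmu, Finset.mul_sum, mul_comm]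
    have h2 := (resid_energy_bounds hN hP A w hw).2
    have h3 : ∑ n ∈ Finset.range (M + P), nsq (w n) = ∑ n ∈ Finset.range M, nsq (w n) := by
      rw [Finset.sum_range_add]
      simp only [add_eq_left]
      refine Finset.sum_eq_zero fun j _ => ?_
      rw [hw _ (Or.inr (by omega)), nsq_zero]
    rw [h3] at h2
    refine le_trans ?_ h2
    calc _ ≤ ∑ t ∈ Finset.range M, nsq (resid A w t) := by
          refine Finset.sum_le_sum fun t _ => ?_
          refine (lambdaMin_mul_nsq_le hS hSS hSig.1 _).trans (le_of_eq ?_)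
          rw [Matrix.mulVec_mulVec, Matrix.mul_nonsing_inv _ hdet, Matrix.one_mulVec]
      _ ≤ _ := Finset.sum_le_sum_of_subset_of_nonneg (Finset.range_subset_range.2 (by omega))
          fun _ _ _ => nsq_nonneg _

/-- Extension by zero of a noise vector on the times `0, …, M - 1`. -/
def extend {M : ℕ} (ζ : Fin M × Fin N → ℝ) (t : ℕ) : Fin N → ℝ :=
  fun i => if h : t < M then ζ (⟨t, h⟩, i) else 0

lemma sum_nsq_extend {M : ℕ} (ζ : Fin M × Fin N → ℝ) :
    ∑ t ∈ Finset.range M, nsq (extend ζ t) = nsq ζ := by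
  rw [nsq, Fintype.sum_prod_type, ← Fin.sum_univ_eq_sum_range (fun t => nsq (extend ζ t))]
  refine Finset.sum_congr rfl fun t _ => Finset.sum_congr rfl fun i _ => ?_
  simp [extend]

/-- The blocks `(v_t, …, v_{t-P})`, `a ≤ t < a + L`, of the response to the noise `S ζ`, paired
with `u`. -/
def gramMap (A : Tensor3 N P) (S : Matrix (Fin N) (Fin N) ℝ) (a L M : ℕ)
    (u : Fin N × Fin (P + 1) → ℝ) : (Fin M × Fin N → ℝ) →ₗ[ℝ] (Fin L → ℝ) where
  toFun ζ k := u ⬝ᵥ lagVec (P + 1) (resp A fun t => S *ᵥ extend ζ t) ((a + k.val + 1 : ℕ) : ℤ)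
  map_add' ζ ζ' := by
    ext k
    have h1 : (fun t => S *ᵥ extend (ζ + ζ') t)
        = (fun t => S *ᵥ extend ζ t) + fun t => S *ᵥ extend ζ' t := by
      ext t : 1
      rw [Pi.add_apply, ← Matrix.mulVec_add]
      congr 1; ext i; simp only [extend, Pi.add_apply]; split_ifs <;> simp
    simp only [Pi.add_apply, ← dotProduct_add]
    congr 1; ext c
    simp only [lagVec, Pi.add_apply, h1, resp_add]
  map_smul' b ζ := by
    ext k
    have h1 : (fun t => S *ᵥ extend (b • ζ) t) = b • fun t => S *ᵥ extend ζ t := by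
      ext t : 1
      rw [Pi.smul_apply, ← Matrix.mulVec_smul]
      congr 1; ext i; simp only [extend, Pi.smul_apply]; split_ifs <;> simp
    simp only [RingHom.id_apply, Pi.smul_apply, ← dotProduct_smul]
    congr 1; ext c
    simp only [lagVec, Pi.smul_apply, h1, resp_smul]

lemma gramMap_apply (A : Tensor3 N P) (S : Matrix (Fin N) (Fin N) ℝ) (a L M : ℕ)
    (u : Fin N × Fin (P + 1) → ℝ) (ζ : Fin M × Fin N → ℝ) (k : Fin L) :
    gramMap A S a L M u ζ k
      = u ⬝ᵥ lagVec (P + 1) (resp A fun t => S *ᵥ extend ζ t) ((a + k.val + 1 : ℕ) : ℤ) := rfl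

/-- The matrix of `gramMap`. -/
def gramMatrix (A : Tensor3 N P) (S : Matrix (Fin N) (Fin N) ℝ) (a L M : ℕ)
    (u : Fin N × Fin (P + 1) → ℝ) : Matrix (Fin L) (Fin M × Fin N) ℝ :=
  LinearMap.toMatrix' (gramMap A S a L M u)

lemma gramMatrix_mulVec (A : Tensor3 N P) (S : Matrix (Fin N) (Fin N) ℝ) (a L M : ℕ)
    (u : Fin N × Fin (P + 1) → ℝ) (ζ : Fin M × Fin N → ℝ) :
    gramMatrix A S a L M u *ᵥ ζ = gramMap A S a L M u ζ :=
  LinearMap.toMatrix'_mulVec _ _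

lemma gramMatrix_add (A : Tensor3 N P) (S : Matrix (Fin N) (Fin N) ℝ) (a L M : ℕ)
    (u v : Fin N × Fin (P + 1) → ℝ) :
    gramMatrix A S a L M (u + v) = gramMatrix A S a L M u + gramMatrix A S a L M v := by
  ext k p
  simp only [gramMatrix, LinearMap.toMatrix'_apply, gramMap_apply, Matrix.add_apply, add_dotProduct]

lemma gramMatrix_smul (A : Tensor3 N P) (S : Matrix (Fin N) (Fin N) ℝ) (a L M : ℕ) (b : ℝ)
    (u : Fin N × Fin (P + 1) → ℝ) :
    gramMatrix A S a L M (b • u) = b • gramMatrix A S a L M u := by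
  ext k p
  simp only [gramMatrix, LinearMap.toMatrix'_apply, gramMap_apply, Matrix.smul_apply,
    smul_dotProduct]

section bounds
variable (hN : 1 ≤ N) (hP : 1 ≤ P) {A : Tensor3 N P}
  (hst : ∀ z : ℂ, ‖z‖ ≤ 1 → (charPoly A z).det ≠ 0) {Sig S : Matrix (Fin N) (Fin N) ℝ}
  (hS : S.IsHermitian) (hSS : S * S = Sig) {a L M : ℕ} (ha : P ≤ a) (haM : a + L ≤ M)
include hN hP hst hS hSS ha haM

/-- Each value of the response occurs in at most `P + 1` of the overlapping blocks, and the total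
energy of the response is at most `κ_U` times that of the noise. -/
lemma nsq_gramMatrix_mulVec_le (hSig : Sig.IsHermitian) (u : Fin N × Fin (P + 1) → ℝ)
    (ζ : Fin M × Fin N → ℝ) :
    nsq (gramMatrix A S a L M u *ᵥ ζ) ≤ (P + 1) * kappaU A Sig * nsq u * nsq ζ := by
  rw [gramMatrix_mulVec]
  set v := resp A fun t => S *ᵥ extend ζ t
  calc nsq (gramMap A S a L M u ζ)
      ≤ ∑ k : Fin L, nsq u * nsq (lagVec (P + 1) v ((a + 1 + k.val : ℕ) : ℤ)) := by
        refine Finset.sum_le_sum fun k _ => ?_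
        rw [gramMap_apply, add_right_comm]
        exact dotProduct_sq_le _ _
    _ = nsq u * ∑ k ∈ Finset.range L, nsq (lagVec (P + 1) v ((a + 1 + k : ℕ) : ℤ)) := by
        rw [← Finset.mul_sum, Fin.sum_univ_eq_sum_range
          (fun k => nsq (lagVec (P + 1) v ((a + 1 + k : ℕ) : ℤ)))]
    _ ≤ nsq u * (((P + 1 : ℕ) : ℝ) * (kappaU A Sig * nsq ζ)) := by
        refine mul_le_mul_of_nonneg_left ?_ (nsq_nonneg u)
        refine (sum_nsq_lagVec_le v (P := P + 1) (M := M) (by omega) (by omega)).trans ?_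
        refine mul_le_mul_of_nonneg_left ?_ (by positivity)
        rw [← sum_nsq_extend ζ]
        exact resp_mulVec_energy_le hN hP hst hS hSS hSig _ M
    _ = _ := by push_cast; ring

/-- The squared length of a row is the variance of `u` paired with one block. Feeding the row itself
in as noise and applying Cauchy–Schwarz gives the bound; a single block repeats no time, so the
factor `P + 1` is absent. -/
lemma nsq_gramMatrix_row_le (hSig : Sig.IsHermitian) (hku : 0 ≤ kappaU A Sig)
    (u : Fin N × Fin (P + 1) → ℝ) (k : Fin L) :
    nsq (gramMatrix A S a L M u k) ≤ kappaU A Sig * nsq u := by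
  set r := gramMatrix A S a L M u k with hr
  have h1 : nsq r = gramMap A S a L M u r k := by
    rw [← gramMatrix_mulVec, nsq_eq_dotProduct]; rfl
  have h2 : (gramMap A S a L M u r k) ^ 2 ≤ nsq u * (kappaU A Sig * nsq r) := by
    rw [gramMap_apply]
    refine (dotProduct_sq_le _ _).trans (mul_le_mul_of_nonneg_left ?_ (nsq_nonneg u))
    have := k.2
    refine (nsq_lagVec_le _ (M := M) (by omega) (by omega)).trans ?_
    rw [← sum_nsq_extend r]
    exact resp_mulVec_energy_le hN hP hst hS hSS hSig _ M
  rw [← h1] at h2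
  rcases (nsq_nonneg r).eq_or_lt with h0 | h0
  · rw [← h0]; exact mul_nonneg hku (nsq_nonneg u)
  · nlinarith

omit hst in
-- A noise input with energy at most `‖u‖²/κ_L` is exhibited whose response has block exactly `u` at
-- this time. Pairing the row with it gives `‖u‖²`, and Cauchy–Schwarz bounds the row from below.
lemma le_nsq_gramMatrix_row (hSig : Sig.PosDef) (hkl : 0 < kappaL A Sig)
    (u : Fin N × Fin (P + 1) → ℝ) (k : Fin L) :
    kappaL A Sig * nsq u ≤ nsq (gramMatrix A S a L M u k) := by
  have hk := k.2
  -- the sequence with blocks `u` at the times `a + k, …, a + k - P`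
  set w : ℤ → Fin N → ℝ := fun n i => if h : (a + k.val : ℤ) - P ≤ n ∧ n ≤ a + k.val then
    u (i, ⟨((a + k.val : ℤ) - n).toNat, by omega⟩) else 0 with hw
  have hw0 : ∀ n : ℤ, n < 0 ∨ (M : ℤ) ≤ n → w n = 0 := by
    intro n hn; ext i
    simp only [hw]
    rw [dif_neg (by omega)]; rfl
  obtain ⟨e, he1, he2⟩ := exists_input hN hP hS hSS hSig hkl w hw0
  set ζ : Fin M × Fin N → ℝ := fun p => e p.1 p.2 with hζ
  have hext : ∀ t : ℕ, t < M → S *ᵥ extend ζ t = resid A w t := by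
    intro t ht
    rw [← he1]; congr 1; ext i; simp [extend, ht, hζ]
  have hlag : lagVec (P + 1) (resp A fun t => S *ᵥ extend ζ t) ((a + k.val + 1 : ℕ) : ℤ) = u := by
    ext ⟨i, j⟩
    have hj := j.2
    simp only [lagVec]
    rw [resp_congr A (e' := fun t : ℕ => resid A w t) (fun s hs => hext s (by omega)),
      resp_resid A w fun n hn => hw0 n (Or.inl hn)]
    simp only [hw]
    rw [dif_pos (by omega)]
    congr 2
    apply Fin.ext
    simp only
    omega
  have h1 : gramMap A S a L M u ζ k = nsq u := by
    rw [gramMap_apply, hlag, nsq_eq_dotProduct]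
  have h2 : (gramMap A S a L M u ζ k) ^ 2 ≤ nsq (gramMatrix A S a L M u k) * nsq ζ := by
    rw [← gramMatrix_mulVec]; exact dotProduct_sq_le _ _
  have h3 : nsq ζ = ∑ t ∈ Finset.range M, nsq (e t) := by
    rw [← sum_nsq_extend]
    refine Finset.sum_congr rfl fun t ht => ?_
    rw [Finset.mem_range] at ht
    congr 1; ext i; simp [extend, ht, hζ]
  have h4 : ∑ t ∈ Finset.range M, nsq (w t) = nsq u := by
    have e1 : nsq u = nsq (lagVec (P + 1) w ((a + k.val + 1 : ℕ) : ℤ)) := by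
      congr 1; ext ⟨i, j⟩
      have hj := j.2
      simp only [lagVec, hw]
      rw [dif_pos (by omega)]
      congr 2; apply Fin.ext; simp only; omega
    rw [e1, nsq_lagVec w (by omega), ← Finset.sum_image (f := fun s : ℕ => nsq (w s))
      (g := fun j => a + k.val + 1 - 1 - j) (by
        intro j hj j' hj' h
        simp only [Finset.coe_range, Set.mem_Iio] at hj hj'
        simp only at h; omega)]
    symm
    refine Finset.sum_subset ?_ ?_
    · intro t ht
      obtain ⟨j, hj, rfl⟩ := Finset.mem_image.1 ht
      rw [Finset.mem_range]; omega
    · intro t _ ht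
      have : w t = 0 := by
        ext i; simp only [hw]
        rw [dif_neg]; · rfl
        intro h
        refine ht (Finset.mem_image.2 ⟨a + k.val - t, Finset.mem_range.2 (by omega), by omega⟩)
      rw [this, nsq_zero]
  rw [h4, ← h3] at he2
  rw [h1] at h2
  rcases (nsq_nonneg u).eq_or_lt with h0 | h0
  · rw [← h0, mul_zero]; exact nsq_nonneg _
  · have h5 : kappaL A Sig * nsq u * nsq u ≤ nsq (gramMatrix A S a L M u k) * nsq u := by
      have h6 := mul_le_mul_of_nonneg_left he2 (nsq_nonneg (gramMatrix A S a L M u k))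
      have h7 := mul_le_mul_of_nonneg_left h2 hkl.le
      nlinarith
    exact le_of_mul_le_mul_right h5 h0

end bounds
end gram
end
end MLRHAR

namespace MLRHAR
open scoped Matrix
noncomputable section

/-! ### Uniform concentration of the Gram matrix -/

section gramEvent
variable {N P : ℕ} {Ω : Type*} [MeasurableSpace Ω] {Pr : Measure Ω}

lemma matrix_row_add {m n : Type*} (X Y : Matrix m n ℝ) (k : m) : (X + Y) k = X k + Y k := rfl

lemma matrix_row_smul {m n : Type*} (b : ℝ) (X : Matrix m n ℝ) (k : m) : (b • X) k = b • X k := rfl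

/-- Deviation of `‖F_u ζ‖²` from its mean, as a bilinear form in `u`. -/
def gramDeviation (A : Tensor3 N P) (S : Matrix (Fin N) (Fin N) ℝ) (a L M : ℕ)
    (ζ : Fin M × Fin N → ℝ) :
    EuclideanSpace ℝ (Fin N × Fin (P + 1)) →ₗ[ℝ] EuclideanSpace ℝ (Fin N × Fin (P + 1)) →ₗ[ℝ] ℝ :=
  LinearMap.mk₂ ℝ (fun u v =>
    (gramMatrix A S a L M u.ofLp *ᵥ ζ) ⬝ᵥ (gramMatrix A S a L M v.ofLp *ᵥ ζ)
      - ∑ k, gramMatrix A S a L M u.ofLp k ⬝ᵥ gramMatrix A S a L M v.ofLp k)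
    (by
      intro u u' v
      simp only [WithLp.ofLp_add, gramMatrix_add, Matrix.add_mulVec, add_dotProduct, Finset.sum_add_distrib, matrix_row_add]
      ring)
    (by
      intro b u v
      simp only [WithLp.ofLp_smul, gramMatrix_smul, Matrix.smul_mulVec, smul_dotProduct,
        matrix_row_smul, ← Finset.smul_sum, smul_sub])
    (by
      intro u v v'
      simp only [WithLp.ofLp_add, gramMatrix_add, Matrix.add_mulVec, dotProduct_add, Finset.sum_add_distrib, matrix_row_add]
      ring)
    (by
      intro b u v
      simp only [WithLp.ofLp_smul, gramMatrix_smul, Matrix.smul_mulVec, dotProduct_smul,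
        matrix_row_smul, ← Finset.smul_sum, smul_sub])

lemma gramDeviation_self (A : Tensor3 N P) (S : Matrix (Fin N) (Fin N) ℝ) (a L M : ℕ)
    (ζ : Fin M × Fin N → ℝ) (u : EuclideanSpace ℝ (Fin N × Fin (P + 1))) :
    gramDeviation A S a L M ζ u u = nsq (gramMatrix A S a L M u.ofLp *ᵥ ζ)
      - ∑ k, ∑ p, gramMatrix A S a L M u.ofLp k p ^ 2 := by
  simp only [gramDeviation, LinearMap.mk₂_apply, nsq_eq_dotProduct, dotProduct, sq]

lemma gramDeviation_comm (A : Tensor3 N P) (S : Matrix (Fin N) (Fin N) ℝ) (a L M : ℕ)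
    (ζ : Fin M × Fin N → ℝ) (u v : EuclideanSpace ℝ (Fin N × Fin (P + 1))) :
    gramDeviation A S a L M ζ u v = gramDeviation A S a L M ζ v u := by
  simp only [gramDeviation, LinearMap.mk₂_apply]
  rw [dotProduct_comm]
  congr 1
  exact Finset.sum_congr rfl fun k _ => dotProduct_comm _ _

/-- Hanson–Wright controls only the diagonal of this form; polarization carries the control to pairs
of net points. -/
lemma gramDeviation_polarization (A : Tensor3 N P) (S : Matrix (Fin N) (Fin N) ℝ) (a L M : ℕ)
    (ζ : Fin M × Fin N → ℝ) (u v : EuclideanSpace ℝ (Fin N × Fin (P + 1))) :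
    4 * gramDeviation A S a L M ζ u v = gramDeviation A S a L M ζ (u + v) (u + v)
      - gramDeviation A S a L M ζ (u - v) (u - v) := by
  simp only [map_add, map_sub, LinearMap.add_apply, LinearMap.sub_apply]
  rw [gramDeviation_comm A S a L M ζ v u]
  ring

lemma IsSubGaussianNoise.half_le {κ : NNReal} {ξ : ℤ → Ω → Fin N → ℝ} [IsProbabilityMeasure Pr]
    (h : IsSubGaussianNoise Pr κ ξ) (hN : 1 ≤ N) : (1 / 2 : ℝ) ≤ κ ^ 2 := by
  refine half_le_of_subgaussian (h.subGaussian 0 ⟨0, hN⟩) ?_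
  have := h.cov 0 ⟨0, hN⟩ ⟨0, hN⟩
  simpa [sq] using this

/-- Uniform concentration of the empirical Gram matrix of the response blocks. -/
theorem exists_gram_event [IsProbabilityMeasure Pr] (hN : 1 ≤ N) (hP : 1 ≤ P) {A : Tensor3 N P}
    (hst : ∀ z : ℂ, ‖z‖ ≤ 1 → (charPoly A z).det ≠ 0) {Sig S : Matrix (Fin N) (Fin N) ℝ}
    (hS : S.IsHermitian) (hSS : S * S = Sig) (hSig : Sig.PosDef) (hkl : 0 < kappaL A Sig)
    (hklu : kappaL A Sig ≤ kappaU A Sig) {κ : NNReal} {ξ : ℤ → Ω → Fin N → ℝ}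
    (hξ : IsSubGaussianNoise Pr κ ξ) (J : ℤ) {a : ℕ} (L : ℕ) (ha : P ≤ a) :
    ∃ B : Set Ω, MeasurableSet B ∧
      Pr B ≤ 8 * 25 ^ (N * (P + 1)) *
        eexp (-(L * (kappaL A Sig / kappaU A Sig) ^ 2 / (655360000 * (P + 1) ^ 2 * κ ^ 4))) ∧
      ∀ ω ∉ B, ∀ u : Fin N × Fin (P + 1) → ℝ,
        24 / 25 * kappaL A Sig * L * nsq u ≤ ∑ k ∈ Finset.range L, (u ⬝ᵥ lagVec (P + 1)
          (resp A fun t => S *ᵥ ξ (t - J) ω) ((a + k + 1 : ℕ) : ℤ)) ^ 2 ∧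
        ∑ k ∈ Finset.range L, (u ⬝ᵥ lagVec (P + 1)
          (resp A fun t => S *ᵥ ξ (t - J) ω) ((a + k + 1 : ℕ) : ℤ)) ^ 2
            ≤ 26 / 25 * kappaU A Sig * L * nsq u := by
  classical
  set M := a + L with hM
  set kl := kappaL A Sig with hkld
  set ku := kappaU A Sig with hkud
  have hku : 0 < ku := hkl.trans_le hklu
  set ζ : Fin M × Fin N → Ω → ℝ := fun p ω => ξ ((p.1.val : ℤ) - J) ω p.2 with hζ
  have hm : ∀ p, Measurable (ζ p) := fun p => hξ.measurable_entry _ _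
  have hind : iIndepFun ζ Pr := by
    refine hξ.iIndepFun_entries.precomp (g := fun p : Fin M × Fin N => ((p.1.val : ℤ) - J, p.2)) ?_
    intro p q h
    simp only [Prod.mk.injEq, sub_left_inj, Nat.cast_inj] at h
    exact Prod.ext (Fin.ext h.1) h.2
  have hsub : ∀ p, HasSubgaussianMGF (ζ p) (κ ^ 2) Pr := fun p => hξ.subGaussian _ _
  have hvar : ∀ p, ∫ ω, ζ p ω ^ 2 ∂Pr = 1 := fun p => by
    have := hξ.cov ((p.1.val : ℤ) - J) p.2 p.2
    simpa [sq] using this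
  have hκ := hξ.half_le hN
  have hκ0 : (0 : ℝ) < κ ^ 2 := by linarith
  set E := EuclideanSpace ℝ (Fin N × Fin (P + 1))
  obtain ⟨s, hcard, hs⟩ := exists_isHalfNet E
  have hdim : Module.finrank ℝ E = N * (P + 1) := by simp [E]
  rw [hdim] at hcard
  set F : E → Matrix (Fin L) (Fin M × Fin N) ℝ := fun u => gramMatrix A S a L M u.ofLp with hF
  -- Polarization turns the threshold `κ_L/50` into `κ_L/100` for pairs of net points, and passing
  -- from the net to all vectors multiplies by four. This yields the deviation `κ_L/25` of the
  -- conclusion.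
  set D : E → Set Ω := fun u => {ω | kl / 50 * (L : ℝ) ≤
    |nsq (F u *ᵥ fun p => ζ p ω) - ∑ k, ∑ p, F u k p ^ 2|} with hD
  have hDm : ∀ u, MeasurableSet (D u) := by
    intro u
    refine measurableSet_le measurable_const ?_
    unfold nsq Matrix.mulVec dotProduct
    fun_prop
  set eps := eexp (-(L * (kl / ku) ^ 2 / (655360000 * (P + 1) ^ 2 * κ ^ 4))) with heps
  have hDp : ∀ u : E, ‖u‖ ≤ 2 → Pr (D u) ≤ 4 * eps := by
    intro u hu
    -- Sums and differences of net points have norm at most two, hence the factor four. The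
    -- resulting constant is `16384 · 16 · 2500 = 655360000`.
    have hb : (0 : ℝ) < 4 * (P + 1) * ku := by positivity
    have hu4 : nsq u.ofLp ≤ 4 := by
      have := nsq_eq_norm_sq u
      nlinarith [norm_nonneg u]
    have h1 := hansonWright hm hind hsub hκ hvar (F u) hb (ρ := kl / 50) (fun x => by
      refine (nsq_gramMatrix_mulVec_le hN hP hst hS hSS ha le_rfl hSig.1 u.ofLp x).trans ?_
      refine mul_le_mul_of_nonneg_right ?_ (nsq_nonneg x)
      rw [← hkud]
      nlinarith [show (0 : ℝ) ≤ (P + 1) * ku by positivity]) (by positivity)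
      (by nlinarith [show (0 : ℝ) ≤ P * ku by positivity])
    rw [Fintype.card_fin] at h1
    refine h1.trans (le_of_eq ?_)
    rw [heps]
    congr 3
    field_simp
    ring
  set B : Set Ω := ⋃ u ∈ s, ⋃ v ∈ s, (D (u + v) ∪ D (u - v)) with hB
  refine ⟨B, ?_, ?_, ?_⟩
  · exact Finset.measurableSet_biUnion _ fun u _ => Finset.measurableSet_biUnion _ fun v _ =>
      (hDm _).union (hDm _)
  · have h2 : ∀ u ∈ s, ∀ v ∈ s, Pr (D (u + v) ∪ D (u - v)) ≤ 8 * eps := by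
      intro u hu v hv
      refine (measure_union_le _ _).trans ?_
      have hu1 := hs.1 u hu
      have hv1 := hs.1 v hv
      calc _ ≤ 4 * eps + 4 * eps := add_le_add
            (hDp _ ((norm_add_le _ _).trans (by linarith)))
            (hDp _ ((norm_sub_le _ _).trans (by linarith)))
        _ = _ := by rw [← add_mul]; norm_num
    calc Pr B ≤ ∑ u ∈ s, ∑ v ∈ s, 8 * eps := by
          refine (measure_biUnion_finset_le _ _).trans (Finset.sum_le_sum fun u hu => ?_)
          exact (measure_biUnion_finset_le _ _).trans (Finset.sum_le_sum fun v hv => h2 u hu v hv)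
      _ = (s.card * s.card : ℕ) * (8 * eps) := by
          simp only [Finset.sum_const, nsmul_eq_mul]; push_cast; ring
      _ ≤ (25 ^ (N * (P + 1)) : ℕ) * (8 * eps) := by
          gcongr
          calc s.card * s.card ≤ 5 ^ (N * (P + 1)) * 5 ^ (N * (P + 1)) := Nat.mul_le_mul hcard hcard
            _ = _ := by rw [← mul_pow]; norm_num
      _ = _ := by push_cast; ring
  · intro ω hω u
    set zω : Fin M × Fin N → ℝ := fun p => ζ p ω with hzω
    have h3 : ∀ u v : E, u ∈ s → v ∈ s → |gramDeviation A S a L M zω u v| ≤ kl / 100 * L := by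
      intro u v hu hv
      have hn : ω ∉ D (u + v) ∧ ω ∉ D (u - v) := by
        constructor <;> intro hc <;> refine hω (Set.mem_biUnion hu (Set.mem_biUnion hv ?_))
        · exact Or.inl hc
        · exact Or.inr hc
      simp only [hD, Set.mem_ofPred_eq, not_le] at hn
      have e := gramDeviation_polarization A S a L M zω u v
      rw [gramDeviation_self, gramDeviation_self] at e
      have h5 := abs_lt.1 hn.1
      have h6 := abs_lt.1 hn.2
      simp only [hF] at h5 h6
      rw [abs_le]
      constructor <;> linarith [h5.1, h5.2, h6.1, h6.2]
    have h7 := hs.abs_bilin_le hs (gramDeviation A S a L M zω)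
      (fun c hc d hd => h3 c d hc hd) (WithLp.toLp 2 u) (WithLp.toLp 2 u)
    rw [gramDeviation_self] at h7
    have hnu : ‖(WithLp.toLp 2 u : E)‖ * ‖(WithLp.toLp 2 u : E)‖ = nsq u := by
      rw [← sq, ← nsq_eq_norm_sq]
    rw [mul_assoc _ ‖(WithLp.toLp 2 u : E)‖, hnu] at h7
    simp only at h7
    have h8 : ∑ k, ∑ p, gramMatrix A S a L M u k p ^ 2 ≤ L * (ku * nsq u) := by
      calc _ ≤ ∑ k : Fin L, ku * nsq u := Finset.sum_le_sum fun k _ =>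
            nsq_gramMatrix_row_le hN hP hst hS hSS ha le_rfl hSig.1 hku.le u k
        _ = _ := by simp
    have h9 : L * (kl * nsq u) ≤ ∑ k, ∑ p, gramMatrix A S a L M u k p ^ 2 := by
      calc L * (kl * nsq u) = ∑ k : Fin L, kl * nsq u := by simp
        _ ≤ _ := Finset.sum_le_sum fun k _ =>
            le_nsq_gramMatrix_row hN hP hS hSS ha le_rfl hSig hkl u k
    have h10 : nsq (gramMatrix A S a L M u *ᵥ zω) = ∑ k ∈ Finset.range L, (u ⬝ᵥ lagVec (P + 1)
        (resp A fun t => S *ᵥ ξ (t - J) ω) ((a + k + 1 : ℕ) : ℤ)) ^ 2 := by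
      rw [gramMatrix_mulVec, nsq, ← Fin.sum_univ_eq_sum_range (fun k => (u ⬝ᵥ lagVec (P + 1)
        (resp A fun t => S *ᵥ ξ (t - J) ω) ((a + k + 1 : ℕ) : ℤ)) ^ 2)]
      refine Finset.sum_congr rfl fun k _ => ?_
      have hk := k.2
      have e : lagVec (P + 1) (resp A fun t => S *ᵥ extend zω t) ((a + k.val + 1 : ℕ) : ℤ)
          = lagVec (P + 1) (resp A fun t => S *ᵥ ξ (t - J) ω) ((a + k.val + 1 : ℕ) : ℤ) := by
        refine lagVec_congr fun j hj => resp_congr A fun t ht => ?_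
        have : t < M := by omega
        congr 1; ext i; simp [extend, this, hzω, hζ]
      rw [gramMap_apply, e]
    rw [h10] at h7
    have h11 := abs_le.1 h7
    have hL0 : (0 : ℝ) ≤ L * nsq u := mul_nonneg (by positivity) (nsq_nonneg u)
    have h12 : kl * (L * nsq u) ≤ ku * (L * nsq u) := mul_le_mul_of_nonneg_right hklu hL0
    constructor <;> linarith [h11.1, h11.2]

end gramEvent
end
end MLRHAR

namespace MLRHAR
open scoped Matrix
noncomputable section

/-! ### Exponential supermartingales for predictable transforms -/

section supermartingale
variable {N : ℕ} {Ω : Type*} [MeasurableSpace Ω] {Pr : Measure Ω}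

/-- The sequence `x` with the entries from time `n` on replaced by zero. -/
def cut (n : ℕ) (x : ℕ → Fin N → ℝ) : ℕ → Fin N → ℝ := fun s => if s < n then x s else 0

lemma measurable_cut (n : ℕ) : Measurable (cut n : (ℕ → Fin N → ℝ) → ℕ → Fin N → ℝ) := by
  refine measurable_pi_lambda _ fun s => ?_
  unfold cut
  split_ifs
  · exact measurable_pi_apply s
  · exact measurable_const

lemma indepFun_cut {ζ : ℕ → Ω → Fin N → ℝ} (hm : ∀ t, Measurable (ζ t)) (hind : iIndepFun ζ Pr)
    (n : ℕ) : IndepFun (fun ω => cut n fun t => ζ t ω) (ζ n) Pr := by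
  have h := hind.indepFun_finset (Finset.range n) {n} (by simp) hm
  let e : (Finset.range n → Fin N → ℝ) → ℕ → Fin N → ℝ :=
    fun x s => if h : s < n then x ⟨s, Finset.mem_range.2 h⟩ else 0
  have he : Measurable e := by
    refine measurable_pi_lambda _ fun s => ?_
    by_cases hs : s < n
    · simp only [e, hs, dite_true]; exact measurable_pi_apply _
    · simp only [e, hs, dite_false]; exact measurable_const
  let e' : (({n} : Finset ℕ) → Fin N → ℝ) → Fin N → ℝ := fun x => x ⟨n, by simp⟩
  have he' : Measurable e' := measurable_pi_apply _
  have h1 := h.comp he he'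
  convert! h1 using 1

/-- Exponential supermartingale of a martingale transform of sub-Gaussian vectors. -/
lemma lintegral_eexp_transform_le [IsProbabilityMeasure Pr] {ζ : ℕ → Ω → Fin N → ℝ} {κ : ℝ}
    (hm : ∀ t, Measurable (ζ t)) (hind : iIndepFun ζ Pr)
    (hmgf : ∀ t v, ∫⁻ ω, eexp (v ⬝ᵥ ζ t ω) ∂Pr ≤ eexp (κ ^ 2 * nsq v / 2))
    {h : ℕ → (ℕ → Fin N → ℝ) → Fin N → ℝ} (hh : ∀ t, Measurable (h t))
    (hpast : ∀ t x, h t (cut t x) = h t x) (n : ℕ) :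
    ∫⁻ ω, eexp (∑ t ∈ Finset.range n, (h t (fun s => ζ s ω) ⬝ᵥ ζ t ω
      - κ ^ 2 * nsq (h t fun s => ζ s ω) / 2)) ∂Pr ≤ 1 := by
  have hζm : Measurable fun ω => fun s => ζ s ω := measurable_pi_lambda _ hm
  have hnsq : Measurable (nsq : (Fin N → ℝ) → ℝ) := continuous_nsq.measurable
  have hdot : Measurable fun p : (Fin N → ℝ) × (Fin N → ℝ) => p.1 ⬝ᵥ p.2 := by
    unfold dotProduct; fun_prop
  induction n with
  | zero => simp [eexp_zero]
  | succ n ih =>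
    set f : (ℕ → Fin N → ℝ) → ℝ := fun x => ∑ t ∈ Finset.range n,
      (h t x ⬝ᵥ x t - κ ^ 2 * nsq (h t x) / 2) with hf
    have hfm : Measurable f := by
      refine Finset.measurable_sum _ fun t _ => ?_
      exact (hdot.comp ((hh t).prodMk (measurable_pi_apply t))).sub
        (((hnsq.comp (hh t)).const_mul _).div_const _)
    -- Predictability is expressed as invariance under erasing all entries from time `t` on; it
    -- persists when the erasure starts later.
    have hcut : ∀ t ≤ n, ∀ x, h t (cut n x) = h t x := by
      intro t ht x
      rw [← hpast t (cut n x), ← hpast t x]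
      congr 1
      ext s : 1
      unfold cut
      split_ifs <;> first | rfl | omega
    have hfc : ∀ x, f (cut n x) = f x := by
      intro x
      refine Finset.sum_congr rfl fun t ht => ?_
      rw [Finset.mem_range] at ht
      rw [hcut t ht.le]
      simp [cut, ht]
    -- The past enters only through the sequence cut at `n`, which is independent of `ζ n`.
    -- Integrating out `ζ n` first, the compensator cancels its moment bound.
    set g : (ℕ → Fin N → ℝ) → (Fin N → ℝ) → ENNReal := fun x v =>
      eexp (f x) * (eexp (h n x ⬝ᵥ v) * eexp (-(κ ^ 2 * nsq (h n x) / 2))) with hg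
    have hgm : Measurable (Function.uncurry g) := by
      have h1 : Measurable fun p : (ℕ → Fin N → ℝ) × (Fin N → ℝ) => eexp (f p.1) :=
        measurable_eexp.comp (hfm.comp measurable_fst)
      have h2 : Measurable fun p : (ℕ → Fin N → ℝ) × (Fin N → ℝ) => eexp (h n p.1 ⬝ᵥ p.2) :=
        measurable_eexp.comp (hdot.comp (((hh n).comp measurable_fst).prodMk measurable_snd))
      have h3 : Measurable fun p : (ℕ → Fin N → ℝ) × (Fin N → ℝ) =>
          eexp (-(κ ^ 2 * nsq (h n p.1) / 2)) :=
        measurable_eexp.comp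
          (((hnsq.comp ((hh n).comp measurable_fst)).const_mul _).div_const _).neg
      exact h1.mul (h2.mul h3)
    have e1 : ∀ ω, eexp (∑ t ∈ Finset.range (n + 1), (h t (fun s => ζ s ω) ⬝ᵥ ζ t ω
        - κ ^ 2 * nsq (h t fun s => ζ s ω) / 2)) = g (cut n fun t => ζ t ω) (ζ n ω) := by
      intro ω
      rw [Finset.sum_range_succ, eexp_add, sub_eq_add_neg, eexp_add]
      simp only [hg, hfc, hcut n le_rfl]
      rfl
    simp_rw [e1]
    have hcm : Measurable fun ω => cut n fun t => ζ t ω := (measurable_cut n).comp hζm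
    rw [lintegral_comp_indepFun hcm (hm n) (indepFun_cut hm hind n) hgm]
    refine (lintegral_mono fun ω => ?_).trans ih
    simp only [hg, hfc, hcut n le_rfl]
    rw [lintegral_const_mul' _ _ (eexp_ne_top _), lintegral_mul_const' _ _ (eexp_ne_top _)]
    calc _ ≤ eexp (f fun t => ζ t ω) * (eexp (κ ^ 2 * nsq (h n fun t => ζ t ω) / 2)
          * eexp (-(κ ^ 2 * nsq (h n fun t => ζ t ω) / 2))) := by
          gcongr
          exact hmgf n _
      _ = _ := by rw [← eexp_add, add_neg_cancel, eexp_zero, mul_one]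

end supermartingale

/-! ### Uniform control of the score over low-rank directions -/

section scoreEvent
variable {N P : ℕ} {Ω : Type*} [MeasurableSpace Ω] {Pr : Measure Ω}

lemma measurable_run (A : Tensor3 N P) (x : Fin N × Fin P → ℝ) (t : ℕ) :
    Measurable fun e : ℕ → Fin N → ℝ => run A x e t := by
  induction t with
  | zero => exact measurable_const
  | succ t ih =>
    refine measurable_pi_lambda _ fun c => ?_
    simp only [run, push]
    split_ifs
    · have h1 : Measurable fun e : ℕ → Fin N → ℝ => (unfold1 A *ᵥ run A x e t) c.1 := by
        unfold Matrix.mulVec dotProduct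
        exact Finset.measurable_sum _ fun j _ =>
          ((measurable_pi_apply j).comp ih).const_mul _
      exact h1.add ((measurable_pi_apply c.1).comp (measurable_pi_apply t))
    · exact (measurable_pi_apply _).comp ih

lemma measurable_mulVec_seq (S : Matrix (Fin N) (Fin N) ℝ) :
    Measurable fun (x : ℕ → Fin N → ℝ) (t : ℕ) => S *ᵥ x t := by
  unfold Matrix.mulVec dotProduct
  fun_prop

variable {q : ℕ}

/-- `U V x` for `U : ℝ^q → ℝ^N` and a matrix with rows `V₁, …, V_q`. -/
def factorVec (U : EuclideanSpace ℝ (Fin q) →L[ℝ] EuclideanSpace ℝ (Fin N))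
    (V : Fin q → Fin N × Fin P → ℝ) (x : Fin N × Fin P → ℝ) : Fin N → ℝ :=
  (U (WithLp.toLp 2 fun j => V j ⬝ᵥ x)).ofLp

lemma factorVec_dotProduct (U : EuclideanSpace ℝ (Fin q) →L[ℝ] EuclideanSpace ℝ (Fin N))
    (V : Fin q → Fin N × Fin P → ℝ) (x : Fin N × Fin P → ℝ) (e : Fin N → ℝ) :
    factorVec U V x ⬝ᵥ e
      = ∑ j, inner ℝ (U (EuclideanSpace.single j 1)) (WithLp.toLp 2 e) * (V j ⬝ᵥ x) := by
  have h1 : (WithLp.toLp 2 fun j => V j ⬝ᵥ x : EuclideanSpace ℝ (Fin q))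
      = ∑ j, (V j ⬝ᵥ x) • EuclideanSpace.single j (1 : ℝ) := by
    ext i; simp [Pi.single_apply]
  have h2 : factorVec U V x ⬝ᵥ e
      = inner ℝ (U (WithLp.toLp 2 fun j => V j ⬝ᵥ x)) (WithLp.toLp 2 e) := by
    rw [EuclideanSpace.inner_eq_star_dotProduct, dotProduct_comm]; rfl
  rw [h2, h1, map_sum, sum_inner]
  refine Finset.sum_congr rfl fun j _ => ?_
  rw [map_smul, real_inner_smul_left, mul_comm]

lemma nsq_factorVec_le {U : EuclideanSpace ℝ (Fin q) →L[ℝ] EuclideanSpace ℝ (Fin N)}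
    (hU : ‖U‖ ≤ 1) (V : Fin q → Fin N × Fin P → ℝ) (x : Fin N × Fin P → ℝ) :
    nsq (factorVec U V x) ≤ ∑ j, (V j ⬝ᵥ x) ^ 2 := by
  have h1 : nsq (factorVec U V x) = ‖U (WithLp.toLp 2 fun j => V j ⬝ᵥ x)‖ ^ 2 :=
    nsq_eq_norm_sq _
  have h2 : ∑ j, (V j ⬝ᵥ x) ^ 2
      = ‖(WithLp.toLp 2 fun j => V j ⬝ᵥ x : EuclideanSpace ℝ (Fin q))‖ ^ 2 :=
    nsq_eq_norm_sq (WithLp.toLp 2 fun j => V j ⬝ᵥ x)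
  rw [h1, h2]
  refine pow_le_pow_left₀ (norm_nonneg _) ((U.le_opNorm _).trans ?_) 2
  exact mul_le_of_le_one_left (norm_nonneg _) hU

lemma factorVec_neg (U : EuclideanSpace ℝ (Fin q) →L[ℝ] EuclideanSpace ℝ (Fin N))
    (V : Fin q → Fin N × Fin P → ℝ) (x : Fin N × Fin P → ℝ) :
    factorVec (-U) V x = -factorVec U V x := rfl

lemma measurable_factorVec (U : EuclideanSpace ℝ (Fin q) →L[ℝ] EuclideanSpace ℝ (Fin N))
    (V : Fin q → Fin N × Fin P → ℝ) : Measurable (factorVec U V) := by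
  have h1 : Continuous (factorVec U V) := by
    unfold factorVec dotProduct
    fun_prop
  exact h1.measurable

/-- The bilinear form `(U, V) ↦ ∑ₖ ⟨U V xₖ, eₖ⟩`. -/
def scoreBilin (L : ℕ) (e : ℕ → Fin N → ℝ) (x : ℕ → Fin N × Fin P → ℝ) :
    (EuclideanSpace ℝ (Fin q) →L[ℝ] EuclideanSpace ℝ (Fin N)) →ₗ[ℝ]
      EuclideanSpace ℝ (Fin q × Fin N × Fin P) →ₗ[ℝ] ℝ :=
  LinearMap.mk₂ ℝ (fun U V => ∑ k ∈ Finset.range L,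
      factorVec U (fun j c => V (j, c)) (x k) ⬝ᵥ e k)
    (by
      intro U U' V
      rw [← Finset.sum_add_distrib]
      exact Finset.sum_congr rfl fun k _ => by rw [← add_dotProduct]; rfl)
    (by
      intro b U V
      rw [Finset.smul_sum]
      exact Finset.sum_congr rfl fun k _ => by rw [← smul_dotProduct]; rfl)
    (by
      intro U V V'
      rw [← Finset.sum_add_distrib]
      refine Finset.sum_congr rfl fun k _ => ?_
      simp only [factorVec_dotProduct, ← Finset.sum_add_distrib]
      refine Finset.sum_congr rfl fun j _ => ?_
      rw [← mul_add, ← add_dotProduct]; rfl)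
    (by
      intro b U V
      rw [Finset.smul_sum]
      refine Finset.sum_congr rfl fun k _ => ?_
      simp only [factorVec_dotProduct, Finset.smul_sum]
      refine Finset.sum_congr rfl fun j _ => ?_
      have : (fun c => (b • V) (j, c)) = b • fun c => V (j, c) := rfl
      rw [this, smul_dotProduct, smul_eq_mul, smul_eq_mul]; ring)

lemma scoreBilin_apply (L : ℕ) (e : ℕ → Fin N → ℝ) (x : ℕ → Fin N × Fin P → ℝ)
    (U : EuclideanSpace ℝ (Fin q) →L[ℝ] EuclideanSpace ℝ (Fin N))
    (V : EuclideanSpace ℝ (Fin q × Fin N × Fin P)) :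
    scoreBilin L e x U V
      = ∑ k ∈ Finset.range L, factorVec U (fun j c => V (j, c)) (x k) ⬝ᵥ e k := rfl

variable {A : Tensor3 N P} {S : Matrix (Fin N) (Fin N) ℝ} {κ : NNReal} {ξ : ℤ → Ω → Fin N → ℝ}

lemma measurable_state (hξ : IsSubGaussianNoise Pr κ ξ) (J : ℤ) (t : ℕ) :
    Measurable fun ω => run A 0 (fun s : ℕ => S *ᵥ ξ (s - J) ω) t :=
  (measurable_run A 0 t).comp ((measurable_mulVec_seq S).comp
    (measurable_pi_lambda _ fun s : ℕ => hξ.measurable (s - J)))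

/-- Tail bound for the score in a fixed direction, on the event that its quadratic variation is
bounded. -/
lemma measure_score_le [IsProbabilityMeasure Pr] (hS : S.IsHermitian)
    (hξ : IsSubGaussianNoise Pr κ ξ) (J : ℤ) (a L : ℕ) {lmax Q τ : ℝ} (hκ : (0 : ℝ) < κ)
    (hlQ : 0 < lmax * Q) (hlmax : 0 ≤ lmax) (hτ : 0 ≤ τ) (hSl : ∀ v, nsq (S *ᵥ v) ≤ lmax * nsq v)
    (U : EuclideanSpace ℝ (Fin q) →L[ℝ] EuclideanSpace ℝ (Fin N))
    (V : Fin q → Fin N × Fin P → ℝ) :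
    Pr {ω | ∑ k ∈ Finset.range L,
          nsq (factorVec U V (run A 0 (fun s : ℕ => S *ᵥ ξ (s - J) ω) (a + k))) ≤ Q ∧
        τ ≤ ∑ k ∈ Finset.range L, factorVec U V (run A 0 (fun s : ℕ => S *ᵥ ξ (s - J) ω) (a + k))
          ⬝ᵥ (S *ᵥ ξ ((a + k : ℕ) - J) ω)}
      ≤ eexp (-(τ ^ 2 / (2 * κ ^ 2 * (lmax * Q)))) := by
  have hT : Sᵀ = S := by simpa [Matrix.IsHermitian] using hS
  -- The minimizer of `-λτ + κ²λ² lmax Q/2`.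
  set lam : ℝ := τ / (κ ^ 2 * (lmax * Q)) with hlam
  have hlam0 : 0 ≤ lam := by positivity
  set ζ : ℕ → Ω → Fin N → ℝ := fun s => ξ (s - J) with hζ
  have hind : iIndepFun ζ Pr := hξ.indep.precomp (g := fun s : ℕ => (s : ℤ) - J) fun s t h => by
    simpa using h
  -- The state at time `t` depends on the noise strictly before `t`, so this is predictable. It is
  -- zero before time `a`, where the score does not collect terms.
  set h : ℕ → (ℕ → Fin N → ℝ) → Fin N → ℝ := fun t x => if a ≤ t then
    lam • (S *ᵥ factorVec U V (run A 0 (fun s => S *ᵥ x s) t)) else 0 with hh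
  have hhm : ∀ t, Measurable (h t) := by
    intro t
    simp only [hh]
    split_ifs
    · refine Measurable.const_smul ?_ lam
      have h1 : Continuous fun v : Fin N → ℝ => S *ᵥ v :=
        Continuous.matrix_mulVec continuous_const continuous_id
      exact h1.measurable.comp ((measurable_factorVec U V).comp
        ((measurable_run A 0 t).comp (measurable_mulVec_seq S)))
    · exact measurable_const
  have hpast : ∀ t x, h t (cut t x) = h t x := by
    intro t x
    simp only [hh]
    rw [run_congr A 0 (e' := fun s => S *ᵥ x s)]
    intro s hs
    simp [cut, hs]
  have hmgf : ∀ t v, ∫⁻ ω, eexp (v ⬝ᵥ ζ t ω) ∂Pr ≤ eexp ((κ : ℝ) ^ 2 * nsq v / 2) := fun t v =>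
    lintegral_eexp_dotProduct_le (hξ.indep_entries _) (hξ.subGaussian _) v
  have hsm := lintegral_eexp_transform_le (κ := κ) (fun t => hξ.measurable _) hind hmgf hhm hpast
    (a + L)
  set X : Ω → ℕ → Fin N → ℝ := fun ω k =>
    factorVec U V (run A 0 (fun s : ℕ => S *ᵥ ξ (s - J) ω) (a + k)) with hX
  set Y : Ω → ℝ := fun ω => ∑ t ∈ Finset.range (a + L), (h t (fun s => ζ s ω) ⬝ᵥ ζ t ω
      - (κ : ℝ) ^ 2 * nsq (h t fun s => ζ s ω) / 2) with hY
  have hYe : ∀ ω, Y ω = ∑ k ∈ Finset.range L, (lam * (X ω k ⬝ᵥ (S *ᵥ ξ ((a + k : ℕ) - J) ω))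
      - (κ : ℝ) ^ 2 * (lam ^ 2 * nsq (S *ᵥ X ω k)) / 2) := by
    intro ω
    simp only [hY]
    rw [Finset.sum_range_add, Finset.sum_eq_zero, zero_add]
    · refine Finset.sum_congr rfl fun k _ => ?_
      simp only [hh, hζ, le_add_iff_nonneg_right, zero_le, if_true, nsq_smul, smul_dotProduct,
        smul_eq_mul]
      congr 2
      rw [Matrix.dotProduct_mulVec, ← Matrix.mulVec_transpose, hT]
    · intro t ht
      rw [Finset.mem_range] at ht
      simp [hh, not_le.2 ht, nsq_zero]
  have hYm : Measurable Y := by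
    refine Finset.measurable_sum _ fun t _ => ?_
    have hm1 : Measurable fun ω => h t (fun s => ζ s ω) :=
      (hhm t).comp (measurable_pi_lambda _ fun s => hξ.measurable _)
    have hm2 : Measurable fun ω => h t (fun s => ζ s ω) ⬝ᵥ ζ t ω := by
      unfold dotProduct
      exact Finset.measurable_sum _ fun i _ => ((measurable_pi_apply i).comp hm1).mul
        (hξ.measurable_entry _ _)
    exact hm2.sub (((continuous_nsq.measurable.comp hm1).const_mul _).div_const _)
  have hc := chernoff (Pr := Pr) hYm (K := 0) (lam := 1) (t := τ ^ 2 / (2 * κ ^ 2 * (lmax * Q)))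
    zero_le_one (by simp only [one_mul, eexp_zero]; exact hsm)
  rw [one_mul, zero_sub] at hc
  refine (measure_mono ?_).trans hc
  rintro ω ⟨hQ, hτ'⟩
  show τ ^ 2 / (2 * κ ^ 2 * (lmax * Q)) ≤ Y ω
  rw [hYe, Finset.sum_sub_distrib, ← Finset.mul_sum]
  have h1 : ∑ k ∈ Finset.range L, (κ : ℝ) ^ 2 * (lam ^ 2 * nsq (S *ᵥ X ω k)) / 2
      ≤ (κ : ℝ) ^ 2 * lam ^ 2 / 2 * (lmax * Q) := by
    calc _ = (κ : ℝ) ^ 2 * lam ^ 2 / 2 * ∑ k ∈ Finset.range L, nsq (S *ᵥ X ω k) := by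
          rw [Finset.mul_sum]; exact Finset.sum_congr rfl fun k _ => by ring
      _ ≤ (κ : ℝ) ^ 2 * lam ^ 2 / 2 * (lmax * ∑ k ∈ Finset.range L, nsq (X ω k)) := by
          refine mul_le_mul_of_nonneg_left ?_ (by positivity)
          rw [Finset.mul_sum]
          exact Finset.sum_le_sum fun k _ => hSl _
      _ ≤ _ := by
          refine mul_le_mul_of_nonneg_left (mul_le_mul_of_nonneg_left hQ hlmax) (by positivity)
  have h2 : lam * τ ≤ lam * ∑ k ∈ Finset.range L, X ω k ⬝ᵥ (S *ᵥ ξ ((a + k : ℕ) - J) ω) :=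
    mul_le_mul_of_nonneg_left hτ' hlam0
  have h3 : τ ^ 2 / (2 * κ ^ 2 * (lmax * Q))
      = lam * τ - (κ : ℝ) ^ 2 * lam ^ 2 / 2 * (lmax * Q) := by
    rw [hlam]; field_simp; ring
  linarith

/-- Uniform bound for the score over matrices of low rank. -/
theorem exists_score_event [IsProbabilityMeasure Pr] (q : ℕ) (hS : S.IsHermitian)
    (hξ : IsSubGaussianNoise Pr κ ξ) (J : ℤ) (a L : ℕ) {lmax Q τ : ℝ} (hκ : (0 : ℝ) < κ)
    (hlmax : 0 < lmax) (hQ : 0 < Q) (hτ : 0 ≤ τ) (hSl : ∀ v, nsq (S *ᵥ v) ≤ lmax * nsq v) :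
    ∃ B : Set Ω, MeasurableSet B ∧
      Pr B ≤ 2 * 5 ^ (q * N + q * (N * P)) * eexp (-(τ ^ 2 / (2 * κ ^ 2 * (lmax * Q)))) ∧
      ∀ ω ∉ B, (∀ b : Fin N × Fin P → ℝ, ∑ k ∈ Finset.range L,
          (b ⬝ᵥ run A 0 (fun s : ℕ => S *ᵥ ξ (s - J) ω) (a + k)) ^ 2 ≤ Q * nsq b) →
        ∀ (U : EuclideanSpace ℝ (Fin q) →L[ℝ] EuclideanSpace ℝ (Fin N))
          (V : Fin q → Fin N × Fin P → ℝ),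
          |∑ k ∈ Finset.range L, factorVec U V (run A 0 (fun s : ℕ => S *ᵥ ξ (s - J) ω) (a + k))
            ⬝ᵥ (S *ᵥ ξ ((a + k : ℕ) - J) ω)| ≤ 4 * τ * ‖U‖ * √(∑ j, nsq (V j)) := by
  classical
  set EU := EuclideanSpace ℝ (Fin q) →L[ℝ] EuclideanSpace ℝ (Fin N)
  set EV := EuclideanSpace ℝ (Fin q × Fin N × Fin P)
  obtain ⟨s, hcard, hs⟩ := exists_isHalfNet EU
  obtain ⟨s', hcard', hs'⟩ := exists_isHalfNet EV
  have hdim : Module.finrank ℝ EU = q * N := by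
    have h1 : Module.finrank ℝ EU
        = Module.finrank ℝ (EuclideanSpace ℝ (Fin q) →ₗ[ℝ] EuclideanSpace ℝ (Fin N)) :=
      (LinearMap.toContinuousLinearMap (𝕜 := ℝ) (E := EuclideanSpace ℝ (Fin q))
        (F' := EuclideanSpace ℝ (Fin N))).symm.finrank_eq
    rw [h1, Module.finrank_linearMap]; simp
  have hdim' : Module.finrank ℝ EV = q * (N * P) := by simp [EV]
  rw [hdim] at hcard
  rw [hdim'] at hcard'
  set X : Ω → ℕ → Fin N × Fin P → ℝ := fun ω k => run A 0 (fun s : ℕ => S *ᵥ ξ (s - J) ω) (a + k)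
    with hX
  set e : Ω → ℕ → Fin N → ℝ := fun ω k => S *ᵥ ξ ((a + k : ℕ) - J) ω with he
  set row : EV → Fin q → Fin N × Fin P → ℝ := fun V j c => V (j, c) with hrow
  set D : EU → EV → Set Ω := fun U V => {ω | ∑ k ∈ Finset.range L, nsq (factorVec U (row V) (X ω k))
      ≤ Q ∧ τ ≤ ∑ k ∈ Finset.range L, factorVec U (row V) (X ω k) ⬝ᵥ e ω k} with hD
  have hXm : ∀ k, Measurable fun ω => X ω k := fun k => measurable_state hξ J _
  have hem : ∀ k, Measurable fun ω => e ω k := by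
    intro k
    have h1 : Continuous fun v : Fin N → ℝ => S *ᵥ v :=
      Continuous.matrix_mulVec continuous_const continuous_id
    exact h1.measurable.comp (hξ.measurable _)
  have hDm : ∀ U V, MeasurableSet (D U V) := by
    intro U V
    have hfm : ∀ k, Measurable fun ω => factorVec U (row V) (X ω k) := fun k =>
      (measurable_factorVec _ _).comp (hXm k)
    have hm1 : MeasurableSet {ω | ∑ k ∈ Finset.range L, nsq (factorVec U (row V) (X ω k)) ≤ Q} :=
      measurableSet_le (Finset.measurable_sum _ fun k _ =>
        continuous_nsq.measurable.comp (hfm k)) measurable_const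
    refine hm1.inter (s₂ := {ω | τ ≤ ∑ k ∈ Finset.range L, factorVec U (row V) (X ω k) ⬝ᵥ e ω k})
      (measurableSet_le measurable_const (Finset.measurable_sum _ fun k _ => ?_))
    unfold dotProduct
    exact Finset.measurable_sum _ fun i _ => ((measurable_pi_apply i).comp (hfm k)).mul
      ((measurable_pi_apply i).comp (hem k))
  set eps := eexp (-(τ ^ 2 / (2 * κ ^ 2 * (lmax * Q)))) with heps
  have hDp : ∀ U V, Pr (D U V) ≤ eps := fun U V =>
    measure_score_le hS hξ J a L hκ (by positivity) hlmax.le hτ hSl U (row V)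
  -- Including `-U` provides the lower tail. The sets `D` carry the constraint on the quadratic
  -- variation, so their probability can be bounded without conditioning on the Gram event.
  set B : Set Ω := ⋃ U ∈ s, ⋃ V ∈ s', (D U V ∪ D (-U) V) with hB
  refine ⟨B, ?_, ?_, ?_⟩
  · exact Finset.measurableSet_biUnion _ fun u _ => Finset.measurableSet_biUnion _ fun v _ =>
      (hDm _ _).union (hDm _ _)
  · have h2 : ∀ U V, Pr (D U V ∪ D (-U) V) ≤ 2 * eps := by
      intro U V
      refine (measure_union_le _ _).trans ?_
      rw [two_mul]
      exact add_le_add (hDp _ _) (hDp _ _)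
    calc Pr B ≤ ∑ u ∈ s, ∑ v ∈ s', 2 * eps := by
          refine (measure_biUnion_finset_le _ _).trans (Finset.sum_le_sum fun u hu => ?_)
          exact (measure_biUnion_finset_le _ _).trans (Finset.sum_le_sum fun v hv => h2 u v)
      _ = (s.card * s'.card : ℕ) * (2 * eps) := by
          simp only [Finset.sum_const, nsmul_eq_mul]; push_cast; ring
      _ ≤ (5 ^ (q * N + q * (N * P)) : ℕ) * (2 * eps) := by
          gcongr
          rw [pow_add]
          exact Nat.mul_le_mul hcard hcard'
      _ = _ := by push_cast; ring
  · intro ω hω hquad U V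
    have h3 : ∀ U ∈ s, ∀ V ∈ s', |scoreBilin L (e ω) (X ω) U V| ≤ τ := by
      intro U hU V hV
      have hn : ω ∉ D U V ∧ ω ∉ D (-U) V := by
        constructor <;> intro hc <;> refine hω (Set.mem_biUnion hU (Set.mem_biUnion hV ?_))
        · exact Or.inl hc
        · exact Or.inr hc
      have hV1 : ∑ j, nsq (row V j) ≤ 1 := by
        have e1 : ∑ j, nsq (row V j) = ‖V‖ ^ 2 := by
          rw [← nsq_eq_norm_sq, nsq, Fintype.sum_prod_type]; rfl
        rw [e1]
        exact pow_le_one₀ (norm_nonneg _) (hs'.1 V hV)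
      -- For factors in the unit balls the quadratic variation is at most the Gram form summed over
      -- the rows of `V`, so the constraint in `D` holds automatically under the Gram bound.
      have hq : ∀ U : EU, ‖U‖ ≤ 1 →
          ∑ k ∈ Finset.range L, nsq (factorVec U (row V) (X ω k)) ≤ Q := by
        intro U hU
        calc _ ≤ ∑ k ∈ Finset.range L, ∑ j, (row V j ⬝ᵥ X ω k) ^ 2 :=
              Finset.sum_le_sum fun k _ => nsq_factorVec_le hU _ _
          _ = ∑ j, ∑ k ∈ Finset.range L, (row V j ⬝ᵥ X ω k) ^ 2 := Finset.sum_comm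
          _ ≤ ∑ j, Q * nsq (row V j) := Finset.sum_le_sum fun j _ => hquad _
          _ ≤ Q := by rw [← Finset.mul_sum]; exact mul_le_of_le_one_right hQ.le hV1
      have hU1 := hs.1 U hU
      have h4 : scoreBilin L (e ω) (X ω) U V < τ := by
        by_contra! hc
        exact hn.1 ⟨hq U hU1, hc⟩
      have h5 : -scoreBilin L (e ω) (X ω) U V < τ := by
        by_contra! hc
        refine hn.2 ⟨hq (-U) (by rwa [norm_neg]), hc.trans (le_of_eq ?_)⟩
        rw [scoreBilin_apply, ← Finset.sum_neg_distrib]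
        exact Finset.sum_congr rfl fun k _ => by rw [factorVec_neg, neg_dotProduct]
      rw [abs_le]
      constructor <;> linarith
    have h6 := hs.abs_bilin_le hs' (scoreBilin L (e ω) (X ω)) h3 U
      (WithLp.toLp 2 fun p => V p.1 p.2)
    have h7 : ‖(WithLp.toLp 2 fun p : Fin q × Fin N × Fin P => V p.1 p.2 : EV)‖
        = √(∑ j, nsq (V j)) := by
      have e1 : ∑ j, nsq (V j) = ‖(WithLp.toLp 2 fun p : Fin q × Fin N × Fin P => V p.1 p.2 : EV)‖ ^ 2 := by
        rw [← nsq_eq_norm_sq, nsq, Fintype.sum_prod_type]; rfl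
      rw [e1, Real.sqrt_sq (norm_nonneg _)]
    rw [h7] at h6
    exact h6

end scoreEvent
end
end MLRHAR

namespace MLRHAR
open scoped Matrix
noncomputable section

/-! ### Stability of the conditions under small observation errors -/

section perturbation
variable {N P : ℕ}

/-- Every lag slot runs injectively through times in `1, …, T`, so only errors of actual
observations occur. Used with `p = P, c = 0` and with `p = P + 1, c = 1`. -/
lemma sum_nsq_lagVec_Icc_le (h : ℤ → Fin N → ℝ) {p c T : ℕ} (hpc : p ≤ P + c) (hc : c ≤ 1) :
    ∑ n ∈ Finset.Icc ((P : ℤ) + 1) (T : ℤ), nsq (lagVec p h (n + c))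
      ≤ p * ∑ n ∈ Finset.Icc (1 : ℤ) (T : ℤ), nsq (h n) := by
  have h1 : ∀ n : ℤ, nsq (lagVec p h n) = ∑ k : Fin p, nsq (h (n - 1 - k.val)) := fun n => by
    unfold nsq; rw [Fintype.sum_prod_type_right]; rfl
  simp_rw [h1]
  rw [Finset.sum_comm]
  calc _ ≤ ∑ _k : Fin p, ∑ n ∈ Finset.Icc (1 : ℤ) (T : ℤ), nsq (h n) := by
        refine Finset.sum_le_sum fun k _ => ?_
        have hk := k.2
        rw [← Finset.sum_image (f := fun m : ℤ => nsq (h m)) (g := fun n : ℤ => n + c - 1 - k.val)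
          (fun a _ b _ hab => by simp only at hab; omega)]
        refine Finset.sum_le_sum_of_subset_of_nonneg ?_ fun _ _ _ => nsq_nonneg _
        intro m hm
        obtain ⟨n, hn, rfl⟩ := Finset.mem_image.1 hm
        rw [Finset.mem_Icc] at hn ⊢
        omega
    _ = _ := by simp

lemma sum_dotProduct_le {J ι : Type*} [Fintype ι] (I : Finset J) (a b : J → ι → ℝ) :
    ∑ n ∈ I, a n ⬝ᵥ b n ≤ √(∑ n ∈ I, nsq (a n)) * √(∑ n ∈ I, nsq (b n)) := by
  calc ∑ n ∈ I, a n ⬝ᵥ b n ≤ ∑ n ∈ I, √(nsq (a n)) * √(nsq (b n)) :=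
        Finset.sum_le_sum fun n _ => (le_abs_self _).trans (abs_dotProduct_le _ _)
    _ ≤ √(∑ n ∈ I, √(nsq (a n)) ^ 2) * √(∑ n ∈ I, √(nsq (b n)) ^ 2) :=
        Real.sum_mul_le_sqrt_mul_sqrt _ _ _
    _ = _ := by simp only [Real.sq_sqrt (nsq_nonneg _)]

lemma sqrt_mul_sqrt_le {X Y c Z : ℝ} (hX : 0 ≤ X) (hc : 0 ≤ c) (h : X * Y ≤ c ^ 2 * Z) :
    √X * √Y ≤ c * √Z := by
  rw [← Real.sqrt_mul hX]
  refine (Real.sqrt_le_sqrt h).trans (le_of_eq ?_)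
  rw [Real.sqrt_mul (sq_nonneg c), Real.sqrt_sq hc]

lemma scoreForm_eq {q : ℕ} (I : Finset ℤ) (e : ℤ → Fin N → ℝ) (x : ℤ → Fin N × Fin P → ℝ)
    (U : EuclideanSpace ℝ (Fin q) →L[ℝ] EuclideanSpace ℝ (Fin N))
    (V : Fin q → Fin N × Fin P → ℝ) :
    scoreForm I e x U V = ∑ n ∈ I, factorVec U V (x n) ⬝ᵥ e n :=
  Finset.sum_congr rfl fun n _ => (factorVec_dotProduct U V (x n) (e n)).symm

lemma scoreForm_add {q : ℕ} (I : Finset ℤ) (e e' : ℤ → Fin N → ℝ) (x x' : ℤ → Fin N × Fin P → ℝ)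
    (U : EuclideanSpace ℝ (Fin q) →L[ℝ] EuclideanSpace ℝ (Fin N))
    (V : Fin q → Fin N × Fin P → ℝ) :
    scoreForm I (e + e') (x + x') U V = scoreForm I e x U V + scoreForm I e x' U V
      + scoreForm I e' (x + x') U V := by
  rw [scoreForm_eq, scoreForm_eq, scoreForm_eq, scoreForm_eq, ← Finset.sum_add_distrib,
    ← Finset.sum_add_distrib]
  refine Finset.sum_congr rfl fun n _ => ?_
  simp only [Pi.add_apply, dotProduct_add]
  congr 1
  simp only [factorVec_dotProduct, ← Finset.sum_add_distrib, dotProduct_add, mul_add]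

/-- The score is controlled by the energies of the residuals and of the lag vectors. -/
lemma scoreForm_le {q : ℕ} (I : Finset ℤ) (e : ℤ → Fin N → ℝ) (x : ℤ → Fin N × Fin P → ℝ)
    {U : EuclideanSpace ℝ (Fin q) →L[ℝ] EuclideanSpace ℝ (Fin N)} (hU : ‖U‖ ≤ 1)
    (V : Fin q → Fin N × Fin P → ℝ) {X Y : ℝ} (hX : ∑ n ∈ I, nsq (e n) ≤ X)
    (hY : ∀ b, ∑ n ∈ I, (b ⬝ᵥ x n) ^ 2 ≤ Y * nsq b) :
    scoreForm I e x U V ≤ √X * √(Y * ∑ j, nsq (V j)) := by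
  rw [scoreForm_eq]
  refine (sum_dotProduct_le _ _ _).trans ?_
  rw [mul_comm]
  refine mul_le_mul (Real.sqrt_le_sqrt hX) (Real.sqrt_le_sqrt ?_) (Real.sqrt_nonneg _)
    (Real.sqrt_nonneg _)
  calc _ ≤ ∑ n ∈ I, ∑ j, (V j ⬝ᵥ x n) ^ 2 := Finset.sum_le_sum fun n _ => nsq_factorVec_le hU _ _
    _ = ∑ j, ∑ n ∈ I, (V j ⬝ᵥ x n) ^ 2 := Finset.sum_comm
    _ ≤ ∑ j, Y * nsq (V j) := Finset.sum_le_sum fun j _ => hY _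
    _ = _ := by rw [Finset.mul_sum]

lemma lagVec_add (p : ℕ) (z h : ℤ → Fin N → ℝ) : lagVec p (z + h) = lagVec p z + lagVec p h := rfl

lemma resid_add (A : Tensor3 N P) (z h : ℤ → Fin N → ℝ) :
    resid A (z + h) = resid A z + resid A h := by
  ext n : 1
  simp only [resid, lagVec_add, Pi.add_apply, Matrix.mulVec_add]
  abel

/-- Padding a coefficient vector for the lags `1, …, P` by zero at lag `0`. -/
def pad (b : Fin N × Fin P → ℝ) : Fin N × Fin (P + 1) → ℝ :=
  fun c => Fin.cases 0 (fun k => b (c.1, k)) c.2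

lemma nsq_pad (b : Fin N × Fin P → ℝ) : nsq (pad b) = nsq b := by
  simp [nsq, Fintype.sum_prod_type, Fin.sum_univ_succ, pad]

lemma pad_dotProduct (b : Fin N × Fin P → ℝ) (v : ℤ → Fin N → ℝ) (n : ℤ) :
    pad b ⬝ᵥ lagVec (P + 1) v (n + 1) = b ⬝ᵥ lagVec P v n := by
  simp only [dotProduct, Fintype.sum_prod_type, Fin.sum_univ_succ, pad, lagVec, Fin.cases_zero,
    zero_mul, zero_add, Fin.cases_succ, Fin.val_succ]
  refine Finset.sum_congr rfl fun i _ => Finset.sum_congr rfl fun k _ => ?_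
  have e : n + 1 - 1 - ((k.val + 1 : ℕ) : ℤ) = n - 1 - k.val := by push_cast; ring
  rw [e]

/-- Restricted eigenvalue and score bounds survive a small perturbation of the observations. -/
theorem conditions_of_perturbation (hN : 1 ≤ N) (hP : 1 ≤ P) {T L : ℕ} (hLT : L + P = T)
    (hT100 : 100 * P ≤ T) {A : Tensor3 N P} {kl ku τ s : ℝ} (hkl : 0 < kl) (hklu : kl ≤ ku)
    (hs : s = kl / (400 * P * N * T)) {z h : ℤ → Fin N → ℝ}
    (hlow : ∀ u, 24 / 25 * kl * L * nsq u
      ≤ ∑ n ∈ Finset.Icc ((P : ℤ) + 1) (T : ℤ), (u ⬝ᵥ lagVec (P + 1) z (n + 1)) ^ 2)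
    (hup : ∀ u, ∑ n ∈ Finset.Icc ((P : ℤ) + 1) (T : ℤ), (u ⬝ᵥ lagVec (P + 1) z (n + 1)) ^ 2
      ≤ 26 / 25 * ku * L * nsq u)
    (herr : ∑ n ∈ Finset.Icc (1 : ℤ) (T : ℤ), nsq (h n) ≤ T * s) {q : ℕ}
    (hscore : ∀ U : EuclideanSpace ℝ (Fin q) →L[ℝ] EuclideanSpace ℝ (Fin N), ‖U‖ ≤ 1 →
      ∀ V, scoreForm (Finset.Icc ((P : ℤ) + 1) (T : ℤ)) (resid A z) (lagVec P z) U V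
        ≤ 4 * τ * √(∑ j, nsq (V j))) :
    (∀ b, 4 / 5 * kl * T * nsq b
      ≤ ∑ n ∈ Finset.Icc ((P : ℤ) + 1) (T : ℤ), (b ⬝ᵥ lagVec P (z + h) n) ^ 2) ∧
    (∀ b, ∑ n ∈ Finset.Icc ((P : ℤ) + 1) (T : ℤ), (b ⬝ᵥ lagVec P (z + h) n) ^ 2
      ≤ 6 / 5 * ku * T * nsq b) ∧
    ∀ U : EuclideanSpace ℝ (Fin q) →L[ℝ] EuclideanSpace ℝ (Fin N), ‖U‖ ≤ 1 →
      ∀ V, scoreForm (Finset.Icc ((P : ℤ) + 1) (T : ℤ)) (resid A (z + h)) (lagVec P (z + h)) U V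
        ≤ T * ((4 * τ / T + 3 * (P + 1) * √(muMax A * ku * N * s)) * √(∑ j, nsq (V j))) := by
  set I := Finset.Icc ((P : ℤ) + 1) (T : ℤ) with hI
  have hP1 : (1 : ℝ) ≤ P := by exact_mod_cast hP
  have hN1 : (1 : ℝ) ≤ N := by exact_mod_cast hN
  have hT100' : 100 * (P : ℝ) ≤ T := by exact_mod_cast hT100
  have hT1 : (1 : ℝ) ≤ T := by linarith
  have hT0 : (0 : ℝ) < T := by linarith
  have hL : (L : ℝ) = T - P := by
    have : ((L + P : ℕ) : ℝ) = T := by rw [hLT]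
    push_cast at this; linarith
  have hL99 : 99 / 100 * (T : ℝ) ≤ L := by rw [hL]; linarith
  have hLT' : (L : ℝ) ≤ T := by rw [hL]; linarith
  have hku : 0 < ku := hkl.trans_le hklu
  have hs0 : 0 < s := by rw [hs]; positivity
  have hmu := muMax_nonneg hN A
  have hPs : P * s ≤ kl / 400 := by
    rw [hs, mul_div_assoc', div_le_div_iff₀ (by positivity) (by norm_num)]
    have h1 : (1 : ℝ) ≤ N * T := one_le_mul_of_one_le_of_one_le hN1 hT1
    nlinarith [mul_le_mul_of_nonneg_left h1 (show 0 ≤ 400 * P * kl by positivity)]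
  have hlagh : ∀ b : Fin N × Fin P → ℝ, ∑ n ∈ I, (b ⬝ᵥ lagVec P h n) ^ 2
      ≤ (P * (T * s)) * nsq b := by
    intro b
    calc _ ≤ ∑ n ∈ I, nsq b * nsq (lagVec P h n) :=
          Finset.sum_le_sum fun n _ => dotProduct_sq_le _ _
      _ = nsq b * ∑ n ∈ I, nsq (lagVec P h (n + (0 : ℕ))) := by rw [Finset.mul_sum]; simp
      _ ≤ nsq b * (P * (T * s)) := by
          refine mul_le_mul_of_nonneg_left ?_ (nsq_nonneg b)
          refine (sum_nsq_lagVec_Icc_le h (by omega) (by omega)).trans ?_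
          gcongr
      _ = _ := mul_comm _ _
  have hlow' : ∀ b : Fin N × Fin P → ℝ, 24 / 25 * kl * L * nsq b
      ≤ ∑ n ∈ I, (b ⬝ᵥ lagVec P z n) ^ 2 := fun b => by
    simpa only [pad_dotProduct, nsq_pad] using hlow (pad b)
  have hup' : ∀ b : Fin N × Fin P → ℝ, ∑ n ∈ I, (b ⬝ᵥ lagVec P z n) ^ 2
      ≤ 26 / 25 * ku * L * nsq b := fun b => by
    simpa only [pad_dotProduct, nsq_pad] using hup (pad b)
  have hlow2 : ∀ b, 4 / 5 * kl * T * nsq b ≤ ∑ n ∈ I, (b ⬝ᵥ lagVec P (z + h) n) ^ 2 := by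
    intro b
    -- Weighted form of `(x + y)² ≤ (1 + 1/20) x² + (1 + 20) y²`, so that most of the Gram bound
    -- survives and the small error term takes the large weight.
    have h1 : ∑ n ∈ I, (b ⬝ᵥ lagVec P z n) ^ 2 ≤ 21 / 20 * ∑ n ∈ I, (b ⬝ᵥ lagVec P (z + h) n) ^ 2
        + 21 * ∑ n ∈ I, (b ⬝ᵥ lagVec P h n) ^ 2 := by
      rw [Finset.mul_sum, Finset.mul_sum, ← Finset.sum_add_distrib]
      refine Finset.sum_le_sum fun n _ => ?_
      rw [lagVec_add, Pi.add_apply, dotProduct_add]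
      nlinarith [sq_nonneg ((b ⬝ᵥ lagVec P z n) + 21 * (b ⬝ᵥ lagVec P h n))]
    have h2 := hlow' b
    have h3 := hlagh b
    have h4 : 24 / 25 * kl * (99 / 100 * T) * nsq b ≤ 24 / 25 * kl * L * nsq b := by
      have := nsq_nonneg b; gcongr
    have h5 : (P * (T * s)) * nsq b ≤ kl / 400 * (T * nsq b) := by
      have := mul_le_mul_of_nonneg_right hPs (mul_nonneg hT0.le (nsq_nonneg b))
      linarith
    have h6 : 0 ≤ kl * (T * nsq b) := mul_nonneg hkl.le (mul_nonneg hT0.le (nsq_nonneg b))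
    linarith
  have hup2 : ∀ b, ∑ n ∈ I, (b ⬝ᵥ lagVec P (z + h) n) ^ 2 ≤ 6 / 5 * ku * T * nsq b := by
    intro b
    have h1 : ∑ n ∈ I, (b ⬝ᵥ lagVec P (z + h) n) ^ 2 ≤ 21 / 20 * ∑ n ∈ I, (b ⬝ᵥ lagVec P z n) ^ 2
        + 21 * ∑ n ∈ I, (b ⬝ᵥ lagVec P h n) ^ 2 := by
      rw [Finset.mul_sum, Finset.mul_sum, ← Finset.sum_add_distrib]
      refine Finset.sum_le_sum fun n _ => ?_
      rw [lagVec_add, Pi.add_apply, dotProduct_add]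
      nlinarith [sq_nonneg ((b ⬝ᵥ lagVec P z n) - 20 * (b ⬝ᵥ lagVec P h n))]
    have h2 := hup' b
    have h3 := hlagh b
    have h4 : 26 / 25 * ku * L * nsq b ≤ 26 / 25 * ku * T * nsq b := by
      have := nsq_nonneg b; gcongr
    have h5 : (P * (T * s)) * nsq b ≤ ku / 400 * (T * nsq b) := by
      have := mul_le_mul_of_nonneg_right (hPs.trans (show kl / 400 ≤ ku / 400 by linarith))
        (mul_nonneg hT0.le (nsq_nonneg b))
      linarith
    have h6 : 0 ≤ ku * (T * nsq b) := mul_nonneg hku.le (mul_nonneg hT0.le (nsq_nonneg b))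
    linarith
  refine ⟨hlow2, hup2, fun U hU V => ?_⟩
  rw [resid_add, lagVec_add, scoreForm_add]
  set W := ∑ j, nsq (V j) with hW
  have hW0 : 0 ≤ W := Finset.sum_nonneg fun j _ => nsq_nonneg _
  -- The residuals are bounded through the trace of the Gram matrix of `P + 1` lags, by testing with
  -- unit vectors. For this the Gram event includes lag zero.
  have henergy : ∑ n ∈ I, nsq (resid A z n) ≤ muMax A * (N * (P + 1) * (26 / 25 * ku * L)) := by
    calc _ ≤ ∑ n ∈ I, muMax A * nsq (lagVec (P + 1) z (n + 1)) :=
          Finset.sum_le_sum fun n _ => nsq_resid_le hN hP A z n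
      _ = muMax A * ∑ c, ∑ n ∈ I, lagVec (P + 1) z (n + 1) c ^ 2 := by
          rw [← Finset.mul_sum]; congr 1; exact Finset.sum_comm
      _ ≤ muMax A * ∑ _c : Fin N × Fin (P + 1), 26 / 25 * ku * L := by
          refine mul_le_mul_of_nonneg_left (Finset.sum_le_sum fun c _ => ?_) hmu
          have h1 := hup (Pi.single c 1)
          have h2 : nsq (Pi.single c 1 : Fin N × Fin (P + 1) → ℝ) = 1 := by
            rw [nsq_eq_dotProduct]; simp
          simpa [h2] using h1
      _ = _ := by simp
  have henergy' : ∑ n ∈ I, nsq (resid A h n) ≤ muMax A * ((P + 1) * (T * s)) := by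
    calc _ ≤ ∑ n ∈ I, muMax A * nsq (lagVec (P + 1) h (n + (1 : ℕ))) :=
          Finset.sum_le_sum fun n _ => nsq_resid_le hN hP A h n
      _ = muMax A * ∑ n ∈ I, nsq (lagVec (P + 1) h (n + (1 : ℕ))) := by rw [← Finset.mul_sum]
      _ ≤ muMax A * (((P + 1 : ℕ) : ℝ) * (T * s)) := by
          refine mul_le_mul_of_nonneg_left ?_ hmu
          refine (sum_nsq_lagVec_Icc_le h le_rfl le_rfl).trans ?_
          gcongr
      _ = _ := by push_cast; ring
  have h1 := hscore U hU V
  have h2 := scoreForm_le I (resid A z) (lagVec P h) hU V henergy hlagh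
  have h3 := scoreForm_le I (resid A h) (lagVec P z + lagVec P h) hU V henergy' hup2
  have hc0 : 0 ≤ 3 / 2 * ((P : ℝ) + 1) * T := by positivity
  -- The two cross terms between residuals and lags. Both fit below the same level `√(μ_max κ_U N
  -- s)`, which with `s` of order `κ_L/(PNT)` does not exceed the order of the stochastic error.
  have h4 := sqrt_mul_sqrt_le (X := muMax A * (N * (P + 1) * (26 / 25 * ku * L)))
    (Y := P * (T * s) * W) (c := 3 / 2 * (P + 1) * T) (Z := muMax A * ku * N * s * W)
    (by positivity) hc0 (by
      have e1 : muMax A * (N * (P + 1) * (26 / 25 * ku * L)) * (P * (T * s) * W)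
        = (26 / 25 * (P + 1) * P * L * T) * (muMax A * ku * N * s * W) := by ring
      rw [e1]
      refine mul_le_mul_of_nonneg_right ?_ (by positivity)
      calc 26 / 25 * ((P : ℝ) + 1) * P * L * T ≤ 26 / 25 * (P + 1) * (P + 1) * T * T := by
            gcongr; linarith
        _ ≤ _ := by nlinarith [show 0 ≤ ((P : ℝ) + 1) * (P + 1) * T * T by positivity])
  have h5 := sqrt_mul_sqrt_le (X := muMax A * ((P + 1) * (T * s)))
    (Y := 6 / 5 * ku * T * W) (c := 3 / 2 * (P + 1) * T) (Z := muMax A * ku * N * s * W)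
    (by positivity) hc0 (by
      have e1 : muMax A * ((P + 1) * (T * s)) * (6 / 5 * ku * T * W)
        = (6 / 5 * (P + 1) * 1 * T * T) * (muMax A * ku * s * W) := by ring
      have e2 : (3 / 2 * ((P : ℝ) + 1) * T) ^ 2 * (muMax A * ku * N * s * W)
        = (9 / 4 * (P + 1) * ((P + 1) * N) * T * T) * (muMax A * ku * s * W) := by ring
      rw [e1, e2]
      refine mul_le_mul_of_nonneg_right ?_ (by positivity)
      have h6 : (1 : ℝ) ≤ (P + 1) * N := one_le_mul_of_one_le_of_one_le (by linarith) hN1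
      gcongr
      all_goals norm_num)
  rw [Real.sqrt_mul (by positivity : 0 ≤ muMax A * ku * N * s)] at h4 h5
  have e3 : T * ((4 * τ / T + 3 * (P + 1) * √(muMax A * ku * N * s)) * √W)
      = 4 * τ * √W + 2 * (3 / 2 * (P + 1) * T * (√(muMax A * ku * N * s) * √W)) := by
    field_simp
  rw [e3]
  linarith

end perturbation
end
end MLRHAR

namespace MLRHAR
open scoped Matrix
noncomputable section

/-! ### Approximation of the stationary process by one started at zero -/

section zeroStart
variable {N P : ℕ} {Ω : Type*} [MeasurableSpace Ω] {Pr : Measure Ω}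

/-- The autoregression with noise `S ξ`, started at zero at time `-J`. -/
def zeroStart (A : Tensor3 N P) (S : Matrix (Fin N) (Fin N) ℝ) (ξ : ℤ → Ω → Fin N → ℝ) (J : ℕ)
    (ω : Ω) (n : ℤ) : Fin N → ℝ :=
  resp A (fun t : ℕ => S *ᵥ ξ (t - J) ω) (n + J)

variable {A : Tensor3 N P} {S : Matrix (Fin N) (Fin N) ℝ} {κ : NNReal} {ξ y : ℤ → Ω → Fin N → ℝ}

lemma measurable_zeroStart (hξ : IsSubGaussianNoise Pr κ ξ) (J : ℕ) (n : ℤ) :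
    Measurable fun ω => zeroStart A S ξ J ω n := by
  unfold zeroStart resp
  split_ifs
  · exact measurable_const
  · have h1 : Continuous fun v : Fin N × Fin P → ℝ => unfold1 A *ᵥ v :=
      Continuous.matrix_mulVec continuous_const continuous_id
    have h2 : Continuous fun v : Fin N → ℝ => S *ᵥ v :=
      Continuous.matrix_mulVec continuous_const continuous_id
    exact (h1.measurable.comp (measurable_state hξ J _)).add (h2.measurable.comp (hξ.measurable _))

lemma tendsto_nsq_impulse (hP : 1 ≤ P) (hst : ∀ z : ℂ, ‖z‖ ≤ 1 → (charPoly A z).det ≠ 0)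
    (i : Fin N) : Filter.Tendsto (fun t : ℕ => nsq ((unfold1 A * companion (unfold1 A) ^ t) i))
      Filter.atTop (nhds 0) := by
  have h1 : ∀ c, Filter.Tendsto (fun t : ℕ => (unfold1 A * companion (unfold1 A) ^ t) i c)
      Filter.atTop (nhds 0) := by
    intro c
    have h2 : ∀ t : ℕ, (unfold1 A * companion (unfold1 A) ^ t) i c
        = (unfold1 A *ᵥ (companion (unfold1 A) ^ t *ᵥ Pi.single c 1)) i := by
      intro t
      rw [Matrix.mulVec_mulVec, Matrix.mulVec_single_one]; rfl
    simp_rw [h2]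
    have h3 : Continuous fun v : Fin N × Fin P → ℝ => (unfold1 A *ᵥ v) i :=
      (continuous_apply i).comp (Continuous.matrix_mulVec continuous_const continuous_id)
    have h4 := (h3.tendsto 0).comp (tendsto_companion_pow A hP hst (Pi.single c 1))
    simpa [Function.comp_def] using h4
  have h5 : Filter.Tendsto (fun t : ℕ => ∑ c, (unfold1 A * companion (unfold1 A) ^ t) i c ^ 2)
      Filter.atTop (nhds (∑ _c : Fin N × Fin P, 0)) :=
    tendsto_finsetSum _ fun c _ => by simpa using (h1 c).pow 2
  simpa [nsq] using h5

/-- A stationary autoregression is approximated in mean square by one started at zero. -/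
lemma IsStationaryVAR.exists_zeroStart_close (hP : 1 ≤ P)
    (hst : ∀ z : ℂ, ‖z‖ ≤ 1 → (charPoly A z).det ≠ 0) (hy : IsStationaryVAR Pr A S ξ y) {ε : ℝ}
    (hε : 0 < ε) :
    ∃ J : ℕ, ∀ n : ℤ, 0 ≤ n → ∀ i, MemLp (fun ω => y n ω i - zeroStart A S ξ J ω n i) 2 Pr ∧
      ∫ ω, (y n ω i - zeroStart A S ξ J ω n i) ^ 2 ∂Pr ≤ ε := by
  set K : ℝ := ∑ c : Fin N × Fin P, ∫ ω, y 0 ω c.1 ^ 2 ∂Pr with hK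
  -- By stationarity `K` is the second moment of the state at any time, so the same `K` serves for
  -- every starting time `-J`.
  have hev : ∀ᶠ t : ℕ in Filter.atTop, ∀ i,
      nsq ((unfold1 A * companion (unfold1 A) ^ t) i) * K < ε := by
    rw [Filter.eventually_all]
    intro i
    have h1 := (tendsto_nsq_impulse hP hst i).mul_const K
    rw [zero_mul] at h1
    exact h1.eventually (gt_mem_nhds hε)
  obtain ⟨J, hJ⟩ := Filter.eventually_atTop.1 hev
  refine ⟨J, fun n hn i => ?_⟩
  obtain ⟨t, ht⟩ : ∃ t : ℕ, n + J = t := ⟨(n + J).toNat, by omega⟩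
  set R := (unfold1 A * companion (unfold1 A) ^ t) i with hR
  -- Both processes have the same noise, so their difference is the noise-free evolution of the
  -- stationary state at time `-J`, over `t = n + J ≥ J` steps.
  have hae : (fun ω => y n ω i - zeroStart A S ξ J ω n i)
      =ᵐ[Pr] fun ω => R ⬝ᵥ lagVec P (fun m => y m ω) (-J) := by
    filter_upwards [ae_all_iff.2 fun s : ℕ => hy.recursion (-J + s)] with ω hω
    set e : ℕ → Fin N → ℝ := fun s => S *ᵥ ξ (s - J) ω with he
    have hes : ∀ s : ℕ, S *ᵥ ξ (-J + s) ω = e s := fun s => by simp only [he]; congr 2; ring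
    have h1 := lagVec_eq_run A (fun m => y m ω) e (-J) (t := t) fun s _ => by rw [← hes]; exact hω s
    have h2 : y n ω = unfold1 A *ᵥ run A (lagVec P (fun m => y m ω) (-J)) e t + e t := by
      have h3 := hω t
      rw [hes, h1] at h3
      rw [← h3]; congr 1; omega
    have h4 : zeroStart A S ξ J ω n = unfold1 A *ᵥ run A 0 e t + e t := by
      rw [zeroStart, ht, resp_natCast]
    have h5 := run_add A (lagVec P (fun m => y m ω) (-J)) 0 0 e t
    rw [add_zero, zero_add, run_zero_input] at h5
    rw [h2, h4, h5, Matrix.mulVec_add, Matrix.mulVec_mulVec]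
    simp only [Pi.add_apply]
    have h6 : ((unfold1 A * companion (unfold1 A) ^ t) *ᵥ lagVec P (fun m => y m ω) (-J)) i
        = R ⬝ᵥ lagVec P (fun m => y m ω) (-J) := rfl
    rw [h6]; ring
  have hL : MemLp (fun ω => R ⬝ᵥ lagVec P (fun m => y m ω) (-J)) 2 Pr :=
    memLp_finsetSum _ fun c _ => (hy.memLp _ _).const_mul (R c)
  refine ⟨hL.ae_eq hae.symm, ?_⟩
  have hae2 : (fun ω => (y n ω i - zeroStart A S ξ J ω n i) ^ 2)
      =ᵐ[Pr] fun ω => (R ⬝ᵥ lagVec P (fun m => y m ω) (-J)) ^ 2 := by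
    filter_upwards [hae] with ω hω
    rw [hω]
  rw [integral_congr_ae hae2]
  have hlag : Integrable (fun ω => nsq (lagVec P (fun m => y m ω) (-J))) Pr :=
    integrable_finsetSum _ fun c _ => (hy.memLp _ _).integrable_sq
  have hElag : ∫ ω, nsq (lagVec P (fun m => y m ω) (-J)) ∂Pr = K := by
    unfold nsq lagVec
    rw [integral_finsetSum _ fun c _ => (hy.memLp _ _).integrable_sq]
    exact Finset.sum_congr rfl fun c _ => hy.integral_sq_eq _ _
  calc _ ≤ ∫ ω, nsq R * nsq (lagVec P (fun m => y m ω) (-J)) ∂Pr :=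
        integral_mono hL.integrable_sq (hlag.const_mul _) fun ω => dotProduct_sq_le _ _
    _ = nsq R * K := by rw [integral_const_mul, hElag]
    _ ≤ ε := (hJ t (by omega) i).le

/-- Markov's inequality for the total energy of the observation errors. -/
lemma exists_error_event [IsProbabilityMeasure Pr] {h : Ω → ℤ → Fin N → ℝ} {T : ℕ} {v s : ℝ}
    (hT : 0 < T) (hs : 0 < s) (hm : ∀ n ∈ Finset.Icc (1 : ℤ) T, ∀ i, Measurable fun ω => h ω n i)
    (hL : ∀ n ∈ Finset.Icc (1 : ℤ) T, ∀ i, MemLp (fun ω => h ω n i) 2 Pr)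
    (hv : ∀ n ∈ Finset.Icc (1 : ℤ) T, ∀ i, ∫ ω, h ω n i ^ 2 ∂Pr ≤ v) :
    ∃ B : Set Ω, MeasurableSet B ∧ Pr.real B ≤ N * v / s ∧
      ∀ ω ∉ B, ∑ n ∈ Finset.Icc (1 : ℤ) T, nsq (h ω n) ≤ T * s := by
  have hT0 : (0 : ℝ) < T := by exact_mod_cast hT
  set f : Ω → ℝ := fun ω => ∑ n ∈ Finset.Icc (1 : ℤ) T, nsq (h ω n) with hf
  have hfm : Measurable f := Finset.measurable_sum _ fun n hn =>
    Finset.measurable_sum _ fun i _ => (hm n hn i).pow_const 2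
  refine ⟨{ω | T * s ≤ f ω}, measurableSet_le measurable_const hfm, ?_, fun ω hω => ?_⟩
  · have hint : ∀ n ∈ Finset.Icc (1 : ℤ) T, Integrable (fun ω => nsq (h ω n)) Pr := fun n hn =>
      integrable_finsetSum _ fun i _ => (hL n hn i).integrable_sq
    have h1 := mul_meas_ge_le_integral_of_nonneg (μ := Pr) (f := f)
      (ae_of_all _ fun ω => Finset.sum_nonneg fun n _ => nsq_nonneg _)
      (integrable_finsetSum _ hint) (T * s)
    have h2 : ∫ ω, f ω ∂Pr ≤ T * (N * v) := by
      simp only [hf]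
      rw [integral_finsetSum _ hint]
      calc _ ≤ ∑ n ∈ Finset.Icc (1 : ℤ) T, (N * v : ℝ) := by
            refine Finset.sum_le_sum fun n hn => ?_
            unfold nsq
            rw [integral_finsetSum _ fun i _ => (hL n hn i).integrable_sq]
            calc _ ≤ ∑ _i : Fin N, v := Finset.sum_le_sum fun i _ => hv n hn i
              _ = _ := by simp
        _ = _ := by simp
    rw [le_div_iff₀ hs]
    have h3 : T * (Pr.real {ω | T * s ≤ f ω} * s) ≤ T * (N * v) := by
      refine le_trans (le_of_eq ?_) (h1.trans h2); ring
    exact le_of_mul_le_mul_left h3 hT0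
  · simp only [Set.mem_ofPred_eq, not_le] at hω
    exact hω.le

end zeroStart
end
end MLRHAR

namespace MLRHAR
open scoped Matrix
noncomputable section

/-! ### Comparison of constants and failure probabilities -/

section constants
variable {N P : ℕ}

lemma lambdaMin_le_lambdaMax (hN : 1 ≤ N) {Sig : Matrix (Fin N) (Fin N) ℝ} (hSig : Sig.IsHermitian) :
    lambdaMin Sig ≤ lambdaMax Sig := by
  have h1 := lambdaMin_mul_le Sig hSig (Pi.single ⟨0, hN⟩ 1)
  have h2 := le_lambdaMax_mul Sig hSig (Pi.single ⟨0, hN⟩ 1)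
  have h3 : ∑ i, ‖(Pi.single (⟨0, hN⟩ : Fin N) (1 : ℝ) : Fin N → ℝ) i‖ ^ 2 = 1 := by
    simp [Pi.single_apply, apply_ite]
  rw [h3, mul_one] at h1 h2
  exact h1.trans h2

lemma muMin_le_muMax (hN : 1 ≤ N) (A : Tensor3 N P) : muMin A ≤ muMax A := by
  have h1 := muMin_mul_le hN A (z := 1) norm_one (Pi.single ⟨0, hN⟩ 1)
  have h2 := le_muMax_mul hN A (z := 1) norm_one (Pi.single ⟨0, hN⟩ 1)
  have h3 : ∑ i, ‖(Pi.single (⟨0, hN⟩ : Fin N) (1 : ℂ) : Fin N → ℂ) i‖ ^ 2 = 1 := by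
    simp [Pi.single_apply, apply_ite]
  rw [h3, mul_one] at h1 h2
  exact h1.trans h2

lemma muMax_mul_kappaL_le (hN : 1 ≤ N) {A : Tensor3 N P} {Sig : Matrix (Fin N) (Fin N) ℝ}
    (hSig : Sig.IsHermitian) (hkl : 0 < kappaL A Sig) :
    0 < lambdaMax Sig ∧ muMax A * kappaL A Sig ≤ lambdaMax Sig := by
  have hmu : 0 < muMax A := (muMax_nonneg hN A).lt_of_ne fun h0 => by simp [kappaL, ← h0] at hkl
  have h1 : muMax A * kappaL A Sig = lambdaMin Sig := by rw [kappaL]; field_simp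
  have h2 := lambdaMin_le_lambdaMax hN hSig
  have h3 : 0 < muMax A * kappaL A Sig := by positivity
  exact ⟨by linarith, by linarith⟩

lemma kappaL_le_kappaU (hN : 1 ≤ N) {A : Tensor3 N P} {Sig : Matrix (Fin N) (Fin N) ℝ}
    (hSig : Sig.IsHermitian) (hmu : 0 < muMin A) (hkl : 0 < kappaL A Sig) :
    kappaL A Sig ≤ kappaU A Sig :=
  div_le_div₀ (muMax_mul_kappaL_le hN hSig hkl).1.le (lambdaMin_le_lambdaMax hN hSig) hmu
    (muMin_le_muMax hN A)

lemma five_pow_le_exp (k : ℕ) : (5 : ℝ) ^ k ≤ Real.exp (2 * k) := by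
  have h : (5 : ℝ) ≤ Real.exp 2 := by
    have h1 := Real.exp_one_gt_d9
    have h2 : Real.exp 2 = Real.exp 1 * Real.exp 1 := by rw [← Real.exp_add]; norm_num
    rw [h2]; nlinarith
  calc (5 : ℝ) ^ k ≤ Real.exp 2 ^ k := pow_le_pow_left₀ (by norm_num) h k
    _ = _ := by rw [← Real.exp_nat_mul]; ring_nf

/-- The constant in the exponent of the concentration of the Gram matrix. -/
def gramConst (P : ℕ) : ℝ := 655360000 * (P + 1) ^ 2

lemma one_le_gramConst (P : ℕ) : 1 ≤ gramConst P := by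
  unfold gramConst; nlinarith [sq_nonneg (P : ℝ), (Nat.cast_nonneg P : (0 : ℝ) ≤ P)]

/-- The prefactor is at most `exp (7 (P + 1) d)`, which the sample size makes at most `exp (T w /
(4G))` with `G = gramConst P`. As `L ≥ T/2`, half of the remaining exponent is left. -/
lemma gram_failure_le {d T L : ℕ} {w : ℝ} (hNd : N ≤ d) (hd : 1 ≤ d) (hL : (T : ℝ) / 2 ≤ L)
    (hw : 0 ≤ w) (hT : 28 * (P + 1) * gramConst P * d ≤ T * w) :
    8 * 25 ^ (N * (P + 1)) * Real.exp (-(L * w / gramConst P))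
      ≤ Real.exp (-(T * w / (4 * gramConst P))) := by
  have hG := one_le_gramConst P
  have hd1 : (1 : ℝ) ≤ d := by exact_mod_cast hd
  have hNd' : (N : ℝ) ≤ d := by exact_mod_cast hNd
  have h1 : (25 : ℝ) ^ (N * (P + 1)) ≤ Real.exp (4 * (P + 1) * d) := by
    have e : (25 : ℝ) ^ (N * (P + 1)) = 5 ^ (2 * (N * (P + 1))) := by rw [pow_mul (5 : ℝ) 2]; norm_num
    rw [e]
    refine (five_pow_le_exp _).trans (Real.exp_le_exp.2 ?_)
    push_cast
    nlinarith [mul_le_mul_of_nonneg_left hNd' (show (0 : ℝ) ≤ 4 * (P + 1) by positivity)]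
  have h2 : (8 : ℝ) ≤ Real.exp (3 * (P + 1) * d) := by
    have h3 : (8 : ℝ) ≤ Real.exp 3 := by
      have h1 := Real.exp_one_gt_d9
      have h2 : Real.exp 3 = Real.exp 1 ^ 3 := by rw [← Real.exp_nat_mul]; norm_num
      rw [h2]
      calc (8 : ℝ) = 2 ^ 3 := by norm_num
        _ ≤ _ := pow_le_pow_left₀ (by norm_num) (by linarith) 3
    refine h3.trans (Real.exp_le_exp.2 ?_)
    nlinarith [(Nat.cast_nonneg P : (0 : ℝ) ≤ P)]
  calc _ ≤ Real.exp (3 * (P + 1) * d) * Real.exp (4 * (P + 1) * d)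
        * Real.exp (-(L * w / gramConst P)) := by gcongr
    _ = Real.exp (7 * (P + 1) * d - L * w / gramConst P) := by
        rw [← Real.exp_add, ← Real.exp_add]; ring_nf
    _ ≤ _ := by
        refine Real.exp_le_exp.2 ?_
        have h4 : T / 2 * w / gramConst P ≤ L * w / gramConst P := by gcongr
        have h5 : 28 * (P + 1) * d ≤ T * w / gramConst P := by
          rw [le_div_iff₀ (by linarith)]; linarith
        have h6 : T / 2 * w / gramConst P = T * w / gramConst P / 2 := by ring
        have h7 : T * w / (4 * gramConst P) = T * w / gramConst P / 4 := by
          field_simp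
        rw [h7]
        linarith

/-- The nets for both factors have together at most `5 ^ (qN(P + 1)) ≤ exp (2 (P + 1) d)` elements.
-/
lemma score_failure_le {q d : ℕ} (hqd : q * N ≤ d) :
    2 * 5 ^ (q * N + q * (N * P)) * Real.exp (-(2 * (P + 2) * d)) ≤ 2 * Real.exp (-(2 * d : ℝ)) := by
  have hqd' : (q : ℝ) * N ≤ d := by exact_mod_cast hqd
  have h1 := five_pow_le_exp (q * N + q * (N * P))
  calc _ ≤ 2 * Real.exp (2 * ((q * N + q * (N * P) : ℕ) : ℝ)) * Real.exp (-(2 * (P + 2) * d)) := by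
        gcongr
    _ = 2 * Real.exp (2 * ((q * N + q * (N * P) : ℕ) : ℝ) + -(2 * (P + 2) * d)) := by
        rw [mul_assoc, ← Real.exp_add]
    _ ≤ _ := by
        gcongr
        push_cast
        nlinarith [mul_le_mul_of_nonneg_left hqd' (show (0 : ℝ) ≤ 2 * (P + 1) by positivity)]

/-- Multiplying the two sample-size conditions cancels `T ^ (2δ)` and leaves `m ^ (1/2) ≥ (6400
C₀/kL) T N² P e^d`, which is exactly what the Markov bound requires. -/
lemma error_failure_le (hN : 1 ≤ N) (hP : 1 ≤ P) {T m d : ℕ} {C₀ kL kl δ : ℝ} (hC₀ : 0 < C₀)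
    (hkL : 0 < kL) (hkl : kL ≤ kl) (hT : 0 < T)
    (h1 : (N : ℝ) ^ 2 * P * Real.exp d ≤ (m : ℝ) ^ (1 / 4 : ℝ) * (T : ℝ) ^ (2 * δ))
    (h2 : 6400 * C₀ / kL * (T : ℝ) ^ (1 + 2 * δ) ≤ (m : ℝ) ^ (1 / 4 : ℝ)) :
    0 < (m : ℝ) ^ (-(1 / 2) : ℝ) ∧
    N * (4 * (C₀ * (m : ℝ) ^ (-(1 / 2) : ℝ))) / (kl / (400 * P * N * T))
      ≤ 1 / 4 * Real.exp (-(d : ℝ)) := by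
  have hT0 : (0 : ℝ) < T := by exact_mod_cast hT
  have hN0 : (0 : ℝ) < N := by exact_mod_cast hN
  have hP0 : (0 : ℝ) < P := by exact_mod_cast hP
  have hkl0 : 0 < kl := hkL.trans_le hkl
  set M := (m : ℝ) ^ (1 / 4 : ℝ) with hM
  set t := (T : ℝ) ^ (2 * δ) with ht
  have ht0 : 0 < t := Real.rpow_pos_of_pos hT0 _
  rw [Real.rpow_add hT0, Real.rpow_one, ← ht] at h2
  have hM0 : 0 < M := lt_of_lt_of_le (by positivity) h2
  have hm0 : (0 : ℝ) < m := by
    rcases (Nat.cast_nonneg m : (0 : ℝ) ≤ m).eq_or_lt with h | h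
    · rw [hM, ← h, Real.zero_rpow (by norm_num)] at hM0; exact absurd hM0 (lt_irrefl _)
    · exact h
  have hM2 : (m : ℝ) ^ (-(1 / 2) : ℝ) = (M ^ 2)⁻¹ := by
    rw [Real.rpow_neg hm0.le, hM, ← Real.rpow_natCast, ← Real.rpow_mul hm0.le]; norm_num
  refine ⟨Real.rpow_pos_of_pos hm0 _, ?_⟩
  have h3 : 6400 * C₀ / kL * T * ((N : ℝ) ^ 2 * P * Real.exp d) ≤ M ^ 2 := by
    have h4 : (6400 * C₀ / kL * (T * t)) * ((N : ℝ) ^ 2 * P * Real.exp d) ≤ M * (M * t) :=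
      mul_le_mul h2 h1 (by positivity) hM0.le
    have h5 : (6400 * C₀ / kL * T * ((N : ℝ) ^ 2 * P * Real.exp d)) * t ≤ M ^ 2 * t := by
      nlinarith
    exact le_of_mul_le_mul_right h5 ht0
  rw [hM2, Real.exp_neg]
  have e1 : N * (4 * (C₀ * (M ^ 2)⁻¹)) / (kl / (400 * P * N * T))
      = 1600 * C₀ * P * (N : ℝ) ^ 2 * T / (kl * M ^ 2) := by field_simp; ring
  have e2 : 1 / 4 * (Real.exp (d : ℝ))⁻¹ = 1 / (4 * Real.exp d) := by field_simp
  rw [e1, e2, div_le_div_iff₀ (by positivity) (by positivity)]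
  have h6 : kL * (6400 * C₀ / kL * T * ((N : ℝ) ^ 2 * P * Real.exp d)) ≤ kl * M ^ 2 :=
    mul_le_mul hkl h3 (by positivity) hkl0.le
  have e3 : kL * (6400 * C₀ / kL * T * ((N : ℝ) ^ 2 * P * Real.exp d))
      = 6400 * C₀ * T * ((N : ℝ) ^ 2 * P * Real.exp d) := by field_simp
  rw [e3] at h6
  nlinarith

/-- The statistical error is dominated by the first term of `statError`. -/
lemma noise_level_le {d T : ℕ} (hP : 1 ≤ P) (hN : 1 ≤ N) (hT : 0 < T) (hd : 1 ≤ d)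
    {κ mu kl ku lmax : ℝ} (hκ : 0 ≤ κ) (hκ2 : 1 / 2 ≤ κ ^ 2) (hku : 0 < ku)
    (hkl : 0 < kl) (hlmax : 0 ≤ lmax) (hmul : mu * kl ≤ lmax) :
    4 * (√(8 * (P + 2)) * κ * √(lmax * ku) * √(T * d)) / T
        + 3 * (P + 1) * √(mu * ku * N * (kl / (400 * P * N * T)))
      ≤ 70 * (P + 2) * (κ ^ 2 * √(lmax * ku) * √((d : ℝ) / T)) := by
  have hT0 : (0 : ℝ) < T := by exact_mod_cast hT
  have hN0 : (0 : ℝ) < N := by exact_mod_cast hN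
  have hP0 : (1 : ℝ) ≤ P := by exact_mod_cast hP
  have hd1 : (1 : ℝ) ≤ d := by exact_mod_cast hd
  -- Here `κ² ≥ 1/2` absorbs the first power of `κ`, and later pure constants, into `κ²`.
  have hκ3 : κ ≤ 2 * κ ^ 2 := by nlinarith [sq_nonneg (κ - 1 / 2)]
  have h1 : √((T : ℝ) * d) / T = √((d : ℝ) / T) := by
    rw [Real.sqrt_mul hT0.le, Real.sqrt_div (by positivity)]
    have h2 : (T : ℝ) = √T * √T := (Real.mul_self_sqrt hT0.le).symm
    have h3 : 0 < √(T : ℝ) := Real.sqrt_pos.2 hT0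
    rw [div_eq_div_iff hT0.ne' h3.ne']
    nth_rewrite 3 [h2]
    ring
  have h4 : √(8 * ((P : ℝ) + 2)) ≤ 8 * (P + 2) := by
    rw [Real.sqrt_le_left (by positivity)]
    nlinarith
  have h5 : √(mu * ku * N * (kl / (400 * P * N * T))) ≤ √(lmax * ku) * √((d : ℝ) / T) := by
    rw [← Real.sqrt_mul (by positivity)]
    refine Real.sqrt_le_sqrt ?_
    have e : mu * ku * N * (kl / (400 * P * N * T)) = (mu * kl) * ku / (400 * P * T) := by
      field_simp
    have e2 : lmax * ku * ((d : ℝ) / T) = lmax * ku * d / T := by ring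
    rw [e, e2, div_le_div_iff₀ (by positivity) hT0]
    have h6 : mu * kl * ku ≤ lmax * ku := mul_le_mul_of_nonneg_right hmul hku.le
    have h7 : lmax * ku * 1 ≤ lmax * ku * (d * (400 * P)) := by
      refine mul_le_mul_of_nonneg_left ?_ (by positivity)
      nlinarith
    nlinarith
  set X := √(lmax * ku) * √((d : ℝ) / T) with hX
  have hX0 : 0 ≤ X := by positivity
  have e3 : 4 * (√(8 * (P + 2)) * κ * √(lmax * ku) * √(T * d)) / T
      = 4 * (√(8 * (P + 2)) * κ * X) := by
    rw [hX, ← h1]; ring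
  have e4 : κ ^ 2 * √(lmax * ku) * √((d : ℝ) / T) = κ ^ 2 * X := by rw [hX]; ring
  rw [e3, e4]
  have h8 : √(8 * ((P : ℝ) + 2)) * κ * X ≤ 8 * (P + 2) * (2 * κ ^ 2) * X := by gcongr
  have h9 : √(mu * ku * N * (kl / (400 * P * N * T))) ≤ 2 * κ ^ 2 * X :=
    h5.trans (by nlinarith)
  have h10 : 3 * ((P : ℝ) + 1) * √(mu * ku * N * (kl / (400 * P * N * T)))
      ≤ 3 * (P + 1) * (2 * κ ^ 2 * X) := by gcongr
  have h11 : 0 ≤ κ ^ 2 * X := by positivity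
  nlinarith

/-- Both exponents are only weakened: `1/(4G) ≤ 1` and the minimum is at most `κ⁻⁴`. -/
lemma failure_le {d T x κ G p : ℝ} (hG : 1 ≤ G) (hd : 0 ≤ d) (hT : 0 ≤ T)
    (hp : p ≤ Real.exp (-d) + Real.exp (-(T * (x ^ 2 / κ ^ 4) / (4 * G)))) :
    p ≤ Real.exp (-(1 / (4 * G) * d))
      + 2 * Real.exp (-(1 / (4 * G) * T * x ^ 2 * min ((κ ^ 2)⁻¹) ((κ ^ 4)⁻¹))) := by
  have hG0 : 0 < G := by linarith
  have h1 : Real.exp (-d) ≤ Real.exp (-(1 / (4 * G) * d)) := by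
    refine Real.exp_le_exp.2 (neg_le_neg ?_)
    refine mul_le_of_le_one_left hd ?_
    rw [div_le_one (by positivity)]
    linarith
  have h2 : Real.exp (-(T * (x ^ 2 / κ ^ 4) / (4 * G)))
      ≤ Real.exp (-(1 / (4 * G) * T * x ^ 2 * min ((κ ^ 2)⁻¹) ((κ ^ 4)⁻¹))) := by
    refine Real.exp_le_exp.2 (neg_le_neg ?_)
    calc _ ≤ 1 / (4 * G) * T * x ^ 2 * (κ ^ 4)⁻¹ := by
          gcongr
          exact min_le_right _ _
      _ = _ := by ring
  have h3 := Real.exp_pos (-(1 / (4 * G) * T * x ^ 2 * min ((κ ^ 2)⁻¹) ((κ ^ 4)⁻¹)))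
  linarith

/-- The first term of `statError`. -/
lemma le_statError (A : Tensor3 N P) (Sig : Matrix (Fin N) (Fin N) ℝ) {κ : ℝ} (hκ : 0 ≤ κ) (δ : ℝ)
    (d T m : ℕ) :
    κ ^ 2 * √(lambdaMax Sig * kappaU A Sig) * √((d : ℝ) / T) ≤ statError A Sig κ δ d T m := by
  have h1 : 0 ≤ κ * √(kappaU A Sig) * √((d : ℝ) / T) := by positivity
  have h2 : 0 ≤ (T : ℝ) ^ (1 + 2 * δ) / (m : ℝ) ^ (1 / 4 : ℝ) := by positivity
  unfold statError
  linarith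

end constants

/-! ### Vanishing ranks in the first mode -/

section degenerate
variable {N P : ℕ}

lemma eq_zero_of_norm_cols_le {a b : Type*} [Fintype a] [Fintype b] {X : Matrix a b ℝ} (h : ‖cols X‖ ≤ 0) :
    X = 0 := by
  have h1 : cols X = 0 := norm_le_zero_iff.1 h
  ext i c
  have h2 := congrFun (congrArg (fun w : PiLp 2 fun _ : b => EuclideanSpace ℝ a => w.ofLp) h1) c
  simpa [cols_apply] using congrFun (congrArg (fun w : EuclideanSpace ℝ a => w.ofLp) h2) i

/-- Near-contractivity with target zero, rank zero and `β = 0`. -/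
lemma IsTruncatedSVD.eq_zero {a b : Type*} [Fintype a] [Fintype b] {q : ℕ} {B : Matrix a b ℝ}
    (h : IsTruncatedSVD q 0 B) : B = 0 := by
  obtain ⟨W, -, hW⟩ := h.norm_sub_le (A := 0) (r := 0) (by simp) le_rfl (by simp)
  refine eq_zero_of_norm_cols_le ?_
  rw [sub_zero, sub_zero] at hW
  refine hW.trans ?_
  have h0 : ‖cols (0 : Matrix a b ℝ)‖ = 0 := by
    have := norm_cols_sq (0 : Matrix a b ℝ); simpa using this
  have := norm_projCols_le W (cols (0 : Matrix a b ℝ))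
  rw [h0] at this
  linarith [norm_nonneg (projCols W (cols (0 : Matrix a b ℝ)))]

lemma unfold1_eq_zero {B : Tensor3 N P} (h : unfold1 B = 0) : B = 0 := by
  ext ⟨i, j, k⟩; exact congrFun (congrFun h i) (j, k)

lemma unfold2_eq_zero {B : Tensor3 N P} (h : unfold2 B = 0) : B = 0 := by
  ext ⟨i, j, k⟩; exact congrFun (congrFun h j) (i, k)

lemma unfold3_eq_zero {B : Tensor3 N P} (h : unfold3 B = 0) : B = 0 := by
  ext ⟨i, j, k⟩; exact congrFun (congrFun h k) (i, j)

/-- With running rank zero in the first mode, every iterate vanishes. -/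
lemma IsPGDStep.eq_zero {L : Tensor3 N P → ℝ} {τ : ℝ} {q : Fin 3 → ℕ} {B B' : Tensor3 N P}
    (h : IsPGDStep L τ q B B') (hq : q 0 = 0) : B' = 0 := by
  obtain ⟨B₁, B₂, h1, h2, h3⟩ := h
  have e1 : B₁ = 0 := by
    obtain ⟨l, s, u, v, -, -, -, -, -, hB⟩ := h1
    refine unfold1_eq_zero (hB.trans ?_)
    simp [hq]
  have e2 : B₂ = 0 := unfold2_eq_zero (IsTruncatedSVD.eq_zero (q := q 1) (by
    have : unfold2 B₁ = 0 := by rw [e1]; rfl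
    rwa [this] at h2))
  exact unfold3_eq_zero (IsTruncatedSVD.eq_zero (q := q 2) (by
    have : unfold3 B₂ = 0 := by rw [e2]; rfl
    rwa [this] at h3))

lemma eq_zero_of_rank_unfold1 {A : Tensor3 N P} (h : (unfold1 A).rank = 0) : A = 0 := by
  rw [Matrix.rank, Submodule.finrank_eq_zero, LinearMap.range_eq_bot] at h
  refine unfold1_eq_zero ?_
  ext i c
  have h1 := congrFun (LinearMap.congr_fun h (Pi.single c 1)) i
  simpa using h1

/-- If the first Tucker ranks vanish, then the target and the iterates are zero. -/
lemma pgd_rank_zero {A : Tensor3 N P} {B : ℕ → Tensor3 N P} {r r' : Fin 3 → ℕ}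
    {L : Tensor3 N P → ℝ} {τ θ e : ℝ} (hA : A ∈ tuckerSet N P r) (hq : r 0 + r' 0 = 0)
    (hstep : ∀ k, IsPGDStep L τ r' (B k) (B (k + 1))) (hθ : 0 ≤ θ) (he : 0 ≤ e) (K : ℕ) :
    ‖B K - A‖ ≤ θ ^ K * ‖B 0 - A‖ + e := by
  have hA0 : A = 0 := eq_zero_of_rank_unfold1 (Nat.le_zero.1 (hA.1.trans (by omega)))
  rcases K with _ | K
  · rw [pow_zero, one_mul]; linarith
  · rw [(hstep K).eq_zero (by omega), hA0, sub_zero, norm_zero]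
    positivity

end degenerate
end
end MLRHAR

namespace MLRHAR
open scoped Matrix
noncomputable section

/-! ### The good event and the theorem -/

section main
variable {N P : ℕ} {Ω : Type*}

lemma sum_Icc_eq_sum_range {T L : ℕ} (hLT : L + P = T) (f : ℤ → ℝ) :
    ∑ n ∈ Finset.Icc ((P : ℤ) + 1) (T : ℤ), f n = ∑ k ∈ Finset.range L, f ((P : ℤ) + 1 + k) := by
  refine Finset.sum_nbij' (fun n => (n - (P + 1)).toNat) (fun k => (P : ℤ) + 1 + k) ?_ ?_ ?_ ?_ ?_
  · intro n hn; rw [Finset.mem_Icc] at hn; rw [Finset.mem_range]; omega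
  · intro k hk; rw [Finset.mem_range] at hk; rw [Finset.mem_Icc]; omega
  · intro n hn; rw [Finset.mem_Icc] at hn; omega
  · intro k _; omega
  · intro n hn
    rw [Finset.mem_Icc] at hn
    congr 1; omega

lemma lagVec_zeroStart (A : Tensor3 N P) (S : Matrix (Fin N) (Fin N) ℝ) (ξ : ℤ → Ω → Fin N → ℝ)
    (J p : ℕ) (ω : Ω) (n : ℤ) : lagVec p (zeroStart A S ξ J ω) n
      = lagVec p (resp A fun t : ℕ => S *ᵥ ξ (t - J) ω) (n + J) := by
  ext c
  have e : n - 1 - (c.2.val : ℤ) + J = n + J - 1 - c.2.val := by ring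
  simp only [lagVec, zeroStart, e]

lemma resid_zeroStart (A : Tensor3 N P) (S : Matrix (Fin N) (Fin N) ℝ) (ξ : ℤ → Ω → Fin N → ℝ)
    (J : ℕ) (ω : Ω) {n : ℤ} {t : ℕ} (hn : n + J = t) :
    resid A (zeroStart A S ξ J ω) n = S *ᵥ ξ n ω := by
  have h := resid_resp A (fun t : ℕ => S *ᵥ ξ (t - J) ω) t
  rw [resid, lagVec_zeroStart, hn, zeroStart, hn]
  rw [resid] at h
  rw [h]; congr 2; omega

variable [MeasurableSpace Ω] {Pr : Measure Ω}

lemma real_le_of_le_ofReal {B : Set Ω} {x : ℝ} (hx : 0 ≤ x) (h : Pr B ≤ ENNReal.ofReal x) :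
    Pr.real B ≤ x := ENNReal.toReal_le_of_le_ofReal hx h

lemma two_mul_exp_neg_le {d : ℝ} (hd : 1 ≤ d) :
    2 * Real.exp (-(2 * d)) ≤ 3 / 4 * Real.exp (-d) := by
  have h1 : Real.exp (-(2 * d)) = Real.exp (-d) * Real.exp (-d) := by
    rw [← Real.exp_add]; ring_nf
  have h2 : Real.exp (-d) ≤ 3 / 8 := by
    refine (Real.exp_le_exp.2 (neg_le_neg hd)).trans ?_
    have := Real.exp_neg_one_lt_d9
    linarith
  rw [h1]
  nlinarith [Real.exp_pos (-d)]

/-- The observations are close to the autoregression started at zero in the distant past. -/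
lemma exists_observation_event [IsProbabilityMeasure Pr] (hP : 1 ≤ P) {T : ℕ}
    {A : Tensor3 N P} (hst : ∀ z : ℂ, ‖z‖ ≤ 1 → (charPoly A z).det ≠ 0)
    {S : Matrix (Fin N) (Fin N) ℝ} {κ : NNReal} {ξ y η : ℤ → Ω → Fin N → ℝ}
    (hξ : IsSubGaussianNoise Pr κ ξ) (hy : IsStationaryVAR Pr A S ξ y) {v s : ℝ} (hv : 0 < v)
    (hη : ∀ n ∈ Finset.Icc (1 : ℤ) (T : ℤ), Measurable (η n) ∧ ∀ i,
      MemLp (fun ω => η n ω i) 2 Pr ∧ ∫ ω, |η n ω i| ^ 2 ∂Pr ≤ v)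
    (hT0 : 0 < T) (hs0 : 0 < s) :
    ∃ (J : ℕ) (B : Set Ω), MeasurableSet B ∧ Pr.real B ≤ N * (4 * v) / s ∧
      ∀ ω ∉ B, ∑ n ∈ Finset.Icc (1 : ℤ) T,
        nsq (fun i => y n ω i + η n ω i - zeroStart A S ξ J ω n i) ≤ T * s := by
  obtain ⟨J, hJ⟩ := hy.exists_zeroStart_close hP hst hv
  refine ⟨J, ?_⟩
  set h : Ω → ℤ → Fin N → ℝ := fun ω n i => y n ω i + η n ω i - zeroStart A S ξ J ω n i with hh
  have hhm : ∀ n ∈ Finset.Icc (1 : ℤ) T, ∀ i, Measurable fun ω => h ω n i := by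
    intro n hn i
    exact (((measurable_pi_apply i).comp (hy.measurable n)).add
      ((measurable_pi_apply i).comp (hη n hn).1)).sub
      ((measurable_pi_apply i).comp (measurable_zeroStart hξ J n))
  have hhe : ∀ n i, (fun ω => h ω n i)
      = (fun ω => y n ω i - zeroStart A S ξ J ω n i) + fun ω => η n ω i := by
    intro n i; ext ω; simp only [hh, Pi.add_apply]; ring
  have hhL : ∀ n ∈ Finset.Icc (1 : ℤ) T, ∀ i, MemLp (fun ω => h ω n i) 2 Pr := by
    intro n hn i
    rw [hhe]
    exact (hJ n (by rw [Finset.mem_Icc] at hn; omega) i).1.add ((hη n hn).2 i).1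
  have hhv : ∀ n ∈ Finset.Icc (1 : ℤ) T, ∀ i,
      ∫ ω, h ω n i ^ 2 ∂Pr ≤ 4 * v := by
    intro n hn i
    obtain ⟨ha1, ha2⟩ := hJ n (by rw [Finset.mem_Icc] at hn; omega) i
    obtain ⟨hb1, hb2⟩ := (hη n hn).2 i
    simp only [sq_abs] at hb2
    have e1 : ∫ ω, h ω n i ^ 2 ∂Pr ≤ ∫ ω, (2 * (y n ω i - zeroStart A S ξ J ω n i) ^ 2
        + 2 * η n ω i ^ 2) ∂Pr := by
      refine integral_mono (hhL n hn i).integrable_sq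
        ((ha1.integrable_sq.const_mul 2).add (hb1.integrable_sq.const_mul 2)) fun ω => ?_
      have := congrFun (hhe n i) ω
      simp only [Pi.add_apply] at this
      simp only [this]
      nlinarith [sq_nonneg (y n ω i - zeroStart A S ξ J ω n i - η n ω i)]
    rw [integral_add (ha1.integrable_sq.const_mul 2) (hb1.integrable_sq.const_mul 2),
      integral_const_mul, integral_const_mul] at e1
    linarith
  exact exists_error_event hT0 hs0 hhm hhL hhv

set_option maxHeartbeats 400000 in
/-- With high probability, the observations satisfy the restricted eigenvalue and score bounds. -/
theorem exists_good_event [IsProbabilityMeasure Pr] (hN : 1 ≤ N) (hP : 1 ≤ P) {T m d q : ℕ}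
    {A : Tensor3 N P} (hst : ∀ z : ℂ, ‖z‖ ≤ 1 → (charPoly A z).det ≠ 0)
    {Sig S : Matrix (Fin N) (Fin N) ℝ} (hSig : Sig.PosDef) (hS : S.IsHermitian) (hSS : S * S = Sig)
    {κ : NNReal} {ξ y η : ℤ → Ω → Fin N → ℝ} (hξ : IsSubGaussianNoise Pr κ ξ)
    (hy : IsStationaryVAR Pr A S ξ y) {C₀ kL δ : ℝ} (hC₀ : 0 < C₀)
    (hη : IsSmallEstimationError Pr C₀ m T η) (hkL : 0 < kL) (hkl : kL ≤ kappaL A Sig)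
    (hq : 1 ≤ q) (hqd : q * N ≤ d)
    (hT : 28 * (P + 1) * gramConst P * ((κ : ℝ) ^ 4 * (kappaU A Sig / kappaL A Sig) ^ 2 * d) ≤ T)
    (h1 : (N : ℝ) ^ 2 * P * Real.exp d ≤ (m : ℝ) ^ (1 / 4 : ℝ) * (T : ℝ) ^ (2 * δ))
    (h2 : 6400 * C₀ / kL * (T : ℝ) ^ (1 + 2 * δ) ≤ (m : ℝ) ^ (1 / 4 : ℝ)) :
    0 < T ∧ ∃ B : Set Ω, MeasurableSet B ∧
      Pr.real B ≤ Real.exp (-(d : ℝ)) + Real.exp (-(T * ((kappaL A Sig / kappaU A Sig) ^ 2 / κ ^ 4)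
        / (4 * gramConst P))) ∧
      ∀ ω ∉ B,
        (∀ b, 4 / 5 * kappaL A Sig * T * nsq b ≤ ∑ n ∈ Finset.Icc ((P : ℤ) + 1) (T : ℤ),
          (b ⬝ᵥ lagVec P (fun n i => y n ω i + η n ω i) n) ^ 2) ∧
        (∀ b, ∑ n ∈ Finset.Icc ((P : ℤ) + 1) (T : ℤ),
          (b ⬝ᵥ lagVec P (fun n i => y n ω i + η n ω i) n) ^ 2 ≤ 6 / 5 * kappaU A Sig * T * nsq b) ∧
        ∀ U : EuclideanSpace ℝ (Fin q) →L[ℝ] EuclideanSpace ℝ (Fin N), ‖U‖ ≤ 1 →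
          ∀ V, scoreForm (Finset.Icc ((P : ℤ) + 1) (T : ℤ))
              (resid A fun n i => y n ω i + η n ω i) (lagVec P fun n i => y n ω i + η n ω i) U V
            ≤ T * (70 * (P + 2) * (κ ^ 2 * √(lambdaMax Sig * kappaU A Sig) * √((d : ℝ) / T))
              * √(∑ j, nsq (V j))) := by
  have hmin : 0 < muMin A := muMin_pos hN A fun z => hst z (Circle.norm_coe z).le
  have hkl0 : 0 < kappaL A Sig := hkL.trans_le hkl
  obtain ⟨hlmax, hmul⟩ := muMax_mul_kappaL_le hN hSig.1 hkl0
  have hklu := kappaL_le_kappaU hN hSig.1 hmin hkl0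
  set kl := kappaL A Sig with hkld
  set ku := kappaU A Sig with hkud
  set lmax := lambdaMax Sig with hlmaxd
  have hku : 0 < ku := hkl0.trans_le hklu
  have hκ2 := hξ.half_le hN
  have hκ0 : (0 : ℝ) < κ := by
    rcases κ.coe_nonneg.eq_or_lt with h | h
    · rw [← h] at hκ2; norm_num at hκ2
    · exact h
  have hκ4 : (1 / 4 : ℝ) ≤ κ ^ 4 := by nlinarith
  have hNd : N ≤ d := le_trans (Nat.le_mul_of_pos_left N hq) hqd
  have hd : 1 ≤ d := hN.trans hNd
  have hd1 : (1 : ℝ) ≤ d := by exact_mod_cast hd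
  have hG := one_le_gramConst P
  have hP1 : (1 : ℝ) ≤ P := by exact_mod_cast hP
  have hN1 : (1 : ℝ) ≤ N := by exact_mod_cast hN
  -- sample size
  have hx1 : 1 ≤ (ku / kl) ^ 2 := one_le_pow₀ ((one_le_div hkl0).2 hklu)
  have hT100' : 100 * (P : ℝ) ≤ T := by
    refine le_trans ?_ hT
    have e1 : (1 / 4 : ℝ) * 1 * 1 ≤ κ ^ 4 * (ku / kl) ^ 2 * d := by gcongr
    have e2 : (655360000 : ℝ) ≤ gramConst P := by
      unfold gramConst; nlinarith
    calc 100 * (P : ℝ) ≤ 28 * (P + 1) * 655360000 * (1 / 4 * 1 * 1) := by nlinarith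
      _ ≤ _ := by gcongr
  have hT100 : 100 * P ≤ T := by exact_mod_cast hT100'
  have hT0 : 0 < T := by omega
  have hT0' : (0 : ℝ) < T := by exact_mod_cast hT0
  refine ⟨hT0, ?_⟩
  obtain ⟨L, hLT⟩ : ∃ L, L + P = T := ⟨T - P, by omega⟩
  have hL : (L : ℝ) = T - P := by
    have : ((L + P : ℕ) : ℝ) = T := by rw [hLT]
    push_cast at this; linarith
  have hLhalf : (T : ℝ) / 2 ≤ L := by rw [hL]; linarith
  -- zero start and observation error
  obtain ⟨hm0, herrp⟩ := error_failure_le hN hP hC₀ hkL hkl hT0 h1 h2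
  set s : ℝ := kl / (400 * P * N * T) with hs
  have hs0 : 0 < s := by positivity
  obtain ⟨J, B₃, hB₃m, hB₃p, hB₃⟩ := exists_observation_event hP hst hξ hy (mul_pos hC₀ hm0) hη
    hT0 hs0
  replace hB₃p := hB₃p.trans herrp
  -- Gram matrix
  obtain ⟨B₁, hB₁m, hB₁p, hB₁⟩ := exists_gram_event hN hP hst hS hSS hSig hkl0 hklu hξ (J : ℤ)
    (a := J + P + 1) L (by omega)
  set w : ℝ := (kl / ku) ^ 2 / κ ^ 4 with hw
  have hw0 : 0 ≤ w := by positivity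
  replace hB₁p : Pr.real B₁ ≤ Real.exp (-(T * w / (4 * gramConst P))) := by
    refine le_trans (real_le_of_le_ofReal (x := 8 * 25 ^ (N * (P + 1))
      * Real.exp (-(L * w / gramConst P))) (by positivity) (hB₁p.trans (le_of_eq ?_)))
      (gram_failure_le hNd hd hLhalf hw0 ?_)
    · rw [ENNReal.ofReal_mul (by positivity), ENNReal.ofReal_mul (by norm_num),
        ENNReal.ofReal_pow (by norm_num), eexp]
      have e : L * w / gramConst P
          = L * (kl / ku) ^ 2 / (655360000 * (P + 1) ^ 2 * κ ^ 4) := by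
        rw [hw, gramConst]; field_simp
      rw [e, hkld, hkud]
      norm_num
    · have e : (κ : ℝ) ^ 4 * (ku / kl) ^ 2 * w = 1 := by rw [hw]; field_simp
      calc 28 * (P + 1) * gramConst P * d
          = 28 * (P + 1) * gramConst P * (κ ^ 4 * (ku / kl) ^ 2 * d) * w := by
            linear_combination -(28 * (P + 1) * gramConst P * d) * e
        _ ≤ T * w := by gcongr
  -- score
  set τ : ℝ := √(8 * (P + 2)) * κ * √(lmax * ku) * √(T * d) with hτ
  obtain ⟨B₂, hB₂m, hB₂p, hB₂⟩ := exists_score_event (A := A) q hS hξ (J : ℤ) (J + P + 1) L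
    (lmax := lmax) (Q := 2 * ku * T) (τ := τ) hκ0 hlmax (by positivity) (by positivity)
    (nsq_mulVec_le_lambdaMax hS hSS hSig.1)
  replace hB₂p : Pr.real B₂ ≤ 2 * Real.exp (-(2 * d : ℝ)) := by
    refine le_trans (real_le_of_le_ofReal (x := 2 * 5 ^ (q * N + q * (N * P))
      * Real.exp (-(2 * (P + 2) * d))) (by positivity) (hB₂p.trans (le_of_eq ?_)))
      (score_failure_le hqd)
    rw [ENNReal.ofReal_mul (by positivity), ENNReal.ofReal_mul (by norm_num),
      ENNReal.ofReal_pow (by norm_num), eexp]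
    have e : τ ^ 2 / (2 * κ ^ 2 * (lmax * (2 * ku * T))) = 2 * (P + 2) * d := by
      have e1 : τ ^ 2 = 8 * (P + 2) * κ ^ 2 * (lmax * ku) * (T * d) := by
        rw [hτ, mul_pow, mul_pow, mul_pow, Real.sq_sqrt (by positivity),
          Real.sq_sqrt (by positivity), Real.sq_sqrt (by positivity)]
      rw [e1]; field_simp; ring
    rw [e]
    norm_num
  -- The score contributes at most `3/4 e^(-d)` and the observation errors at most `1/4 e^(-d)`.
  refine ⟨B₁ ∪ B₂ ∪ B₃, (hB₁m.union hB₂m).union hB₃m, ?_, ?_⟩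
  · have e1 := measureReal_union_le (μ := Pr) (B₁ ∪ B₂) B₃
    have e2 := measureReal_union_le (μ := Pr) B₁ B₂
    have e3 := two_mul_exp_neg_le hd1
    linarith
  · intro ω hω
    simp only [Set.mem_union, not_or] at hω
    obtain ⟨⟨hω1, hω2⟩, hω3⟩ := hω
    set z : ℤ → Fin N → ℝ := zeroStart A S ξ J ω with hz
    set h : ℤ → Fin N → ℝ := fun n i => y n ω i + η n ω i - z n i with hh
    have hgram := hB₁ ω hω1
    have hsum : ∀ u : Fin N × Fin (P + 1) → ℝ,
        ∑ n ∈ Finset.Icc ((P : ℤ) + 1) (T : ℤ), (u ⬝ᵥ lagVec (P + 1) z (n + 1)) ^ 2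
        = ∑ k ∈ Finset.range L, (u ⬝ᵥ lagVec (P + 1) (resp A fun t => S *ᵥ ξ (t - J) ω)
          ((J + P + 1 + k + 1 : ℕ) : ℤ)) ^ 2 := by
      intro u
      rw [sum_Icc_eq_sum_range hLT]
      refine Finset.sum_congr rfl fun k _ => ?_
      rw [hz, lagVec_zeroStart]
      congr 3; push_cast; ring
    have hquad : ∀ b : Fin N × Fin P → ℝ, ∑ k ∈ Finset.range L,
        (b ⬝ᵥ run A 0 (fun t : ℕ => S *ᵥ ξ (t - J) ω) (J + P + 1 + k)) ^ 2
          ≤ 2 * ku * T * nsq b := by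
      intro b
      have e1 := (hgram (pad b)).2
      rw [nsq_pad] at e1
      have e2 : ∀ k : ℕ, pad b ⬝ᵥ lagVec (P + 1) (resp A fun t : ℕ => S *ᵥ ξ (t - J) ω)
          ((J + P + 1 + k + 1 : ℕ) : ℤ)
          = b ⬝ᵥ run A 0 (fun t : ℕ => S *ᵥ ξ (t - J) ω) (J + P + 1 + k) := by
        intro k
        rw [Nat.cast_succ, pad_dotProduct, lagVec_resp]
      simp only [e2] at e1
      refine e1.trans (mul_le_mul_of_nonneg_right ?_ (nsq_nonneg b))
      have hLT' : (L : ℝ) ≤ T := by exact_mod_cast (by omega : L ≤ T)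
      gcongr
      norm_num
    have hscore := hB₂ ω hω2 hquad
    have hdec : (fun n i => y n ω i + η n ω i) = z + h := by
      ext n i; simp only [hh, Pi.add_apply]; ring
    rw [hdec]
    obtain ⟨c1, c2, c3⟩ := conditions_of_perturbation hN hP hLT hT100 hkl0 hklu hs (A := A)
      (z := z) (h := h) (τ := τ) (q := q) (fun u => by rw [hsum]; exact (hgram u).1)
      (fun u => by rw [hsum]; exact (hgram u).2) (hB₃ ω hω3) (by
        intro U hU V
        rw [scoreForm_eq, sum_Icc_eq_sum_range hLT]
        have e1 := (le_abs_self _).trans (hscore U V)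
        have e2 : 4 * τ * ‖U‖ * √(∑ j, nsq (V j)) ≤ 4 * τ * √(∑ j, nsq (V j)) := by
          refine mul_le_mul_of_nonneg_right ?_ (Real.sqrt_nonneg _)
          exact mul_le_of_le_one_right (by positivity) hU
        refine le_trans (le_of_eq ?_) (e1.trans e2)
        refine Finset.sum_congr rfl fun k _ => ?_
        have e3 : (P : ℤ) + 1 + k + J = ((J + P + 1 + k : ℕ) : ℤ) := by push_cast; ring
        rw [hz, resid_zeroStart A S ξ J ω e3, lagVec_zeroStart, e3, lagVec_resp]
        congr 3
        push_cast; ring)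
    refine ⟨c1, c2, fun U hU V => (c3 U hU V).trans ?_⟩
    have e4 := noise_level_le hP hN hT0 hd κ.coe_nonneg hκ2 hku hkl0 hlmax.le hmul
    gcongr

end main
end
end MLRHAR

theorem theorem3 (P : ℕ) (hP : 1 ≤ P) :
    ∃ c₁ C c : ℝ, 0 < c₁ ∧ 0 < C ∧ 0 < c ∧
    ∀ C₀ kL : ℝ, 0 < C₀ → 0 < kL →
    ∃ c₂ c₃ : ℝ, 0 < c₂ ∧ 0 < c₃ ∧
    ∀ (Ω : Type*) [MeasurableSpace Ω] (Pr : Measure Ω) [IsProbabilityMeasure Pr]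
      (N T m : ℕ) (r r' : Fin 3 → ℕ) (κ : NNReal) (δ : ℝ)
      (A : MLRHAR.Tensor3 N P) (Sig S : Matrix (Fin N) (Fin N) ℝ)
      (ξ y η : ℤ → Ω → Fin N → ℝ),
    1 ≤ N → 0 < δ →
    -- the coefficient tensor has low Tucker ranks, and the autoregression is stable
    A ∈ MLRHAR.tuckerSet N P r →
    (∀ z : ℂ, ‖z‖ < 1 → (MLRHAR.charPoly A z).det ≠ 0) →
    -- the innovations are `Σ^{1/2} ξ_n` with `Σ` positive definite and `S = Σ^{1/2}`
    Sig.PosDef → S.PosSemidef → S * S = Sig →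
    MLRHAR.IsSubGaussianNoise Pr κ ξ →
    MLRHAR.IsStationaryVAR Pr A S ξ y →
    -- the data are `y_n + η_n`
    MLRHAR.IsSmallEstimationError Pr C₀ m T η →
    IndepFun (fun ω n => S.mulVec (ξ n ω))
      (fun ω (n : Finset.Icc (1 : ℤ) (T : ℤ)) => η n ω) Pr →
    kL ≤ MLRHAR.kappaL A Sig →
    -- running ranks
    (∀ i, ((1 + MLRHAR.kappaL A Sig / (24 * MLRHAR.kappaU A Sig)) ^ (1 / 3 : ℝ) - 1) ^ (-2 : ℤ)
      * (r i : ℝ) ≤ (r' i : ℝ)) →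
    -- sample sizes
    c₁ * (max ((κ : ℝ) ^ 2) ((κ : ℝ) ^ 4) * (MLRHAR.kappaU A Sig / MLRHAR.kappaL A Sig) ^ 2
      * (MLRHAR.tuckerDim N P (r + r') : ℝ)) ≤ (T : ℝ) →
    c₂ * ((N : ℝ) ^ 2 * P * Real.exp (MLRHAR.tuckerDim N P (r + r') : ℝ))
      ≤ (m : ℝ) ^ (1 / 4 : ℝ) * (T : ℝ) ^ (2 * δ) →
    c₃ * (T : ℝ) ^ (1 + 2 * δ) ≤ (m : ℝ) ^ (1 / 4 : ℝ) →
    -- the contraction factor is that of a linear rate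
    (0 < 1 - MLRHAR.kappaL A Sig / (24 * MLRHAR.kappaU A Sig) ∧
      1 - MLRHAR.kappaL A Sig / (24 * MLRHAR.kappaU A Sig) < 1) ∧
    -- every run of the algorithm satisfies the error bound with high probability
    ∀ Ahat : ℕ → Ω → MLRHAR.Tensor3 N P,
      (∀ ω, Ahat 0 ω ∈ MLRHAR.tuckerSet N P r') →
      (∀ k ω, MLRHAR.IsPGDStep (MLRHAR.loss T (fun n i => y n ω i + η n ω i))
        (2 / (3 * MLRHAR.kappaU A Sig)) r' (Ahat k ω) (Ahat (k + 1) ω)) →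
      ∃ E : Set Ω, MeasurableSet E ∧
        1 - Real.exp (-(c * (MLRHAR.tuckerDim N P (r + r') : ℝ)))
          - 2 * Real.exp (-(c * T * (MLRHAR.kappaL A Sig / MLRHAR.kappaU A Sig) ^ 2
              * min (((κ : ℝ) ^ 2)⁻¹) (((κ : ℝ) ^ 4)⁻¹))) ≤ Pr.real E ∧
        ∀ ω ∈ E, ∀ K : ℕ,
          ‖Ahat K ω - A‖ ≤
            (1 - MLRHAR.kappaL A Sig / (24 * MLRHAR.kappaU A Sig)) ^ K * ‖Ahat 0 ω - A‖
            + C / MLRHAR.kappaL A Sig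
              * MLRHAR.statError A Sig κ δ (MLRHAR.tuckerDim N P (r + r')) T m := by
  have hG := MLRHAR.one_le_gramConst P
  have hG0 : 0 < MLRHAR.gramConst P := by linarith
  -- The first constant comes from beating the net in the Gram event, `980 = 14 · 70` combines the
  -- constants of the convergence theorem and of the noise level, and `6400 C₀/kL` is the constant
  -- in the Markov bound.
  refine ⟨28 * (P + 1) * MLRHAR.gramConst P, 980 * (P + 2), 1 / (4 * MLRHAR.gramConst P),
    by positivity, by positivity, by positivity, fun C₀ kL hC₀ hkL =>
    ⟨1, 6400 * C₀ / kL, one_pos, by positivity, ?_⟩⟩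
  intro Ω _ Pr _ N T m r r' κ δ A Sig S ξ y η hN hδ hA hdet hSig hS hSS hξ hy hη _ hkl hr hT hm1 hm2
  have hSdet : S.det ≠ 0 := by
    have h1 : 0 < Sig.det := hSig.det_pos
    rw [← hSS, Matrix.det_mul] at h1
    exact fun h0 => by simp [h0] at h1
  -- The open disc is excluded by hypothesis, the unit circle by stationarity.
  have hst : ∀ z : ℂ, ‖z‖ ≤ 1 → (MLRHAR.charPoly A z).det ≠ 0 := fun z hz =>
    hz.lt_or_eq.elim (hdet z) (hy.det_charPoly_ne_zero hP hξ hSdet)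
  have hmin : 0 < MLRHAR.muMin A := MLRHAR.muMin_pos hN A fun z => hst z (Circle.norm_coe z).le
  have hkl0 : 0 < MLRHAR.kappaL A Sig := hkL.trans_le hkl
  have hklu := MLRHAR.kappaL_le_kappaU hN hSig.1 hmin hkl0
  set kl := MLRHAR.kappaL A Sig with hkld
  set ku := MLRHAR.kappaU A Sig with hkud
  set d := MLRHAR.tuckerDim N P (r + r') with hd
  have hku : 0 < ku := hkl0.trans_le hklu
  have hrate : 0 < kl / (24 * ku) ∧ kl / (24 * ku) < 1 :=
    ⟨by positivity, (div_lt_one (by positivity)).2 (by linarith)⟩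
  refine ⟨⟨by linarith [hrate.2], by linarith [hrate.1]⟩, fun Ahat _ hstep => ?_⟩
  have hstat : (κ : ℝ) ^ 2 * √(MLRHAR.lambdaMax Sig * ku) * √((d : ℝ) / T)
      ≤ MLRHAR.statError A Sig κ δ d T m := MLRHAR.le_statError A Sig κ.coe_nonneg δ d T m
  have hstat0 : 0 ≤ MLRHAR.statError A Sig κ δ d T m := le_trans (by positivity) hstat
  -- The probabilistic part uses `1 ≤ N ≤ d`, obtained from `q N ≤ d` with `q = r 0 + r' 0`. For `q
  -- = 0` the target and all iterates after the start vanish, so the bound holds surely.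
  rcases Nat.eq_zero_or_pos (r 0 + r' 0) with hq | hq
  · refine ⟨Set.univ, MeasurableSet.univ, ?_, fun ω _ K => MLRHAR.pgd_rank_zero hA hq
      (fun k => hstep k ω) (by linarith [hrate.2]) (by positivity) K⟩
    rw [measureReal_def, measure_univ, ENNReal.toReal_one]
    have h1 := MLRHAR.failure_le (d := d) (T := T) (x := kl / ku) (κ := κ) (p := 0) hG
      (Nat.cast_nonneg _) (Nat.cast_nonneg _) (by positivity)
    linarith
  · have hqd : (r 0 + r' 0) * N ≤ d := by
      rw [hd, MLRHAR.tuckerDim]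
      simp only [Pi.add_apply]
      rw [mul_comm]
      omega
    obtain ⟨hT0, B, hBm, hBp, hB⟩ := MLRHAR.exists_good_event hN hP hst hSig hS.1 hSS hξ hy hC₀ hη
      hkL hkl hq hqd (by
        refine le_trans ?_ hT
        gcongr
        exact le_max_right _ _) (by rwa [one_mul] at hm1) hm2
    refine ⟨Bᶜ, hBm.compl, ?_, fun ω hω K => ?_⟩
    · rw [probReal_compl_eq_one_sub hBm]
      have h1 := MLRHAR.failure_le hG (Nat.cast_nonneg _) (Nat.cast_nonneg _) hBp
      linarith
    · obtain ⟨c1, c2, c3⟩ := hB ω hω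
      have h1 := MLRHAR.pgd_converges hT0 hkl0 hklu hA (fun k => hstep k ω) hr c1 c2
        (by positivity) c3 K
      refine h1.trans (add_le_add_right ?_ _)
      calc _ = 980 * ((P : ℝ) + 2) / kl
            * ((κ : ℝ) ^ 2 * √(MLRHAR.lambdaMax Sig * ku) * √((d : ℝ) / T)) := by ring
        _ ≤ _ := by gcongr
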